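/- Let $\mathbf{B}$ be a 2-element algebra, i.e. the set $\{0,1\}$ with an arbitrary (possibly infinite) family of finitary operations, and let $\mathrm{Clo}(\mathbf{B})$ be its clone of term operations. For clones $\mathcal{C}$ on $\{0,1\}$ write $\mathcal{C}\preceq\mathbf{B}$ if $\mathcal{C}\subseteq\mathrm{Clo}(\mathbf{B})$ and $\mathbf{B}\preceq\mathcal{C}$ if $\mathrm{Clo}(\mathbf{B})\subseteq\mathcal{C}$. Let $\mathsf{MPT}_0^\infty,\ \mathsf{MPT}_1^\infty,\ \mathsf{DM},\ \mathsf{AP},\ \mathsf{A},\ \bigwedge,\ \bigvee,\ \mathsf{U}$ be the clones generated, respectively, by $\{x\wedge(y\vee z)\}$, $\{x\vee(y\wedge z)\}$, $\{\mathrm{maj}(x,y,z)\}$, $\{x+y+z \bmod 2\}$, $\{x\leftrightarrow y,\,0\}$, $\{x\wedge y,\,0,\,1\}$, $\{x\vee y,\,0,\,1\}$, $\{\neg x,\,0\}$. The Hidden Kernel Problem $\mathrm{HKP}(\mathbf{B}^n)$ is the following: given $n$ and, as an oracle, a homomorphism $\varphi$ from $\mathbf{B}^n$ to some algebra $\mathbf{X}$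 similar to $\mathbf{B}$ (the values of $\varphi$ being given by names, i.e. $\mathbf{X}$ comes with a map to $\{0,1\}^n$ that is injective on the range of $\varphi$, and the oracle returns the name of $\varphi(x)$ on input $x\in\{0,1\}^n$), determine the congruence $\ker\varphi=\{(a,b):\varphi(a)=\varphi(b)\}$ of $\mathbf{B}^n$. An algorithm is a fixed program for a random access machine (memory cells holding natural numbers; addition, truncated subtraction, branching and loops; oracle queries; bitwise output); classical algorithms may in addition toss fair coins, and quantum algorithms may moreover apply the gates $X$, $H$, $T$, $\mathrm{CNOT}$ and $|x,y\rangle\mapsto|x,y\oplus\varphi(x)\rangle$ to qubits and measure qubits. It is a polynomial-time algorithm for $\mathrm{HKP}(\mathbf{B}^n)$ if on every instance all its computation branches of nonzero probability halt within a number of steps bounded by a polynomial in $n$, and its output specifies $\ker\varphi$ with probability at least $2/3$. An output format is any rule that assigns to each $n$ and each bit string an equivalence relation on $\{0,1\}^n$; in the generator format the output is a list of pairs in $\{0,1\}^n\times\{0,1\}^n$ and specifies the congruence of $\mathbf{B}^n$ that they generate. Then at least one of the hypotheses of 1, 2, 3 below holds for $\mathbf{B}$, and: 1. If $\mathsf{MPT}_0^\infty\preceq\mathbf{B}$,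 $\mathsf{MPT}_1^\infty\preceq\mathbf{B}$, or $\mathsf{DM}\preceq\mathbf{B}$, then there exist both classical and quantum polynomial-time algorithms for $\mathrm{HKP}(\mathbf{B}^n)$ in the generator format, and the classical one can be taken to be deterministic (no coin tosses, always correct). 2. If $\mathsf{AP}\preceq\mathbf{B}\preceq\mathsf{A}$, then there exists a quantum polynomial-time algorithm for $\mathrm{HKP}(\mathbf{B}^n)$ in the generator format, but for no output format does there exist a classical polynomial-time algorithm. 3. If $\mathbf{B}\preceq\bigwedge$, $\mathbf{B}\preceq\bigvee$, or $\mathbf{B}\preceq\mathsf{U}$, then for no output format does there exist a classical or a quantum polynomial-time algorithm for $\mathrm{HKP}(\mathbf{B}^n)$. -/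

import Mathlib

namespace HKP

/-! ### Clones of operations -/

/-- A finitary operation on `A`: an arity together with a function `A ^ k → A`. -/
abbrev Operation (A : Type*) := Σ k : ℕ, ((Fin k → A) → A)

/-- The clone generated by a set `F` of operations: the smallest set of operations that contains
`F` and the projections and is closed under (generalized) composition. Taking projections for the
inner operations gives permutation and identification of variables and the introduction of
extraneous ones. -/
inductive InClone {A : Type*} (F : Set (Operation A)) : ∀ k : ℕ, ((Fin k → A) → A) → Prop
  | basic {k : ℕ} (f : (Fin k → A) → A) (hf : (⟨k, f⟩ : Operation A) ∈ F) : InClone F k f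
  | proj {k : ℕ} (i : Fin k) : InClone F k (fun x => x i)
  | comp {k m : ℕ} (f : (Fin k → A) → A) (g : Fin k → (Fin m → A) → A)
      (hf : InClone F k f) (hg : ∀ i, InClone F m (g i)) :
      InClone F m (fun x => f (fun i => g i x))

/-- The clone generated by `F`, as a set of operations. -/
def clo {A : Type*} (F : Set (Operation A)) : Set (Operation A) :=
  {f | InClone F f.1 f.2}

/-- The clone of term operations of an algebra with universe `A`, i.e. the clone generated by its
basic operations. An algebra is a structure for a first-order language without relation symbols. -/
def termClone (L : FirstOrder.Language) (A : Type*) [L.Structure A] : Set (Operation A) :=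
  clo {f | ∃ s : L.Functions f.1, f.2 = FirstOrder.Language.Structure.funMap s}

/-- `x ∧ (y ∨ z)` -/
def cloneMPT0 : Set (Operation Bool) := clo {⟨3, fun x => x 0 && (x 1 || x 2)⟩}

/-- `x ∨ (y ∧ z)` -/
def cloneMPT1 : Set (Operation Bool) := clo {⟨3, fun x => x 0 || (x 1 && x 2)⟩}

/-- The majority operation. -/
def cloneDM : Set (Operation Bool) :=
  clo {⟨3, fun x => (x 0 && x 1) || (x 0 && x 2) || (x 1 && x 2)⟩}

/-- `x + y + z` (addition modulo 2) -/
def cloneAP : Set (Operation Bool) := clo {⟨3, fun x => xor (xor (x 0) (x 1)) (x 2)⟩}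

/-- `x ↔ y` and the constant `0` -/
def cloneA : Set (Operation Bool) := clo {⟨2, fun x => x 0 == x 1⟩, ⟨0, fun _ => false⟩}

/-- `x ∧ y` and the constants `0`, `1` -/
def cloneMeet : Set (Operation Bool) :=
  clo {⟨2, fun x => x 0 && x 1⟩, ⟨0, fun _ => false⟩, ⟨0, fun _ => true⟩}

/-- `x ∨ y` and the constants `0`, `1` -/
def cloneJoin : Set (Operation Bool) :=
  clo {⟨2, fun x => x 0 || x 1⟩, ⟨0, fun _ => false⟩, ⟨0, fun _ => true⟩}

/-- `¬ x` and the constant `0` -/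
def cloneU : Set (Operation Bool) := clo {⟨1, fun x => !(x 0)⟩, ⟨0, fun _ => false⟩}

/-! ### Powers, congruences and instances of the Hidden Kernel Problem -/

/-- The power `B ^ n` of a structure `B`, with componentwise operations. -/
instance powerStructure (L : FirstOrder.Language) (B : Type*) [L.Structure B] (n : ℕ) :
    L.Structure (Fin n → B) where
  funMap f x := fun i => FirstOrder.Language.Structure.funMap f (fun j => x j i)
  RelMap r x := ∀ i, FirstOrder.Language.Structure.RelMap r (fun j => x j i)

/-- An equivalence relation that is compatible with all basic operations. -/
def IsCongruence (L : FirstOrder.Language) {A : Type*} [L.Structure A] (r : Setoid A) : Prop :=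
  ∀ (k : ℕ) (f : L.Functions k) (a b : Fin k → A), (∀ i, r (a i) (b i)) →
    r (FirstOrder.Language.Structure.funMap f a) (FirstOrder.Language.Structure.funMap f b)

/-- The congruence generated by a set of pairs. -/
def congruenceGen (L : FirstOrder.Language) {A : Type*} [L.Structure A] (D : Set (A × A)) :
    Setoid A :=
  sInf {r | IsCongruence L r ∧ ∀ p ∈ D, r p.1 p.2}

/-- An instance of the Hidden Kernel Problem for `B ^ n`, where `B` is an algebra with universe
`{0, 1}`: a homomorphism `φ` from `B ^ n` to a similar algebra `X`, together with names
in `{0, 1} ^ n` for the elements of `X` that `φ` takes as values. (There are at most `2 ^ n` of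
them, so that names of length `n` suffice.) -/
structure Instance (L : FirstOrder.Language) [L.Structure Bool] (n : ℕ) where
  X : Type
  [str : L.Structure X]
  φ : L.Hom (Fin n → Bool) X
  name : X → Fin n → Bool
  name_injOn : Set.InjOn name (Set.range φ)

/-- The black box that is handed to the algorithm: it returns the name of `φ x`. -/
def Instance.oracle {L : FirstOrder.Language} [L.Structure Bool] {n : ℕ} (I : Instance L n) :
    (Fin n → Bool) → (Fin n → Bool) :=
  letI := I.str
  fun x => I.name (I.φ x)

/-- The kernel of the homomorphism, which the algorithm has to determine. -/
def Instance.kernel {L : FirstOrder.Language} [L.Structure Bool] {n : ℕ} (I : Instance L n) :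
    Setoid (Fin n → Bool) :=
  letI := I.str
  Setoid.ker I.φ

/-- An output format: it says, for each `n`, which equivalence relation on `{0, 1} ^ n` a given
bit string specifies. -/
abbrev OutputFormat := ∀ n : ℕ, List Bool → Setoid (Fin n → Bool)

/-- The output format in which a congruence of `B ^ n` is specified by a list of pairs that generate
it. The bit string is cut into blocks of length `2 n`; each block consists of the two
components of a pair (an incomplete last block is ignored). -/
def generatorFormat (L : FirstOrder.Language) [L.Structure Bool] : OutputFormat := fun n l =>
  congruenceGen L
    {p | ∃ j : ℕ, 2 * n * (j + 1) ≤ l.length ∧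
      ∀ i : Fin n, p.1 i = l.getD (2 * n * j + i) false ∧
        p.2 i = l.getD (2 * n * j + n + i) false}

/-! ### Quantum registers

Qubits are numbered by `0, 1, 2, …`. A computational basis state is given by the finite set of
qubits that are in state `1`, and a (not necessarily normalized) quantum state is a finite
linear combination of basis states. -/

/-- Quantum states. -/
abbrev QState := Finset ℕ →₀ ℂ

/-- Elementary gates, acting on qubits with addresses in `α`: the Pauli gate `X`, the Hadamard gate
`H`, the `π/8` gate `T`, the controlled `NOT` gate, and the oracle gate. -/
inductive Gate (α : Type)
  | x (q : α)
  | h (q : α)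
  | t (q : α)
  | cnot (c q : α)
  | oracle

/-- The change of addresses. -/
def Gate.map {α β : Type} (f : α → β) : Gate α → Gate β
  | .x q => .x (f q)
  | .h q => .h (f q)
  | .t q => .t (f q)
  | .cnot c q => .cnot (f c) (f q)
  | .oracle => .oracle

/-- The action of a gate on a basis state. For an oracle `F` on `{0, 1} ^ n`, the oracle gate acts on
the qubits `0, …, n - 1` (query register) and `n, …, 2 n - 1` (answer register) by
`|x, y⟩ ↦ |x, y + F x⟩`. A controlled `NOT` whose two qubits coincide does nothing. -/
noncomputable def Gate.onBasis {n : ℕ} (F : (Fin n → Bool) → (Fin n → Bool)) :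
    Gate ℕ → Finset ℕ → QState
  | .x q, s => Finsupp.single (symmDiff s {q}) 1
  | .h q, s => ((1 / Real.sqrt 2 : ℝ) : ℂ) •
      (Finsupp.single (s.erase q) 1 + Finsupp.single (insert q s) (if q ∈ s then -1 else 1))
  | .t q, s => Finsupp.single s (if q ∈ s then Complex.exp (Complex.I * (Real.pi / 4 : ℝ)) else 1)
  | .cnot c q, s => Finsupp.single (if c ∈ s ∧ c ≠ q then symmDiff s {q} else s) 1
  | .oracle, s => Finsupp.single
      (symmDiff s ((Finset.univ.filter fun i : Fin n => F (fun j => decide (j.1 ∈ s)) i = true).image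
        fun i => n + i.1)) 1

/-- The action of a gate on quantum states, by linear extension. -/
noncomputable def Gate.apply {n : ℕ} (F : (Fin n → Bool) → (Fin n → Bool)) (g : Gate ℕ) :
    QState →ₗ[ℂ] QState :=
  Finsupp.linearCombination ℂ (Gate.onBasis F g)

/-- The squared norm of a quantum state. -/
noncomputable def QState.normSq (ψ : QState) : ℝ := ψ.sum fun _ a => ‖a‖ ^ 2

/-! ### Programs

The machine model is a random access machine whose memory consists of two-dimensional arrays of
natural numbers and which also controls a quantum register. The arithmetic operations are addition
and truncated subtraction only, so that after `T` steps all numbers have `O(T)` bits and unit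
costs are polynomially equivalent to Turing machine time. A program is a fixed finite text, the same
for all input sizes. -/

/-- Arithmetic expressions. `size` is the input size `n`, and `get a i j` is the entry with indices
`(i, j)` of array number `a`. -/
inductive Expr
  | const (c : ℕ)
  | size
  | get (a : ℕ) (i j : Expr)
  | add (e₁ e₂ : Expr)
  | sub (e₁ e₂ : Expr)

/-- The contents of the memory: array number, then the two indices. -/
abbrev Memory := ℕ → ℕ → ℕ → ℕ

/-- The value of an expression. -/
def Expr.eval (n : ℕ) (m : Memory) : Expr → ℕ
  | .const c => c
  | .size => n
  | .get a i j => m a (i.eval n m) (j.eval n m)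
  | .add e₁ e₂ => e₁.eval n m + e₂.eval n m
  | .sub e₁ e₂ => e₁.eval n m - e₂.eval n m

/-- Overwriting one memory cell. -/
def Memory.write (m : Memory) (a i j v : ℕ) : Memory := fun a' i' j' =>
  if a' = a ∧ i' = i ∧ j' = j then v else m a' i' j'

/-- Elementary instructions.
* `assign a i j e`: `a[i, j] := e`.
* `query a i b k`: evaluate the oracle at the bits `a[i, 0], …, a[i, n - 1]` (a nonzero number is
  read as `1`) and store the bits of the answer in `b[k, 0], …, b[k, n - 1]`.
* `emit e`: append a bit to the output (`1` if `e ≠ 0`).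
* `coin a i j`: store a fair random bit in `a[i, j]`.
* `gate g`: apply a quantum gate.
* `measure q a i j`: measure qubit `q` and store the outcome in `a[i, j]`. -/
inductive Instr
  | assign (a : ℕ) (i j e : Expr)
  | query (a : ℕ) (i : Expr) (b : ℕ) (k : Expr)
  | emit (e : Expr)
  | coin (a : ℕ) (i j : Expr)
  | gate (g : Gate Expr)
  | measure (q : Expr) (a : ℕ) (i j : Expr)

/-- Programs. -/
inductive Program
  | instr (c : Instr)
  | seq (p₁ p₂ : Program)
  | ite (e : Expr) (p₁ p₂ : Program)
  | loop (e : Expr) (p : Program)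

/-- The data that a program acts on. `weight` is the probability of the coin tosses so far. The
quantum state is not renormalized in measurements, so that its squared norm is the probability of the
measurement outcomes so far. -/
structure Data where
  mem : Memory
  out : List Bool
  weight : ℝ
  ψ : QState

/-- The probability with which a computation branch is taken. -/
noncomputable def Data.prob (d : Data) : ℝ := d.weight * QState.normSq d.ψ

/-- The execution of one instruction. The result is the list of possible outcomes; there are two of
them for coin tosses and measurements, and one in all other cases. -/
noncomputable def Instr.exec {n : ℕ} (F : (Fin n → Bool) → (Fin n → Bool)) (d : Data) :
    Instr → List Data
  | .assign a i j e =>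
      [{ d with mem := d.mem.write a (i.eval n d.mem) (j.eval n d.mem) (e.eval n d.mem) }]
  | .query a i b k =>
      [{ d with mem := fun a' i' j' =>
          if h : a' = b ∧ i' = k.eval n d.mem ∧ j' < n then
            (F (fun l => decide (d.mem a (i.eval n d.mem) l.1 ≠ 0)) ⟨j', h.2.2⟩).toNat
          else d.mem a' i' j' }]
  | .emit e => [{ d with out := d.out ++ [decide (e.eval n d.mem ≠ 0)] }]
  | .coin a i j =>
      [{ d with
          mem := d.mem.write a (i.eval n d.mem) (j.eval n d.mem) 0
          weight := d.weight / 2 },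
       { d with
          mem := d.mem.write a (i.eval n d.mem) (j.eval n d.mem) 1
          weight := d.weight / 2 }]
  | .gate g => [{ d with ψ := (g.map (Expr.eval n d.mem)).apply F d.ψ }]
  | .measure q a i j =>
      [{ d with
          mem := d.mem.write a (i.eval n d.mem) (j.eval n d.mem) 0
          ψ := d.ψ.filter fun s => q.eval n d.mem ∉ s },
       { d with
          mem := d.mem.write a (i.eval n d.mem) (j.eval n d.mem) 1
          ψ := d.ψ.filter fun s => q.eval n d.mem ∈ s }]

/-- A configuration: the programs that are still to be executed, one after the other, and the
data. -/
structure Config where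
  control : List Program
  data : Data

/-- One step of the computation; it leads to a list of possible successor configurations. A
configuration in which nothing is left to execute has halted and stays as it is. -/
noncomputable def Config.step {n : ℕ} (F : (Fin n → Bool) → (Fin n → Bool)) :
    Config → List Config
  | ⟨[], d⟩ => [⟨[], d⟩]
  | ⟨.instr c :: k, d⟩ => (c.exec F d).map fun d' => ⟨k, d'⟩
  | ⟨.seq p₁ p₂ :: k, d⟩ => [⟨p₁ :: p₂ :: k, d⟩]
  | ⟨.ite e p₁ p₂ :: k, d⟩ => [⟨(if e.eval n d.mem ≠ 0 then p₁ else p₂) :: k, d⟩]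
  | ⟨.loop e p :: k, d⟩ => [⟨if e.eval n d.mem ≠ 0 then p :: .loop e p :: k else k, d⟩]

/-- All computation branches of length `T` that start in a given configuration. -/
noncomputable def Config.run {n : ℕ} (F : (Fin n → Bool) → (Fin n → Bool)) :
    ℕ → Config → List Config
  | 0, c => [c]
  | T + 1, c => (c.step F).flatMap (Config.run F T)

/-- A configuration has halted if nothing is left to execute. -/
def Config.Halted (c : Config) : Prop := c.control = []

/-- The initial configuration: all memory cells are `0`, the output is empty, and all qubits are in
state `0`. -/
noncomputable def Program.init (p : Program) : Config :=
  ⟨[p], ⟨fun _ _ _ => 0, [], 1, Finsupp.single ∅ 1⟩⟩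

open Classical in
/-- The total probability of those of the listed branches that satisfy `E`. -/
noncomputable def branchProb (cs : List Config) (E : Config → Prop) : ℝ :=
  (cs.map fun c => if E c then c.data.prob else 0).sum

/-- A program is classical if it does not use the quantum register. It may toss coins. -/
def Program.IsClassical : Program → Prop
  | .instr (.gate _) => False
  | .instr (.measure _ _ _ _) => False
  | .instr _ => True
  | .seq p₁ p₂ => p₁.IsClassical ∧ p₂.IsClassical
  | .ite _ p₁ p₂ => p₁.IsClassical ∧ p₂.IsClassical
  | .loop _ p => p.IsClassical

/-- A program is deterministic if it uses neither the quantum register nor coin tosses. -/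
def Program.IsDeterministic : Program → Prop
  | .instr (.gate _) => False
  | .instr (.measure _ _ _ _) => False
  | .instr (.coin _ _ _) => False
  | .instr _ => True
  | .seq p₁ p₂ => p₁.IsDeterministic ∧ p₂.IsDeterministic
  | .ite _ p₁ p₂ => p₁.IsDeterministic ∧ p₂.IsDeterministic
  | .loop _ p => p.IsDeterministic

/-! ### Polynomial-time algorithms for the Hidden Kernel Problem -/

/-- The program `P` solves the Hidden Kernel Problem for the powers `B ^ n` of an algebra `B` with
universe `{0, 1}` in polynomial time, with success probability at least `δ`: on every instance, all
computation branches that occur with nonzero probability halt within a number of steps that is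
bounded by a polynomial in `n`, and with probability at least `δ` the output specifies
the kernel of the homomorphism. -/
def SolvesInPolyTime (L : FirstOrder.Language) [L.Structure Bool] (fmt : OutputFormat) (δ : ℝ)
    (P : Program) : Prop :=
  ∃ p : Polynomial ℕ, ∀ (n : ℕ) (I : Instance L n),
    (∀ c ∈ P.init.run I.oracle (p.eval n), c.data.prob ≠ 0 → c.Halted) ∧
    δ ≤ branchProb (P.init.run I.oracle (p.eval n))
      (fun c => c.Halted ∧ fmt n c.data.out = I.kernel)

/-- There is a deterministic classical polynomial-time algorithm. -/
def HasDeterministicAlgorithm (L : FirstOrder.Language) [L.Structure Bool] (fmt : OutputFormat) :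
    Prop :=
  ∃ P : Program, P.IsDeterministic ∧ SolvesInPolyTime L fmt 1 P

/-- There is a classical polynomial-time algorithm, which may be randomized with bounded error. -/
def HasClassicalAlgorithm (L : FirstOrder.Language) [L.Structure Bool] (fmt : OutputFormat) :
    Prop :=
  ∃ P : Program, P.IsClassical ∧ SolvesInPolyTime L fmt (2 / 3) P

/-- There is a quantum polynomial-time algorithm with bounded error. -/
def HasQuantumAlgorithm (L : FirstOrder.Language) [L.Structure Bool] (fmt : OutputFormat) :
    Prop :=
  ∃ P : Program, SolvesInPolyTime L fmt (2 / 3) P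

end HKP

namespace HKP

/-! ### The part of Post's lattice that is needed -/

/-! The trichotomy is the coarse part of Post's lattice (`clone_trichotomy`). A clone with `∧`
either contains `x ∧ (y ∨ z)` or consists of constants and conjunctions; dually for `∨`. A clone
with neither may contain majority. If not, but it contains minority, all its operations are affine;
and if it contains none of the four operations, all its operations are essentially unary.

Case 1. Each of the three generators is a term `t` with `t(p,p,q) = p` for which `t(c,¬c,·)` is not
constant (`IsSeparating`). Applied to a related pair that differs in coordinate `i`, such a term
relates all pairs that differ only in `i`. A congruence is therefore given by the set of coordinates
it ignores, and the queries at zero and at the `n` unit vectors find this set.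

Case 2. In the presence of minority a congruence is the coset partition of a subgroup of `(ℤ/2)^n`,
so this is a hidden subgroup problem and Simon's algorithm applies. The overlap of a state with its
translates is carried by the Hadamard gates into the Fourier coefficients of the sample
distribution, so these are 1 at periods and 0 elsewhere, up to normalization
(`sum_chi_sampleState`). The program maintains generators of the annihilator of all samples seen. A
period never leaves it, and a non-period survives each round with probability one half; the weighted
count `failBound` of errors is thus preserved on average and shows that `n + 2` rounds fail with
probability at most 1/4. Classically, the subgroup `{0,h}` is hidden behind a random permutation: a
run that never queries two points of one coset behaves as on an injective oracle, and `T` queries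
can meet the cosets of at most `T²` vectors `h` (`card_perm_le`, `not_hasClassicalAlgorithm`).

Case 3. The problem contains unstructured search. On `B^(2m)` there are `2^m` instances, indexed by
the balanced strings, whose oracles differ from a fixed oracle, and each query point tells at most
two of them apart from it. The hybrid argument (`hybrid`, `not_hasQuantumAlgorithm`) then forces a
number of steps of order `2^(m/2)`. For semilattices the instances collapse an absorbing set, with
or without one further balanced string; for unary algebras they glue one balanced string to zero and
its complement to the all-ones string.

The algorithms are verified in a program logic (`Tri`) that bounds the running time and whose
postcondition carries a real-valued function, a lower bound for the success probability that
remains; the argument for Simon's algorithm is an invariant of this kind. -/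

/-- A family of operations that contains the projections and is closed under composition. -/
structure IsClone (C : ∀ k : ℕ, ((Fin k → Bool) → Bool) → Prop) : Prop where
  proj : ∀ {k : ℕ} (i : Fin k), C k (fun x => x i)
  comp : ∀ {k m : ℕ} (f : (Fin k → Bool) → Bool) (g : Fin k → (Fin m → Bool) → Bool),
    C k f → (∀ i, C m (g i)) → C m (fun x => f (fun i => g i x))

theorem isClone_inClone (F : Set (Operation Bool)) : IsClone (InClone F) :=
  ⟨InClone.proj, InClone.comp⟩

namespace IsClone

variable {C : ∀ k : ℕ, ((Fin k → Bool) → Bool) → Prop}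

theorem comp1 (hC : IsClone C) {m : ℕ} {f : (Fin 1 → Bool) → Bool} {g : (Fin m → Bool) → Bool}
    (hf : C 1 f) (hg : C m g) : C m (fun x => f ![g x]) := by
  have := hC.comp f ![g] hf (by intro i; fin_cases i; exact hg)
  convert this using 3 with x
  ext i; fin_cases i; rfl

theorem comp2 (hC : IsClone C) {m : ℕ} {f : (Fin 2 → Bool) → Bool}
    {g h : (Fin m → Bool) → Bool} (hf : C 2 f) (hg : C m g) (hh : C m h) :
    C m (fun x => f ![g x, h x]) := by
  have := hC.comp f ![g, h] hf (by intro i; fin_cases i; exacts [hg, hh])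
  convert this using 3 with x
  ext i; fin_cases i <;> rfl

theorem comp3 (hC : IsClone C) {m : ℕ} {f : (Fin 3 → Bool) → Bool}
    {g h l : (Fin m → Bool) → Bool} (hf : C 3 f) (hg : C m g) (hh : C m h) (hl : C m l) :
    C m (fun x => f ![g x, h x, l x]) := by
  have := hC.comp f ![g, h, l] hf (by intro i; fin_cases i; exacts [hg, hh, hl])
  convert this using 3 with x
  ext i; fin_cases i <;> rfl

theorem comp4 (hC : IsClone C) {m : ℕ} {f : (Fin 4 → Bool) → Bool}
    {g h l p : (Fin m → Bool) → Bool} (hf : C 4 f) (hg : C m g) (hh : C m h) (hl : C m l)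
    (hp : C m p) : C m (fun x => f ![g x, h x, l x, p x]) := by
  have := hC.comp f ![g, h, l, p] hf (by intro i; fin_cases i; exacts [hg, hh, hl, hp])
  convert this using 3 with x
  ext i; fin_cases i <;> rfl

theorem minor (hC : IsClone C) {k m : ℕ} {f : (Fin k → Bool) → Bool} (hf : C k f)
    (σ : Fin k → Fin m) : C m (fun x => f (fun i => x (σ i))) :=
  hC.comp f _ hf fun i => hC.proj (σ i)

theorem inClone_le (hC : IsClone C) {F : Set (Operation Bool)} (hF : ∀ f ∈ F, C f.1 f.2)
    {k : ℕ} {f : (Fin k → Bool) → Bool} (hf : InClone F k f) : C k f := by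
  induction hf with
  | basic f h => exact hF _ h
  | proj i => exact hC.proj i
  | comp f g _ _ ih1 ih2 => exact hC.comp f g ih1 ih2

end IsClone

/-- Conjunction, disjunction, majority and minority. -/
def opAnd : (Fin 2 → Bool) → Bool := fun x => x 0 && x 1
def opOr : (Fin 2 → Bool) → Bool := fun x => x 0 || x 1
def opMaj : (Fin 3 → Bool) → Bool := fun x => (x 0 && x 1) || (x 0 && x 2) || (x 1 && x 2)
def opMin : (Fin 3 → Bool) → Bool := fun x => xor (xor (x 0) (x 1)) (x 2)
def opMeetJoin : (Fin 3 → Bool) → Bool := fun x => x 0 && (x 1 || x 2)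
def opJoinMeet : (Fin 3 → Bool) → Bool := fun x => x 0 || (x 1 && x 2)

section
variable {C : ∀ k : ℕ, ((Fin k → Bool) → Bool) → Prop}

theorem bool_fun2_ext {f g : (Fin 2 → Bool) → Bool} (h : ∀ a b, f ![a, b] = g ![a, b]) : f = g := by
  funext x
  have : x = ![x 0, x 1] := by ext i; fin_cases i <;> rfl
  rw [this]; exact h _ _

theorem bool_fun3_ext {f g : (Fin 3 → Bool) → Bool}
    (h : ∀ a b c, f ![a, b, c] = g ![a, b, c]) : f = g := by
  funext x
  have : x = ![x 0, x 1, x 2] := by ext i; fin_cases i <;> rfl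
  rw [this]; exact h _ _ _

theorem IsClone.congr2 {f g : (Fin 2 → Bool) → Bool} (hf : C 2 f)
    (h : ∀ a b, f ![a, b] = g ![a, b]) : C 2 g := bool_fun2_ext h ▸ hf

theorem IsClone.congr3 {f g : (Fin 3 → Bool) → Bool} (hf : C 3 f)
    (h : ∀ a b c, f ![a, b, c] = g ![a, b, c]) : C 3 g := bool_fun3_ext h ▸ hf

/-- The binary operations in a clone without conjunction, disjunction and minority are essentially
unary. -/
theorem IsClone.binary (hC : IsClone C) (h1 : ¬ C 2 opAnd) (h2 : ¬ C 2 opOr) (h3 : ¬ C 3 opMin)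
    {b : (Fin 2 → Bool) → Bool} (hb : C 2 b) :
    (b ![false, false] = b ![true, true] →
      b ![false, true] = b ![false, false] ∧ b ![true, false] = b ![false, false]) ∧
    (b ![false, false] ≠ b ![true, true] → b ![true, false] = !b ![false, true]) := by
  have p0 : C 2 (fun x => x 0) := hC.proj 0
  have p1 : C 2 (fun x => x 1) := hC.proj 1
  have q0 : C 3 (fun x => x 0) := hC.proj 0
  have q1 : C 3 (fun x => x 1) := hC.proj 1
  have q2 : C 3 (fun x => x 2) := hC.proj 2
  have sw : C 2 (fun x => b ![x 1, x 0]) := hC.comp2 hb p1 p0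
  have bb : C 2 (fun x => b ![x 0, x 1]) := hC.comp2 hb p0 p1
  -- For every forbidden truth table one of these composites is a conjunction, a disjunction or
  -- minority. For instance `b(b,b)` handles NAND and NOR, `b(x,b(x,y))` turns `x ∧ ¬y` into `x ∧
  -- y`, and `b(b(x,y),z)` is minority for exclusive or and for equivalence.
  have e0 : C 2 (fun x => b ![b ![x 0, x 1], b ![x 0, x 1]]) := hC.comp2 hb bb bb
  have e1 : C 2 (fun x => b ![x 0, b ![x 0, x 1]]) := hC.comp2 hb p0 bb
  have e2 : C 2 (fun x => b ![b ![x 0, x 1], x 1]) := hC.comp2 hb bb p1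
  have e3 : C 2 (fun x => b ![x 1, b ![x 1, x 0]]) := hC.comp2 hb p1 sw
  have e4 : C 2 (fun x => b ![b ![x 1, x 0], x 0]) := hC.comp2 hb sw p0
  have e5 : C 3 (fun x => b ![b ![x 0, x 1], x 2]) := hC.comp2 hb (hC.comp2 hb q0 q1) q2
  have A : ∀ f, C 2 f → ¬ ∀ x y, f ![x, y] = (x && y) := fun f hf h =>
    h1 (IsClone.congr2 hf fun x y => by simp [opAnd, h])
  have O : ∀ f, C 2 f → ¬ ∀ x y, f ![x, y] = (x || y) := fun f hf h =>
    h2 (IsClone.congr2 hf fun x y => by simp [opOr, h])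
  have M : ¬ ∀ x y z, b ![b ![x, y], z] = xor (xor x y) z := fun h =>
    h3 (IsClone.congr3 e5 fun x y z => by simp [opMin, h])
  have Ab := A _ bb
  have A0 := A _ e0
  have A1 := A _ e1
  have A2 := A _ e2
  have O0 := O _ e0
  have O1 := O _ e3
  have O2 := O _ e2
  have O3 := O _ e4
  have O4 := O _ bb
  have O5 := O _ e1
  simp only [Bool.forall_bool, Matrix.cons_val_zero, Matrix.cons_val_one] at Ab A0 A1 A2 O0 O1 O2 O3 O4 O5 M
  generalize hx : b ![false, false] = x at *
  generalize hy : b ![false, true] = y at *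
  generalize hz : b ![true, false] = z at *
  generalize hw : b ![true, true] = w at *
  cases x <;> cases y <;> cases z <;> cases w <;> simp_all
end
end HKP

namespace HKP
section
variable {C : ∀ k : ℕ, ((Fin k → Bool) → Bool) → Prop}

/-- Idempotent self-dual ternary operations in a clone without majority and minority. -/
theorem IsClone.ternary (hC : IsClone C) (h1 : ¬ C 3 opMaj) (h2 : ¬ C 3 opMin)
    {t : (Fin 3 → Bool) → Bool} (ht : C 3 t) (hid : t ![false, false, false] = false)
    (hsd : ∀ a b c, t ![!a, !b, !c] = !t ![a, b, c]) :
    (t ![true, false, false] = true ∧ t ![false, true, false] = false ∧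
        t ![false, false, true] = false) ∨
      (t ![true, false, false] = false ∧ t ![false, true, false] = true ∧
        t ![false, false, true] = false) ∨
      (t ![true, false, false] = false ∧ t ![false, true, false] = false ∧
        t ![false, false, true] = true) := by
  have q0 : C 3 (fun x => x 0) := hC.proj 0
  have q1 : C 3 (fun x => x 1) := hC.proj 1
  have q2 : C 3 (fun x => x 2) := hC.proj 2
  have M : ∀ f, C 3 f → ¬ ∀ x y z, f ![x, y, z] = ((x && y) || (x && z) || (y && z)) :=
    fun f hf h => h1 (IsClone.congr3 hf fun x y z => by simp [opMaj, h])
  have N : ∀ f, C 3 f → ¬ ∀ x y z, f ![x, y, z] = xor (xor x y) z :=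
    fun f hf h => h2 (IsClone.congr3 hf fun x y z => by simp [opMin, h])
  have e : C 3 (fun x => t ![x 0, x 1, x 2]) := hC.comp3 ht q0 q1 q2
  -- By self-duality `t` is determined by its values at the three unit vectors. No value 1 gives
  -- majority, three give minority, one gives a projection. With two of them, substituting `t` for
  -- the argument whose unit vector has value 0 gives majority.
  have e0 : C 3 (fun x => t ![t ![x 0, x 1, x 2], x 1, x 2]) := hC.comp3 ht e q1 q2
  have e1 : C 3 (fun x => t ![x 0, t ![x 0, x 1, x 2], x 2]) := hC.comp3 ht q0 e q2
  have e2 : C 3 (fun x => t ![x 0, x 1, t ![x 0, x 1, x 2]]) := hC.comp3 ht q0 q1 e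
  have M' := M _ e
  have M0 := M _ e0
  have M1 := M _ e1
  have M2 := M _ e2
  have N' := N _ e
  have s1 := hsd true false false
  have s2 := hsd false true false
  have s3 := hsd false false true
  have s4 := hsd false false false
  simp only [Bool.not_true, Bool.not_false] at s1 s2 s3 s4
  simp only [Bool.forall_bool, Matrix.cons_val_zero, Matrix.cons_val_one, Matrix.cons_val] at M' M0 M1 M2 N'
  generalize hx : t ![true, false, false] = x at *
  generalize hy : t ![false, true, false] = y at *
  generalize hz : t ![false, false, true] = z at *
  cases x <;> cases y <;> cases z <;> simp_all

/-- An idempotent self-dual operation in a clone without majority and minority is a projection. -/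
theorem IsClone.projection (hC : IsClone C) (h1 : ¬ C 3 opMaj) (h2 : ¬ C 3 opMin) {k : ℕ}
    {f : (Fin k → Bool) → Bool} (hf : C k f) (hid : f (fun _ => false) = false)
    (hsd : ∀ a, f (fun i => !a i) = !f a) : ∃ i, f = fun x => x i := by
  -- Identifying the variables along `A`, `B` and the rest gives a ternary operation to which
  -- `IsClone.ternary` applies: exactly one of `A`, `B` and the complement of `A ∪ B` has value 1.
  -- So `f` is a finitely additive 0-1 measure on the finite set of variables, which must be
  -- concentrated at a point.
  have key : ∀ A B : Finset (Fin k), Disjoint A B →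
      f (fun i => decide (i ∈ A ∪ B)) = (f (fun i => decide (i ∈ A)) || f (fun i => decide (i ∈ B))) := by
    intro A B hAB
    let σ : Fin k → Fin 3 := fun i => if i ∈ A then 0 else if i ∈ B then 1 else 2
    have e := hC.ternary h1 h2 (hC.minor hf σ)
      (by
        refine Eq.trans (congrArg f (funext fun i => ?_)) hid
        generalize σ _ = j; fin_cases j <;> rfl)
      (by
        intro a b c
        rw [← hsd]; congr 1; funext i
        generalize σ _ = j; fin_cases j <;> rfl)
    have v1 : (fun i => (![true, false, false] : Fin 3 → Bool) (σ i)) = fun i => decide (i ∈ A) := by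
      funext i; simp only [σ]; split_ifs <;> simp_all
    have v2 : (fun i => (![false, true, false] : Fin 3 → Bool) (σ i)) = fun i => decide (i ∈ B) := by
      funext i; simp only [σ]
      split_ifs with hA hB
      · have := Finset.disjoint_left.1 hAB hA
        simp [this]
      · simp_all
      · simp_all
    have v3 : (fun i => (![false, false, true] : Fin 3 → Bool) (σ i)) =
        fun i => !decide (i ∈ A ∪ B) := by
      funext i; simp only [σ]; split_ifs <;> simp_all
    rw [v1, v2, v3, hsd fun i => decide (i ∈ A ∪ B)] at e
    revert e
    generalize f _ = x; generalize f _ = y; generalize f _ = z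
    cases x <;> cases y <;> cases z <;> simp
  have key2 : ∀ A : Finset (Fin k), f (fun i => decide (i ∈ A)) = true →
      ∃ i ∈ A, f (fun j => decide (j = i)) = true := by
    intro A
    induction A using Finset.induction_on with
    | empty => intro h; simp [hid] at h
    | insert i A hi ih =>
      intro h
      rw [Finset.insert_eq, key _ _ (by simpa using hi), Bool.or_eq_true] at h
      rcases h with h | h
      · exact ⟨i, by simp, by simpa using h⟩
      · obtain ⟨j, hj, h⟩ := ih h
        exact ⟨j, by simp [hj], h⟩
  obtain ⟨i, -, hi⟩ := key2 Finset.univ (by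
    have := hsd fun _ => false
    simpa [hid] using this)
  refine ⟨i, ?_⟩
  have key3 : ∀ x : Fin k → Bool, x i = true → f x = true := by
    intro x hx
    have := key {i} ((Finset.univ.filter fun j => x j = true).erase i) (by simp)
    have e : (fun j => decide (j ∈ ({i} ∪ (Finset.univ.filter fun j => x j = true).erase i : Finset (Fin k)))) = x := by
      funext j
      by_cases h : j = i
      · simp [h, hx]
      · simp [h]
    rw [e] at this
    rw [this]; simp [hi]
  funext x
  cases hx : x i
  · have := key3 (fun j => !x j) (by simp [hx])
    rw [hsd] at this; simpa using this
  · exact key3 x hx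

/-- A clone contains conjunction, disjunction, majority or minority, unless all its operations are
essentially unary. -/
theorem IsClone.essentially_unary (hC : IsClone C) (h1 : ¬ C 2 opAnd) (h2 : ¬ C 2 opOr)
    (h3 : ¬ C 3 opMaj) (h4 : ¬ C 3 opMin) {k : ℕ} {f : (Fin k → Bool) → Bool} (hf : C k f) :
    (∃ c, f = fun _ => c) ∨ (∃ i, f = fun x => x i) ∨ ∃ i, f = fun x => !x i := by
  -- `IsClone.binary` is applied to the restriction of `f` to the square formed by zero, one, `a`
  -- and the complement of `a`.
  have key : ∀ {f : (Fin k → Bool) → Bool}, C k f → ∀ a,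
      (f (fun _ => false) = f (fun _ => true) → f a = f (fun _ => false)) ∧
      (f (fun _ => false) ≠ f (fun _ => true) → f (fun i => !a i) = !f a) := by
    intro f hf a
    have := hC.binary h1 h2 h4 (hC.minor hf fun i => if a i then (1 : Fin 2) else 0)
    have v (p q : Bool) : (fun i => (![p, q] : Fin 2 → Bool) (if a i then (1 : Fin 2) else 0)) =
        fun i => if a i then q else p := by
      funext i; split_ifs <;> rfl
    simp only [v, Bool.if_true_right, Bool.if_false_right, ite_self] at this
    refine ⟨fun h => ?_, fun h => ?_⟩
    · simpa using (this.1 h).1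
    · simpa using (this.2 h)
  by_cases hu : f (fun _ => false) = f (fun _ => true)
  · exact Or.inl ⟨_, funext fun a => (key hf a).1 hu⟩
  · cases h0 : f (fun _ => false)
    · obtain ⟨i, hi⟩ := hC.projection h3 h4 hf h0 fun a => (key hf a).2 hu
      exact Or.inr (Or.inl ⟨i, hi⟩)
    · have ht : f (fun _ => true) = false := by simpa [h0] using hu
      -- On the diagonal `f` is negation, so negation belongs to the clone and can be applied to `f`
      -- itself.
      have hn : C k (fun x => !f x) := by
        have hm : C 1 (fun x => f (fun i => x 0)) := hC.minor hf fun _ => 0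
        have := hC.comp1 hm hf
        convert this using 2 with x
        cases f x <;> simp [h0, ht]
      obtain ⟨i, hi⟩ := hC.projection h3 h4 hn (by simp [h0]) fun a => by
        simp [(key hf a).2 hu]
      exact Or.inr (Or.inr ⟨i, funext fun x => by rw [← congrFun hi x]; simp⟩)

/-- A clone that contains conjunction also contains `x ∧ (y ∨ z)`, unless all its operations are
constants and conjunctions of variables. -/
theorem IsClone.meet (hC : IsClone C) (h1 : C 2 opAnd) (h2 : ¬ C 3 opMeetJoin) {k : ℕ}
    {f : (Fin k → Bool) → Bool} (hf : C k f) :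
    (∃ c, f = fun _ => c) ∨ ∃ S : Finset (Fin k), S.Nonempty ∧ f = fun x => decide (∀ i ∈ S, x i = true) := by
  have hand : ∀ {m} {g h : (Fin m → Bool) → Bool}, C m g → C m h → C m (fun x => g x && h x) :=
    fun hg hh => by simpa [opAnd] using hC.comp2 h1 hg hh
  have q0 : C 3 (fun x => x 0) := hC.proj 0
  have q1 : C 3 (fun x => x 1) := hC.proj 1
  have q2 : C 3 (fun x => x 2) := hC.proj 2
  have N : ∀ g, C 3 g → ¬ ∀ x y z, g ![x, y, z] = (x && (y || z)) :=
    fun g hg h => h2 (IsClone.congr3 hg fun x y z => by simp [opMeetJoin, h])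
  by_cases hm : ∃ a b : Fin k → Bool, a ≤ b ∧ f a = true ∧ f b = false
  · exfalso
    obtain ⟨a, b, hab, ha, hb⟩ := hm
    -- For `x = 1` the argument of `f` is `a` when `y = 0`, `b` when `y = 1, z = 0`, and the top
    -- element when `y = z = 1`. The result is `x ∧ ¬y`, or `x ∧ (y → z)` if `f` is true at the top.
    have hl : C 3 (fun x => x 0 && f (fun i => x 0 && if a i then x 0 else if b i then x 1 else x 1 && x 2)) := by
      refine hand q0 (hC.comp f _ hf fun i => hand q0 ?_)
      split_ifs
      exacts [q0, q1, hand q1 q2]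
    obtain ⟨c, hl⟩ : ∃ c, C 3 (fun x => x 0 && if x 1 then (if x 2 then c else false) else true) := by
      refine ⟨f fun _ => true, ?_⟩
      convert hl using 2 with x
      cases h0 : x 0
      · rfl
      · simp only [Bool.true_and]
        cases h1 : x 1
        · refine Eq.trans ha.symm (congrArg f (funext fun i => ?_))
          cases a i <;> simp
        · cases h2 : x 2
          · refine Eq.trans hb.symm (congrArg f (funext fun i => ?_))
            have key : ∀ p q : Bool, p ≤ q →
                (true && if p = true then true else if q = true then true else true && false) = q := by
              decide
            simpa using (key _ _ (hab i))
          · simp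
    -- The two forms yield `x ∧ (y ∨ z)` by de Morgan and by `(y → z) → z`, respectively.
    cases c
    · refine N _ (hC.comp3 hl q0 (hand (hC.comp3 hl q0 q1 q1) (hC.comp3 hl q0 q2 q2)) q0) ?_
      decide
    · refine N _ (hC.comp3 hl q0 (hC.comp3 hl q0 q1 q2) q2) ?_
      decide
  · push Not at hm
    have hmono : ∀ a b : Fin k → Bool, a ≤ b → f a = true → f b = true := by
      intro a b h h'; simpa using hm a b h h'
    by_cases h0 : ∀ a, f a = false
    · exact Or.inl ⟨false, funext h0⟩
    by_cases h1' : f ⊥ = true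
    · exact Or.inl ⟨true, funext fun a => hmono _ a bot_le h1'⟩
    push Not at h0
    obtain ⟨a0, ha0⟩ := h0
    have htop : f ⊤ = true := hmono a0 _ le_top (by simpa using ha0)
    by_cases hcl : ∀ a b, f a = true → f b = true → f (a ⊓ b) = true
    · right
      -- The true points form a principal filter with least element `m`, so `f` is the conjunction
      -- of the variables in the support of `m`. The support is nonempty because `f` is false at the
      -- bottom.
      set m := (Finset.univ.filter fun a => f a = true).inf id with hmdef
      have hfm : f m = true :=
        Finset.inf_induction htop (fun a ha b hb => hcl a b ha hb) (by simp)
      have hiff : ∀ a, f a = true ↔ m ≤ a :=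
        fun a => ⟨fun h => Finset.inf_le (f := id) (by simp [h]), fun h => hmono _ _ h hfm⟩
      refine ⟨Finset.univ.filter fun i => m i = true, ?_, ?_⟩
      · by_contra hne
        rw [Finset.not_nonempty_iff_eq_empty, Finset.filter_eq_empty_iff] at hne
        apply h1'
        rw [hiff]
        intro i
        have := hne (Finset.mem_univ i)
        simp at this
        simp [this]
      · funext x
        rw [Bool.eq_iff_iff, hiff, Pi.le_def, decide_eq_true_iff]
        refine forall_congr' fun i => ?_
        simp only [Finset.mem_filter, Finset.mem_univ, true_and]
        cases m i <;> cases x i <;> decide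
    · exfalso
      push Not at hcl
      obtain ⟨a, b, ha, hb, hab⟩ := hcl
      -- For `x = 1` the four values of `(y, z)` produce the arguments `a ⊓ b`, `b`, `a` and top,
      -- with values 0, 1, 1, 1.
      have hl : C 3 (fun x => x 0 && f (fun i => x 0 && if a i then (if b i then x 0 else x 1) else
          if b i then x 2 else x 1 && x 2)) := by
        refine hand q0 (hC.comp f _ hf fun i => hand q0 ?_)
        split_ifs
        exacts [q0, q1, q2, hand q1 q2]
      refine N _ hl fun x y z => ?_
      simp only [Matrix.cons_val_zero, Matrix.cons_val_one, Matrix.cons_val]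
      cases x
      · rfl
      · cases y <;> cases z
        · refine Bool.eq_false_iff.2 fun h => hab (Eq.trans (congrArg f (funext fun i => ?_)) h)
          simp only [Pi.inf_apply]
          cases a i <;> cases b i <;> rfl
        · refine Eq.trans (congrArg f (funext fun i => ?_)) hb
          cases a i <;> cases b i <;> rfl
        · refine Eq.trans (congrArg f (funext fun i => ?_)) ha
          cases a i <;> cases b i <;> rfl
        · refine Eq.trans (congrArg f (funext fun i => ?_)) htop
          cases a i <;> cases b i <;> rfl

end
end HKP

namespace HKP
section
variable {C : ∀ k : ℕ, ((Fin k → Bool) → Bool) → Prop}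

/-- Operations that are affine over the two-element field. -/
def IsAffine {k : ℕ} (f : (Fin k → Bool) → Bool) : Prop :=
  ∀ a u v : Fin k → Bool, xor (xor (f a) (f fun i => xor (a i) (u i)))
    (xor (f fun i => xor (a i) (v i)) (f fun i => xor (xor (a i) (u i)) (v i))) = false

/-- An idempotent operation `g` with `g (0, y, z, 1) = y ∧ z` generates, together with minority, a
conjunction, a disjunction or majority. -/
theorem IsClone.majority_of_four (hC : IsClone C) (h0 : C 3 opMin) (h1 : ¬ C 2 opAnd)
    (h2 : ¬ C 2 opOr) {g : (Fin 4 → Bool) → Bool} (hg : C 4 g)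
    (hid : ∀ p, g ![p, p, p, p] = p) (hyz : ∀ y z, g ![false, y, z, true] = (y && z)) :
    C 3 opMaj := by
  have q0 : C 3 (fun x => x 0) := hC.proj 0
  have q1 : C 3 (fun x => x 1) := hC.proj 1
  have q2 : C 3 (fun x => x 2) := hC.proj 2
  -- Idempotent binary operations of the clone are projections; applied to all binary minors of `g`,
  -- this makes `g` self-dual.
  have hbin : ∀ b : (Fin 2 → Bool) → Bool, C 2 b → b ![false, false] = false →
      b ![true, true] = true → b ![true, false] = !b ![false, true] := by
    intro b hb h00 h11
    have A : ¬ ∀ x y, b ![x, y] = (x && y) := fun h =>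
      h1 (IsClone.congr2 hb fun x y => by simp [opAnd, h])
    have O : ¬ ∀ x y, b ![x, y] = (x || y) := fun h =>
      h2 (IsClone.congr2 hb fun x y => by simp [opOr, h])
    simp only [Bool.forall_bool, h00, h11] at A O
    revert A O
    generalize b ![true, false] = x; generalize b ![false, true] = y
    revert x y; decide
  have hsd : ∀ x, g (fun i => !x i) = !g x := by
    intro x
    have m := hC.minor hg fun i => if x i then (1 : Fin 2) else 0
    have v (p q : Bool) : (fun i => (![p, q] : Fin 2 → Bool) (if x i then (1 : Fin 2) else 0)) =
        fun i => if x i then q else p := by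
      funext i; split_ifs <;> rfl
    have c (p : Bool) : (fun _ : Fin 4 => p) = ![p, p, p, p] := by
      ext i; fin_cases i <;> rfl
    have := hbin _ m (by simp only [v, ite_self]; rw [c, hid]) (by simp only [v, ite_self]; rw [c, hid])
    simpa [v] using this
  have hsd' : ∀ p q r s, g ![!p, !q, !r, !s] = !g ![p, q, r, s] := by
    intro p q r s
    rw [← hsd]; congr 1; funext i; fin_cases i <;> rfl
  -- This is the only value still needed. If it is 0 then `g(x,y,y,z)` is majority; if it is 1 then
  -- `g(x,y,z,x+y+z)` is.
  cases hc : g ![false, true, true, false]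
  · refine IsClone.congr3 (hC.comp4 hg q0 q1 q1 q2) fun x y z => ?_
    have e1 := hsd' false true true false
    have e2 := hsd' false false false true
    have e3 := hsd' false true true true
    have e4 := hid true
    have e5 := hid false
    simp only [Bool.not_true, Bool.not_false, hyz, hc] at e1 e2 e3
    cases x <;> cases y <;> cases z <;> simp [opMaj, *]
  · refine IsClone.congr3 (hC.comp4 hg q0 q1 q2 (hC.comp3 h0 q0 q1 q2)) fun x y z => ?_
    have e1 := hsd' false true true false
    have e2 := hsd' false false true true
    have e3 := hsd' false true false true
    have e4 := hid true
    have e5 := hid false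
    simp only [Bool.not_true, Bool.not_false, hyz, hc] at e1 e2 e3
    cases x <;> cases y <;> cases z <;> simp [opMaj, opMin, *]

/-- A clone that contains minority but neither conjunction, disjunction nor majority consists of
affine operations. -/
theorem IsClone.affine (hC : IsClone C) (h0 : C 3 opMin) (h1 : ¬ C 2 opAnd)
    (h2 : ¬ C 2 opOr) (h3 : ¬ C 3 opMaj) {k : ℕ} {f : (Fin k → Bool) → Bool} (hf : C k f) :
    IsAffine f := by
  have hmin : ∀ {m} {g h l : (Fin m → Bool) → Bool}, C m g → C m h → C m l →
      C m (fun x => xor (xor (g x) (h x)) (l x)) :=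
    fun hg hh hl => by simpa [opMin] using hC.comp3 h0 hg hh hl
  have q0 : C 4 (fun x => x 0) := hC.proj 0
  have q1 : C 4 (fun x => x 1) := hC.proj 1
  have q2 : C 4 (fun x => x 2) := hC.proj 2
  have q3 : C 4 (fun x => x 3) := hC.proj 3
  have add : ∀ {g l} (c : Bool), C 4 g → C 4 l →
      C 4 (fun x => xor (g x) (c && xor (x 0) (l x))) := by
    intro g l c hg hl
    cases c
    · simpa using hg
    · simpa using hmin hg q0 hl
  intro a u v
  by_contra hne
  -- Minority only provides sums with an odd number of terms. Each coefficient is therefore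
  -- multiplied with `x₀ + l`, which keeps the parity and equals `l` at `x₀ = 0`; the last variable,
  -- set to 1, plays the role of the constant.
  obtain ⟨g, hg, hgs⟩ : ∃ g, C 4 g ∧ ∀ y z, g ![false, y, z, true] =
      f fun i => xor (xor (a i) (y && u i)) (z && v i) := by
    refine ⟨_, hC.comp f (fun i => fun x => xor (xor (xor (x 0) (a i && xor (x 0) (x 3)))
      (u i && xor (x 0) (x 1))) (v i && xor (x 0) (x 2))) hf
      (fun i => add _ (add _ (add _ q0 q3) q1) q2), fun y z => congrArg f (funext fun i => ?_)⟩
    simp only [Matrix.cons_val_zero, Matrix.cons_val_one, Matrix.cons_val, Bool.false_xor, Bool.and_true]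
    cases a i <;> cases u i <;> cases v i <;> cases y <;> cases z <;> rfl
  have hn : xor (xor (g ![false, false, false, true]) (g ![false, true, false, true]))
      (xor (g ![false, false, true, true]) (g ![false, true, true, true])) = true := by
    simp only [hgs]; simpa using hne
  have hu : C 4 (fun x => g ![x 0, x 0, x 0, x 0]) := hC.comp4 hg q0 q0 q0 q0
  -- Adding `x₀ + g(x₀,x₀,x₀,x₀)` makes `g` idempotent. On `x₀ = 0` it adds a constant, so the
  -- second difference is unchanged.
  have hg1 := hmin hg q0 hu
  set g1 : (Fin 4 → Bool) → Bool := fun x => xor (xor (g x) (x 0)) (g ![x 0, x 0, x 0, x 0]) with hg1d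
  have hid1 : ∀ p, g1 ![p, p, p, p] = p := by
    intro p; simp [hg1d]
    cases p <;> cases g _ <;> rfl
  have hn1 : xor (xor (g1 ![false, false, false, true]) (g1 ![false, true, false, true]))
      (xor (g1 ![false, false, true, true]) (g1 ![false, true, true, true])) = true := by
    refine Eq.trans ?_ hn
    simp only [hg1d, Matrix.cons_val_zero]
    generalize g ![false, false, false, true] = p
    generalize g ![false, true, false, true] = q
    generalize g ![false, false, true, true] = r
    generalize g ![false, true, true, true] = s
    generalize g _ = t
    revert p q r s t; decide
  -- At `x₀ = 0, x₃ = 1` the operation is `yz` plus a polynomial of degree at most one, because its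
  -- second difference is 1. The three summands cancel the constant and the coefficients of `z` and
  -- `y`.
  have hg2 := add (g1 ![false, false, false, true]) (add (xor (g1 ![false, false, false, true])
    (g1 ![false, false, true, true])) (add (xor (g1 ![false, false, false, true])
    (g1 ![false, true, false, true])) hg1 q1) q2) q3
  refine h3 (hC.majority_of_four h0 h1 h2 hg2 (fun p => ?_) fun y z => ?_)
  · simp [hid1]
  · revert hn1
    cases y <;> cases z <;> simp only [Matrix.cons_val_zero, Matrix.cons_val_one, Matrix.cons_val] <;>
    · generalize g1 ![false, false, false, true] = p
      generalize g1 ![false, true, false, true] = q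
      generalize g1 ![false, false, true, true] = r
      generalize g1 ![false, true, true, true] = s
      revert p q r s; decide

/-- The clone of the dual operations. -/
def dualClone (C : ∀ k : ℕ, ((Fin k → Bool) → Bool) → Prop) :
    ∀ k : ℕ, ((Fin k → Bool) → Bool) → Prop :=
  fun k f => C k (fun x => !f (fun i => !x i))

theorem IsClone.dual (hC : IsClone C) : IsClone (dualClone C) where
  proj i := by simpa [dualClone] using hC.proj i
  comp f g hf hg := by
    have := hC.comp _ _ hf hg
    simpa [dualClone] using this

/-- A clone that contains disjunction also contains `x ∨ (y ∧ z)`, unless all its operations are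
constants and disjunctions of variables. -/
theorem IsClone.join (hC : IsClone C) (h1 : C 2 opOr) (h2 : ¬ C 3 opJoinMeet) {k : ℕ}
    {f : (Fin k → Bool) → Bool} (hf : C k f) :
    (∃ c, f = fun _ => c) ∨ ∃ S : Finset (Fin k), S.Nonempty ∧ f = fun x => decide (∃ i ∈ S, x i = true) := by
  have hf' : dualClone C k (fun x => !f (fun i => !x i)) := by simpa [dualClone] using hf
  have a1 : dualClone C 2 opAnd := by
    refine (IsClone.congr2 h1 ?_ : C 2 _); decide
  have a2 : ¬ dualClone C 3 opMeetJoin := fun h => h2 (by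
    refine (IsClone.congr3 h ?_ : C 3 _); decide)
  rcases hC.dual.meet a1 a2 hf' with ⟨c, h⟩ | ⟨S, hS, h⟩
  · refine Or.inl ⟨!c, funext fun x => ?_⟩
    have := congrFun h fun i => !x i
    simp at this; simp [← this]
  · refine Or.inr ⟨S, hS, funext fun x => ?_⟩
    have := congrFun h fun i => !x i
    simp only [Bool.not_not] at this
    rw [← Bool.not_inj_iff, this, ← decide_not]
    simp
end

/-! ### Explicit operations belong to the clones of the statement -/

theorem inClone_const {F : Set (Operation Bool)} {c : Bool} (h : InClone F 0 fun _ => c) {k : ℕ} :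
    InClone F k fun _ => c :=
  InClone.comp _ (fun i => i.elim0) h fun i => i.elim0

theorem mem_cloneU {k : ℕ} {f : (Fin k → Bool) → Bool}
    (h : (∃ c, f = fun _ => c) ∨ (∃ i, f = fun x => x i) ∨ ∃ i, f = fun x => !x i) :
    (⟨k, f⟩ : Operation Bool) ∈ cloneU := by
  have hC := isClone_inClone {⟨1, fun x => !(x 0)⟩, (⟨0, fun _ => false⟩ : Operation Bool)}
  have hn : ∀ {m} {g : (Fin m → Bool) → Bool}, InClone {⟨1, fun x => !(x 0)⟩,
      (⟨0, fun _ => false⟩ : Operation Bool)} m g → InClone {⟨1, fun x => !(x 0)⟩,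
      (⟨0, fun _ => false⟩ : Operation Bool)} m (fun x => !g x) := fun hg => by
    simpa using hC.comp1 (InClone.basic (fun x : Fin 1 → Bool => !(x 0)) (by simp)) hg
  have h0 : ∀ m, InClone {⟨1, fun x => !(x 0)⟩, (⟨0, fun _ => false⟩ : Operation Bool)} m
    (fun _ => false) := fun m => inClone_const (InClone.basic _ (by simp))
  rcases h with ⟨c, rfl⟩ | ⟨i, rfl⟩ | ⟨i, rfl⟩
  · cases c
    · exact h0 k
    · exact hn (h0 k)
  · exact InClone.proj i
  · exact hn (InClone.proj i)

theorem mem_cloneMeet {k : ℕ} {f : (Fin k → Bool) → Bool}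
    (h : (∃ c, f = fun _ => c) ∨
      ∃ S : Finset (Fin k), S.Nonempty ∧ f = fun x => decide (∀ i ∈ S, x i = true)) :
    (⟨k, f⟩ : Operation Bool) ∈ cloneMeet := by
  rcases h with ⟨c, rfl⟩ | ⟨S, hS, rfl⟩
  · exact inClone_const (InClone.basic _ (by cases c <;> simp))
  · have hC := isClone_inClone {⟨2, fun x => x 0 && x 1⟩, ⟨0, fun _ => false⟩,
      (⟨0, fun _ => true⟩ : Operation Bool)}
    change InClone _ _ _
    dsimp only
    induction hS using Finset.Nonempty.cons_induction with
    | singleton a => simpa using hC.proj a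
    | cons a s h hs ih =>
      have := hC.comp2 (InClone.basic (fun x : Fin 2 → Bool => x 0 && x 1) (by simp)) (hC.proj a) ih
      simpa [Finset.mem_cons] using this

theorem mem_cloneJoin {k : ℕ} {f : (Fin k → Bool) → Bool}
    (h : (∃ c, f = fun _ => c) ∨
      ∃ S : Finset (Fin k), S.Nonempty ∧ f = fun x => decide (∃ i ∈ S, x i = true)) :
    (⟨k, f⟩ : Operation Bool) ∈ cloneJoin := by
  rcases h with ⟨c, rfl⟩ | ⟨S, hS, rfl⟩
  · exact inClone_const (InClone.basic _ (by cases c <;> simp))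
  · have hC := isClone_inClone {⟨2, fun x => x 0 || x 1⟩, ⟨0, fun _ => false⟩,
      (⟨0, fun _ => true⟩ : Operation Bool)}
    change InClone _ _ _
    dsimp only
    induction hS using Finset.Nonempty.cons_induction with
    | singleton a => simpa using hC.proj a
    | cons a s h hs ih =>
      have := hC.comp2 (InClone.basic (fun x : Fin 2 → Bool => x 0 || x 1) (by simp)) (hC.proj a) ih
      simpa [Finset.mem_cons] using this

theorem mem_cloneA {k : ℕ} {f : (Fin k → Bool) → Bool} (h : IsAffine f) :
    (⟨k, f⟩ : Operation Bool) ∈ cloneA := by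
  set F : Set (Operation Bool) := {⟨2, fun x => x 0 == x 1⟩, ⟨0, fun _ => false⟩} with hF
  have hC := isClone_inClone F
  have heq : InClone F 2 (fun x => x 0 == x 1) := InClone.basic _ (by simp [hF])
  have h0 : ∀ {m}, InClone F m (fun _ => false) := inClone_const (InClone.basic _ (by simp [hF]))
  have hx : ∀ {m} {g l : (Fin m → Bool) → Bool}, InClone F m g → InClone F m l →
      InClone F m (fun x => xor (g x) (l x)) := by
    intro m g l hg hl
    have := hC.comp2 heq (hC.comp2 heq hg hl) h0
    convert this using 2 with x
    simp only [Matrix.cons_val_zero, Matrix.cons_val_one]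
    cases g x <;> cases l x <;> rfl
  have hc : ∀ {m} (c : Bool), InClone F m (fun _ => c) := by
    intro m c
    cases c
    · exact h0
    · simpa using hC.comp2 heq h0 (h0 (m := m))
  -- Variables are switched on one at a time. By affinity, switching on `x_j` adds `c ∧ x_j`, where
  -- `c` is the difference of `f` between zero and the `j`-th unit vector.
  have key : ∀ S : Finset (Fin k), InClone F k (fun x => f fun i => decide (i ∈ S) && x i) := by
    intro S
    induction S using Finset.induction_on with
    | empty => simpa using hc (f fun _ => false)
    | insert j S hj ih =>
      set c := xor (f fun _ => false) (f fun i => decide (i = j))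
      have hcx : InClone F k (fun x => c && x j) := by
        cases c
        · simpa using h0
        · simpa using hC.proj j
      convert hx ih hcx using 2 with x
      have := h (fun _ => false) (fun i => decide (i ∈ S) && x i) (fun i => decide (i = j))
      cases hxj : x j
      · simp only [Bool.and_false, Bool.xor_false]
        congr 1; funext i
        by_cases hij : i = j
        · subst hij; simp [hxj]
        · simp [hij]
      · have e : (fun i => decide (i ∈ insert j S) && x i) =
            fun i => xor (xor false (decide (i ∈ S) && x i)) (decide (i = j)) := by
          funext i
          by_cases hij : i = j
          · subst hij; simp [hxj, hj]
          · simp [hij]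
        rw [e]
        simp only [Bool.false_xor, c] at this ⊢
        revert this
        generalize f _ = p; generalize f _ = q; generalize f _ = r; generalize f _ = s
        revert p q r s; decide
  change InClone F k f
  simpa using key Finset.univ

/-- Every clone of Boolean operations falls into one of three cases. -/
theorem clone_trichotomy (F : Set (Operation Bool)) :
    (cloneMPT0 ⊆ clo F ∨ cloneMPT1 ⊆ clo F ∨ cloneDM ⊆ clo F) ∨
      (cloneAP ⊆ clo F ∧ clo F ⊆ cloneA) ∨
      (clo F ⊆ cloneMeet ∨ clo F ⊆ cloneJoin ∨ clo F ⊆ cloneU) := by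
  have hC := isClone_inClone F
  have gen : ∀ g : Operation Bool, InClone F g.1 g.2 → clo {g} ⊆ clo F := by
    intro g hg f hf
    exact hC.inClone_le (F := {g}) (fun f hf => by obtain rfl := hf; exact hg) hf
  by_cases hA : InClone F 2 opAnd
  · by_cases h : InClone F 3 opMeetJoin
    · exact Or.inl (Or.inl (gen ⟨3, _⟩ h))
    · exact Or.inr (Or.inr (Or.inl fun f hf => mem_cloneMeet (hC.meet hA h hf)))
  by_cases hO : InClone F 2 opOr
  · by_cases h : InClone F 3 opJoinMeet
    · exact Or.inl (Or.inr (Or.inl (gen ⟨3, _⟩ h)))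
    · exact Or.inr (Or.inr (Or.inr (Or.inl fun f hf => mem_cloneJoin (hC.join hO h hf))))
  by_cases hM : InClone F 3 opMaj
  · exact Or.inl (Or.inr (Or.inr (gen ⟨3, _⟩ hM)))
  by_cases hN : InClone F 3 opMin
  · exact Or.inr (Or.inl ⟨gen ⟨3, _⟩ hN, fun f hf => mem_cloneA (hC.affine hN hA hO hM hf)⟩)
  · exact Or.inr (Or.inr (Or.inr (Or.inr fun f hf =>
      mem_cloneU (hC.essentially_unary hA hO hM hN hf))))
end HKP

namespace HKP

open FirstOrder

/-! ### Congruences and instances -/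

/-- Compatibility of an equivalence relation on `{0, 1} ^ n` with an operation on `{0, 1}`. -/
def Compatible {n : ℕ} (r : Setoid (Fin n → Bool)) {k : ℕ} (f : (Fin k → Bool) → Bool) : Prop :=
  ∀ a b : Fin k → Fin n → Bool, (∀ i, r (a i) (b i)) →
    r (fun j => f fun i => a i j) (fun j => f fun i => b i j)

theorem Compatible.of_inClone {n : ℕ} {r : Setoid (Fin n → Bool)} {S : Set (Operation Bool)}
    (hS : ∀ f ∈ S, Compatible r f.2) {k : ℕ} {f : (Fin k → Bool) → Bool} (hf : InClone S k f) :
    Compatible r f := by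
  induction hf with
  | basic f h => exact hS _ h
  | proj i => exact fun a b h => h i
  | comp f g _ _ ih1 ih2 => exact fun a b h => ih1 _ _ fun i => ih2 i a b h

variable {L : Language}

theorem congruenceGen_rel {A : Type*} [L.Structure A] {D : Set (A × A)} {p : A × A} (hp : p ∈ D) :
    congruenceGen L D p.1 p.2 := by
  intro r hr
  exact hr.2 p hp

theorem congruenceGen_le {A : Type*} [L.Structure A] {D : Set (A × A)} {r : Setoid A}
    (hr : IsCongruence L r) (h : ∀ p ∈ D, r p.1 p.2) : congruenceGen L D ≤ r :=
  sInf_le ⟨hr, h⟩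

theorem isCongruence_congruenceGen {A : Type*} [L.Structure A] (D : Set (A × A)) :
    IsCongruence L (congruenceGen L D) := by
  intro k f a b h s hs
  exact hs.1 k f a b fun i => h i s hs

variable [L.Structure Bool]

theorem isCongruence_of_compatible {n : ℕ} {r : Setoid (Fin n → Bool)} {S : Set (Operation Bool)}
    (hL : termClone L Bool ⊆ clo S) (hS : ∀ f ∈ S, Compatible r f.2) : IsCongruence L r := by
  intro k f a b h
  have : (⟨k, Language.Structure.funMap f⟩ : Operation Bool) ∈ termClone L Bool :=
    InClone.basic _ ⟨f, rfl⟩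
  exact Compatible.of_inClone hS (hL this) a b h

theorem IsCongruence.compatible {n : ℕ} {r : Setoid (Fin n → Bool)} (hr : IsCongruence L r)
    {k : ℕ} {f : (Fin k → Bool) → Bool} (hf : (⟨k, f⟩ : Operation Bool) ∈ termClone L Bool) :
    Compatible r f := by
  refine Compatible.of_inClone ?_ hf
  rintro ⟨k, f⟩ ⟨s, hs⟩ a b h
  dsimp only at s hs a b h ⊢
  subst hs
  exact hr k s a b h

/-- The instance whose oracle is a given function with a compatible kernel. -/
@[reducible] noncomputable def Instance.ofFun [L.IsAlgebraic] {n : ℕ}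
    (F : (Fin n → Bool) → Fin n → Bool)
    (h : IsCongruence L (Setoid.ker F)) : Instance L n :=
  -- The operations are transported to the range of `F` by choosing preimages; the congruence
  -- property makes the choice immaterial there. Points outside the range get arbitrary values,
  -- which no homomorphism identity sees.
  letI str : L.Structure (Fin n → Bool) :=
    { funMap := fun {k} f x =>
        F ((powerStructure L Bool n).funMap f fun i => Function.invFun F (x i))
      RelMap := fun _ _ => False }
  { X := Fin n → Bool
    str := str
    φ := @Language.Hom.mk L _ _ (powerStructure L Bool n) str F
      (fun f x => h _ f x _ fun i => (Function.invFun_eq (f := F) ⟨x i, rfl⟩).symm)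
      (fun r => isEmptyElim r)
    name := id
    name_injOn := Function.injective_id.injOn }

theorem Instance.isCongruence_kernel {n : ℕ} (I : Instance L n) : IsCongruence L I.kernel := by
  let := I.str
  intro k f a b h
  change I.φ _ = I.φ _
  rw [I.φ.map_fun, I.φ.map_fun]
  congr 1
  exact funext h

theorem Instance.kernel_iff {n : ℕ} (I : Instance L n) (a b : Fin n → Bool) :
    I.kernel a b ↔ I.oracle a = I.oracle b := by
  let := I.str
  exact ⟨fun h => congrArg I.name h, fun h => I.name_injOn ⟨a, rfl⟩ ⟨b, rfl⟩ h⟩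

/-- The congruences of the powers of `B` are determined by their restrictions to the coordinates if
`B` has a ternary term operation that is able to separate the coordinates. -/
structure IsSeparating (t : (Fin 3 → Bool) → Bool) (c : Bool) : Prop where
  fst : ∀ p q, t ![p, p, q] = p
  ne : t ![c, !c, true] ≠ t ![c, !c, false]

/-- Apply `t` to `(x, y, a)` and to `(x, y, b)`. Away from `i` the first two arguments agree, so
both results equal `x` there. At `i` the third argument decides, and since `a i ≠ b i` the two
results are `x` and `y` in some order. -/
theorem IsSeparating.rel {t : (Fin 3 → Bool) → Bool} {c : Bool} (ht : IsSeparating t c) {n : ℕ}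
    {r : Setoid (Fin n → Bool)} (hr : Compatible r t) {a b : Fin n → Bool} (hab : r a b) {i : Fin n}
    (hi : a i ≠ b i) {x y : Fin n → Bool} (hxy : ∀ j, j ≠ i → x j = y j) : r x y := by
  wlog hx : x i = c generalizing x y
  · by_cases hy : y i = c
    · exact r.symm (this (fun j hj => (hxy j hj).symm) hy)
    · have : x = y := by
        funext j
        by_cases hj : j = i
        · subst hj
          revert hx hy; cases x j <;> cases y j <;> cases c <;> simp
        · exact hxy j hj
      exact this ▸ r.refl x
  by_cases hyc : y i = c
  · have : x = y := by
      funext j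
      by_cases hj : j = i
      · subst hj; rw [hx, hyc]
      · exact hxy j hj
    exact this ▸ r.refl x
  have hy : y i = !c := by revert hyc; cases y i <;> cases c <;> simp
  have h := hr ![x, y, a] ![x, y, b] (by
    intro j; fin_cases j
    exacts [r.refl x, r.refl y, hab])
  have e : ∀ a : Fin n → Bool, (fun j => t fun i => (![x, y, a] : Fin 3 → Fin n → Bool) i j) =
      fun j => t ![x j, y j, a j] := by
    intro a; funext j; congr 1; funext i; fin_cases i <;> rfl
  have e' : ∀ (a : Fin n → Bool) (z : Fin n → Bool), (∀ j, j ≠ i → z j = x j) →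
      t ![c, !c, a i] = z i → (fun j => t ![x j, y j, a j]) = z := by
    intro a z hz hzi
    funext j
    by_cases hj : j = i
    · subst hj; rw [hx, hy]; exact hzi
    · rw [← hxy j hj, ht.fst, hz j hj]
  rw [e, e] at h
  have hne := ht.ne
  have hxx : ∀ j, j ≠ i → x j = x j := fun _ _ => rfl
  have hyx : ∀ j, j ≠ i → y j = x j := fun j hj => (hxy j hj).symm
  have hd : t ![c, !c, a i] ≠ t ![c, !c, b i] := by
    revert hne hi
    cases a i <;> cases b i <;> simp <;> exact fun h h' => h h'.symm
  by_cases h1 : t ![c, !c, a i] = c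
  · have h2 : t ![c, !c, b i] = !c := by
      revert h1 hd; cases t ![c, !c, a i] <;> cases t ![c, !c, b i] <;> cases c <;> simp
    rwa [e' a x hxx (by rw [h1, hx]), e' b y hyx (by rw [h2, hy])] at h
  · have h2 : t ![c, !c, b i] = c := by
      revert h1 hd; cases t ![c, !c, a i] <;> cases t ![c, !c, b i] <;> cases c <;> simp
    have h3 : t ![c, !c, a i] = !c := by
      revert h1; cases t ![c, !c, a i] <;> cases c <;> simp
    rw [e' a y hyx (by rw [h3, hy]), e' b x hxx (by rw [h2, hx])] at h
    exact r.symm h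

/-- A congruence is determined by the unit vectors it relates to zero: `x` is changed into `y` one
coordinate at a time. -/
theorem IsSeparating.rel_iff {t : (Fin 3 → Bool) → Bool} {c : Bool} (ht : IsSeparating t c) {n : ℕ}
    {r : Setoid (Fin n → Bool)} (hr : Compatible r t) (x y : Fin n → Bool) :
    r x y ↔ ∀ i, x i ≠ y i → r (fun _ => false) (fun j => decide (j = i)) := by
  constructor
  · intro h i hi
    exact ht.rel hr h hi fun j hj => by simp [hj]
  · intro h
    have key : ∀ S : Finset (Fin n), r x (fun i => if i ∈ S then y i else x i) := by
      intro S
      induction S using Finset.induction_on with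
      | empty => simp
      | insert i S hi ih =>
        refine r.trans ih ?_
        by_cases hxy : x i = y i
        · have : (fun j => if j ∈ insert i S then y j else x j) = fun j => if j ∈ S then y j else x j := by
            funext j
            by_cases hj : j = i
            · subst hj; simp [hxy]
            · simp [hj]
          rw [this]
        · exact ht.rel hr (h i hxy) (i := i) (by simp) fun j hj => by simp [hj]
    simpa using key Finset.univ

/-- In each case `t(c, ¬c, z) = z`: one has `1 ∧ (0 ∨ z) = z`, `0 ∨ (1 ∧ z) = z` and `maj(1, 0, z) =
z`. -/
theorem exists_separating (h : cloneMPT0 ⊆ termClone L Bool ∨ cloneMPT1 ⊆ termClone L Bool ∨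
    cloneDM ⊆ termClone L Bool) : ∃ t c, IsSeparating t c ∧
      (⟨3, t⟩ : Operation Bool) ∈ termClone L Bool := by
  rcases h with h | h | h
  · exact ⟨_, true, ⟨by decide, by decide⟩, h (InClone.basic _ rfl)⟩
  · exact ⟨_, false, ⟨by decide, by decide⟩, h (InClone.basic _ rfl)⟩
  · exact ⟨_, true, ⟨by decide, by decide⟩, h (InClone.basic _ rfl)⟩

/-- By `IsSeparating.rel_iff` it suffices to generate the related unit vectors. Rows of the other
coordinates are zero and contribute trivial pairs, which lets the program always print `n` pairs. -/
theorem IsSeparating.congruenceGen_eq {t : (Fin 3 → Bool) → Bool} {c : Bool}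
    (ht : IsSeparating t c) (hL : (⟨3, t⟩ : Operation Bool) ∈ termClone L Bool) {n : ℕ}
    {r : Setoid (Fin n → Bool)} (hr : IsCongruence L r) {g : Fin n → Fin n → Bool}
    (hg : ∀ i, r (fun _ => false) (fun j => decide (j = i)) → g i = fun j => decide (j = i))
    (hg' : ∀ i, ¬ r (fun _ => false) (fun j => decide (j = i)) → g i = fun _ => false) :
    congruenceGen L (Set.range fun i => ((fun _ => false : Fin n → Bool), g i)) = r := by
  have h0 : ∀ i, r (fun _ => false) (g i) := by
    intro i
    by_cases h : r (fun _ => false) (fun j => decide (j = i))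
    · rw [hg i h]; exact h
    · rw [hg' i h]
  have hle := congruenceGen_le (D := Set.range fun i => ((fun _ => false : Fin n → Bool), g i)) hr
    (by rintro _ ⟨i, rfl⟩; exact h0 i)
  refine le_antisymm hle fun x y hxy => ?_
  rw [ht.rel_iff (hr.compatible hL)] at hxy
  rw [ht.rel_iff ((isCongruence_congruenceGen _).compatible hL)]
  intro i hi
  rw [← hg i (hxy i hi)]
  exact congruenceGen_rel (p := (_, g i)) ⟨i, rfl⟩

/-- The set of sums modulo 2 of the given vectors. -/
inductive XorSpan {n : ℕ} {κ : Type} (g : κ → Fin n → Bool) : (Fin n → Bool) → Prop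
  | zero : XorSpan g fun _ => false
  | add (x : Fin n → Bool) (k : κ) : XorSpan g x → XorSpan g fun j => xor (x j) (g k j)

/-- Translation invariance, from minority applied to `x`, `h` and zero. It makes a congruence the
coset partition of the class of zero. -/
theorem rel_iff_of_minority {n : ℕ} {r : Setoid (Fin n → Bool)} (hr : Compatible r opMin)
    (x y h : Fin n → Bool) : r x y → r (fun j => xor (x j) (h j)) (fun j => xor (y j) (h j)) := by
  intro hxy
  have := hr ![x, h, fun _ => false] ![y, h, fun _ => false] (by
    intro i; fin_cases i
    exacts [hxy, r.refl _, r.refl _])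
  simpa [opMin] using this

theorem congruenceGen_eq_of_minority (hL : (⟨3, opMin⟩ : Operation Bool) ∈ termClone L Bool)
    {n : ℕ} {κ : Type} {r : Setoid (Fin n → Bool)} (hr : IsCongruence L r) {g : κ → Fin n → Bool}
    (hg : ∀ x, r (fun _ => false) x ↔ XorSpan g x) :
    congruenceGen L (Set.range fun i => ((fun _ => false : Fin n → Bool), g i)) = r := by
  refine le_antisymm (congruenceGen_le hr ?_) ?_
  · rintro _ ⟨k, rfl⟩
    exact (hg _).2 (by simpa using XorSpan.add _ k (XorSpan.zero (g := g)))
  · intro x y hxy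
    set s := congruenceGen L (Set.range fun i => ((fun _ => false : Fin n → Bool), g i)) with hs
    have hsc : Compatible s opMin := (isCongruence_congruenceGen _).compatible hL
    have key : ∀ z, XorSpan g z → s (fun _ => false) z := by
      intro z hz
      induction hz with
      | zero => exact s.refl _
      | add z k _ ih =>
        have h1 : s (fun _ => false) (g k) := congruenceGen_rel (p := (_, g k)) ⟨k, rfl⟩
        have := rel_iff_of_minority hsc _ _ (g k) ih
        simp only [Bool.false_xor] at this
        exact s.trans h1 this
    have h1 := rel_iff_of_minority (hr.compatible hL) _ _ x hxy
    simp only [Bool.xor_self] at h1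
    have h2 := rel_iff_of_minority hsc _ _ x (key _ ((hg _).1 h1))
    simpa using h2

end HKP

namespace HKP

/-! ### Quantum gates -/

theorem QState.normSq_eq_sum {ψ : QState} {P : Finset (Finset ℕ)} (h : ψ.support ⊆ P) :
    QState.normSq ψ = ∑ s ∈ P, ‖ψ s‖ ^ 2 :=
  Finsupp.sum_of_support_subset _ h _ (by simp)

theorem QState.normSq_nonneg (ψ : QState) : 0 ≤ QState.normSq ψ :=
  Finset.sum_nonneg fun _ _ => by positivity

theorem QState.normSq_single (s : Finset ℕ) (a : ℂ) :
    QState.normSq (Finsupp.single s a) = ‖a‖ ^ 2 := by simp [QState.normSq]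

/-- The two outcomes of a measurement project to orthogonal parts, so the unnormalized states keep
the total probability. -/
theorem QState.normSq_filter_add (ψ : QState) (p : Finset ℕ → Prop) [DecidablePred p] :
    QState.normSq (ψ.filter fun s => ¬ p s) + QState.normSq (ψ.filter p) = QState.normSq ψ := by
  have h1 : (ψ.filter p).support ⊆ ψ.support := Finset.filter_subset _ _
  have h2 : (ψ.filter fun s => ¬ p s).support ⊆ ψ.support := Finset.filter_subset _ _
  rw [normSq_eq_sum h1, normSq_eq_sum h2, normSq_eq_sum subset_rfl, ← Finset.sum_add_distrib]
  refine Finset.sum_congr rfl fun s _ => ?_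
  by_cases h : p s <;> simp [Finsupp.filter_apply, h]

/-- Weighted form of the triangle inequality. The weight `t` stays free: in the hybrid argument it
is taken of order `1/T`, so that the main term loses only a constant over `T` steps. -/
theorem norm_add_sq_le (a b : ℂ) {t : ℝ} (ht : 0 < t) :
    ‖a + b‖ ^ 2 ≤ (1 + t) * ‖a‖ ^ 2 + (1 + 1 / t) * ‖b‖ ^ 2 := by
  have h1 : ‖a + b‖ ^ 2 ≤ (‖a‖ + ‖b‖) ^ 2 := by gcongr; exact norm_add_le a b
  have h2 : (1 + t) * ‖a‖ ^ 2 + (1 + 1 / t) * ‖b‖ ^ 2 - (‖a‖ + ‖b‖) ^ 2 =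
      (t * ‖a‖ - ‖b‖) ^ 2 / t := by field_simp; ring
  have h3 : 0 ≤ (t * ‖a‖ - ‖b‖) ^ 2 / t := by positivity
  linarith

theorem QState.normSq_add_le (ψ χ : QState) {t : ℝ} (ht : 0 < t) :
    QState.normSq (ψ + χ) ≤ (1 + t) * QState.normSq ψ + (1 + 1 / t) * QState.normSq χ := by
  have h1 : (ψ + χ).support ⊆ ψ.support ∪ χ.support := Finsupp.support_add
  rw [normSq_eq_sum h1, normSq_eq_sum (Finset.subset_union_left (s₂ := χ.support)),
    normSq_eq_sum (Finset.subset_union_right (s₁ := ψ.support)), Finset.mul_sum, Finset.mul_sum,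
    ← Finset.sum_add_distrib]
  exact Finset.sum_le_sum fun s _ => norm_add_sq_le _ _ ht

section
variable {n : ℕ} (F : (Fin n → Bool) → (Fin n → Bool))

theorem Gate.apply_single (g : Gate ℕ) (s : Finset ℕ) (a : ℂ) :
    g.apply F (Finsupp.single s a) = a • g.onBasis F s := by
  simp [Gate.apply]

/-- All gates except Hadamard permute the basis states by an involution, up to phases; this
evaluates their action at a basis state. -/
theorem Gate.apply_of_involutive {g : Gate ℕ} {σ : Finset ℕ → Finset ℕ}
    (hσ : Function.Involutive σ) {c : Finset ℕ → ℂ}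
    (h : ∀ s, g.onBasis F s = Finsupp.single (σ s) (c s)) (ψ : QState) (s : Finset ℕ) :
    g.apply F ψ s = c (σ s) * ψ (σ s) := by
  induction ψ using Finsupp.induction_linear with
  | zero => simp
  | add f g hf hg => simp [hf, hg, mul_add]
  | single t a =>
    rw [Gate.apply_single, h, Finsupp.smul_single, Finsupp.single_apply, Finsupp.single_apply]
    by_cases hts : σ t = s
    · subst hts; simp [hσ t, mul_comm]
    · have : ¬ t = σ s := fun h => hts (by rw [h, hσ])
      simp [hts, this]

theorem Gate.apply_h (q : ℕ) (ψ : QState) (s : Finset ℕ) :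
    (Gate.h q).apply F ψ s = ((1 / Real.sqrt 2 : ℝ) : ℂ) *
      (ψ (s.erase q) + (if q ∈ s then -1 else 1) * ψ (insert q s)) := by
  induction ψ using Finsupp.induction_linear with
  | zero => simp
  | add f g hf hg => simp only [map_add, Finsupp.add_apply, hf, hg]; ring
  | single t a =>
    rw [Gate.apply_single, Gate.onBasis]
    simp only [Finsupp.smul_apply, Finsupp.add_apply, smul_eq_mul, Finsupp.single_apply]
    by_cases hs : q ∈ s <;> by_cases ht : q ∈ t
    · have e1 : ¬ t.erase q = s := fun h => by simp [← h] at hs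
      have e2 : ¬ t = s.erase q := fun h => by simp [h] at ht
      have e3 : insert q t = t := Finset.insert_eq_self.2 ht
      have e4 : insert q s = s := Finset.insert_eq_self.2 hs
      simp only [hs, ht, e1, e2, e3, e4, if_true, if_false]
      split_ifs <;> ring
    · have e1 : ¬ t.erase q = s := fun h => by simp [← h] at hs
      have e2 : insert q t = s ↔ t = s.erase q :=
        ⟨fun h => by rw [← h, Finset.erase_insert ht], fun h => by rw [h, Finset.insert_erase hs]⟩
      have e3 : ¬ t = insert q s := fun h => by simp [h] at ht
      simp only [hs, ht, e1, e2, e3, if_true, if_false]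
      split_ifs <;> ring
    · have e1 : t.erase q = s ↔ t = insert q s :=
        ⟨fun h => by rw [← h, Finset.insert_erase ht], fun h => by rw [h, Finset.erase_insert hs]⟩
      have e2 : ¬ insert q t = s := fun h => by simp [← h] at hs
      have e3 : ¬ t = s.erase q := fun h => by simp [h] at ht
      simp only [hs, ht, e1, e2, e3, if_true, if_false]
      split_ifs <;> ring
    · have e1 : t.erase q = t := Finset.erase_eq_of_notMem ht
      have e2 : ¬ insert q t = s := fun h => by simp [← h] at hs
      have e3 : ¬ t = insert q s := fun h => by simp [h] at ht
      have e4 : s.erase q = s := Finset.erase_eq_of_notMem hs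
      simp only [hs, ht, e1, e2, e3, e4, if_true, if_false]
      split_ifs <;> ring

theorem symmDiff_singleton_involutive (q : ℕ) :
    Function.Involutive fun s : Finset ℕ => symmDiff s {q} := fun s => by
  simp [symmDiff_assoc]

theorem Gate.apply_x (q : ℕ) (ψ : QState) (s : Finset ℕ) :
    (Gate.x q).apply F ψ s = ψ (symmDiff s {q}) := by
  rw [Gate.apply_of_involutive F (symmDiff_singleton_involutive q) (c := fun _ => 1)
    (fun s => rfl), one_mul]

/-- The bit string in the query register of a basis state. -/
def toVec (n : ℕ) (s : Finset ℕ) : Fin n → Bool := fun j => decide (j.1 ∈ s)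

/-- The answer register that corresponds to a bit string. -/
def answer (v : Fin n → Bool) : Finset ℕ :=
  (Finset.univ.filter fun i : Fin n => v i = true).image fun i => n + i.1

theorem mem_answer (v : Fin n → Bool) (q : ℕ) :
    q ∈ answer v ↔ ∃ i : Fin n, v i = true ∧ n + i.1 = q := by simp [answer]

/-- The answer register lies above the query register, so the oracle gate leaves the query intact
and is its own inverse. -/
theorem toVec_symmDiff_answer (s : Finset ℕ) (v : Fin n → Bool) :
    toVec n (symmDiff s (answer v)) = toVec n s := by
  funext j
  have : j.1 ∉ answer v := by
    rw [mem_answer]; rintro ⟨i, -, h⟩; have := j.2; omega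
  simp [toVec, Finset.mem_symmDiff, this]

theorem oracle_involutive :
    Function.Involutive fun s : Finset ℕ => symmDiff s (answer (F (toVec n s))) := fun s => by
  simp [toVec_symmDiff_answer, symmDiff_assoc]

theorem Gate.apply_oracle (ψ : QState) (s : Finset ℕ) :
    (Gate.oracle : Gate ℕ).apply F ψ s = ψ (symmDiff s (answer (F (toVec n s)))) := by
  rw [Gate.apply_of_involutive F (oracle_involutive F) (c := fun _ => 1) (fun s => rfl), one_mul]

theorem normSq_of_perm {ψ χ : QState} {σ : Finset ℕ → Finset ℕ} (hσ : Function.Involutive σ)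
    (h : ∀ s, ‖χ s‖ = ‖ψ (σ s)‖) : QState.normSq χ = QState.normSq ψ := by
  have hs : ∀ s, s ∈ χ.support ↔ σ s ∈ ψ.support := by
    intro s
    rw [Finsupp.mem_support_iff, Finsupp.mem_support_iff, ← norm_ne_zero_iff, h, norm_ne_zero_iff]
  refine Finset.sum_nbij' σ σ (fun s => (hs s).1) (fun s h' => (hs _).2 (by rwa [hσ s]))
    (fun s _ => hσ s) (fun s _ => hσ s) fun s _ => ?_
  simp only [h]

/-- A finite family of basis states that is closed under the flips of one qubit. -/
theorem exists_flip_closed (ψ : QState) (q : ℕ) :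
    ∃ N, q < N ∧ ψ.support ⊆ (Finset.range N).powerset := by
  refine ⟨max (q + 1) ((ψ.support.sup id).sup id + 1), by simp, fun s hs => ?_⟩
  rw [Finset.mem_powerset]
  intro j hj
  have : j ≤ (ψ.support.sup id).sup id :=
    Finset.le_sup (f := id) (Finset.mem_sup.2 ⟨s, hs, hj⟩)
  simp; omega

theorem symmDiff_singleton_of_notMem {s : Finset ℕ} {q : ℕ} (h : q ∉ s) :
    symmDiff s {q} = insert q s := by
  ext j
  by_cases hj : j = q
  · subst hj; simp [Finset.mem_symmDiff, h]
  · simp [Finset.mem_symmDiff, hj]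

theorem symmDiff_singleton_of_mem {s : Finset ℕ} {q : ℕ} (h : q ∈ s) :
    symmDiff s {q} = s.erase q := by
  ext j
  by_cases hj : j = q
  · subst hj; simp [Finset.mem_symmDiff, h]
  · simp [Finset.mem_symmDiff, hj]

/-- Two sums over basis states agree if they agree on pairs of states that differ in one qubit. -/
theorem sum_powerset_eq_of_pair {M : Type*} [AddCommGroup M] [Module ℚ M] {N q : ℕ} (hq : q < N)
    {f g : Finset ℕ → M} (h : ∀ s, q ∉ s → f s + f (insert q s) = g s + g (insert q s)) :
    ∑ s ∈ (Finset.range N).powerset, f s = ∑ s ∈ (Finset.range N).powerset, g s := by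
  have flip : ∀ f : Finset ℕ → M, ∑ s ∈ (Finset.range N).powerset, f (symmDiff s {q}) =
      ∑ s ∈ (Finset.range N).powerset, f s := by
    intro f
    have hm : ∀ s ∈ (Finset.range N).powerset, symmDiff s {q} ∈ (Finset.range N).powerset := by
      intro s hs
      rw [Finset.mem_powerset] at hs ⊢
      refine (Finset.symmDiff_subset_union).trans (Finset.union_subset hs ?_)
      simpa using hq
    exact Finset.sum_nbij' (fun s => symmDiff s {q}) (fun s => symmDiff s {q}) hm hm
      (fun s _ => symmDiff_singleton_involutive q s)
      (fun s _ => symmDiff_singleton_involutive q s) fun s _ => rfl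
  -- Twice the sum is the sum over flipped pairs; the factor 2 is cancelled by rational scalars.
  have key : ∀ f : Finset ℕ → M, (2 : ℚ) • ∑ s ∈ (Finset.range N).powerset, f s =
      ∑ s ∈ (Finset.range N).powerset, (f s + f (symmDiff s {q})) := by
    intro f
    rw [Finset.sum_add_distrib, flip, two_smul]
  refine smul_right_injective M (two_ne_zero (α := ℚ)) ?_
  change (2 : ℚ) • _ = (2 : ℚ) • _
  rw [key, key]
  refine Finset.sum_congr rfl fun s _ => ?_
  by_cases hs : q ∈ s
  · have := h (s.erase q) (by simp)
    rw [Finset.insert_erase hs] at this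
    rw [symmDiff_singleton_of_mem hs, add_comm, this, add_comm]
  · rw [symmDiff_singleton_of_notMem hs, h s hs]

theorem support_apply_h {N q : ℕ} (hq : q < N) {ψ : QState}
    (h : ψ.support ⊆ (Finset.range N).powerset) :
    ((Gate.h q).apply F ψ).support ⊆ (Finset.range N).powerset := by
  intro s hs
  by_contra hN
  rw [Finset.mem_powerset] at hN
  have h0 : ∀ t : Finset ℕ, ¬ t ⊆ Finset.range N → ψ t = 0 := by
    intro t ht
    by_contra h'
    exact ht (Finset.mem_powerset.1 (h (Finsupp.mem_support_iff.2 h')))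
  rw [Finsupp.mem_support_iff, Gate.apply_h, h0, h0] at hs
  · simp at hs
  · exact fun h' => hN ((Finset.subset_insert _ _).trans h')
  · intro h'
    apply hN
    intro j hj
    by_cases hjq : j = q
    · subst hjq; simpa using hq
    · exact h' (Finset.mem_erase.2 ⟨hjq, hj⟩)

theorem sqrt_two_inv_sq : ((1 / Real.sqrt 2 : ℝ) : ℂ) * ((1 / Real.sqrt 2 : ℝ) : ℂ) = 1 / 2 := by
  rw [← Complex.ofReal_mul]
  have : 1 / Real.sqrt 2 * (1 / Real.sqrt 2) = 1 / 2 := by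
    rw [div_mul_div_comm, Real.mul_self_sqrt (by norm_num)]; norm_num
  rw [this]; norm_num

theorem norm_sqrt_two_inv_sq : ‖((1 / Real.sqrt 2 : ℝ) : ℂ)‖ ^ 2 = 1 / 2 := by
  rw [Complex.norm_real, Real.norm_eq_abs, sq_abs, div_pow, Real.sq_sqrt (by norm_num)]; norm_num

/-- Gates preserve the norm. -/
theorem Gate.normSq_apply (g : Gate ℕ) (ψ : QState) :
    QState.normSq (g.apply F ψ) = QState.normSq ψ := by
  cases g with
  | x q => exact normSq_of_perm (symmDiff_singleton_involutive q) fun s => by rw [Gate.apply_x]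
  | h q =>
    obtain ⟨N, hq, hN⟩ := exists_flip_closed ψ q
    rw [QState.normSq_eq_sum hN, QState.normSq_eq_sum (support_apply_h F hq hN)]
    -- On each pair of basis states that differ in qubit `q`, the claim is the parallelogram law.
    refine sum_powerset_eq_of_pair hq fun s hs => ?_
    simp only [Gate.apply_h, hs, Finset.erase_eq_of_notMem hs, Finset.mem_insert_self,
      Finset.erase_insert hs, Finset.insert_idem, if_true, if_false, norm_mul, mul_pow,
      norm_sqrt_two_inv_sq]
    have := parallelogram_law_with_norm ℝ (ψ s) (ψ (insert q s))
    rw [one_mul, neg_one_mul, ← sub_eq_add_neg]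
    linarith
  | t q =>
    refine normSq_of_perm (σ := id) (fun _ => rfl) fun s => ?_
    rw [Gate.apply_of_involutive F (σ := id) (fun _ => rfl) (fun s => rfl), norm_mul, id]
    split_ifs
    · rw [mul_comm Complex.I, Complex.norm_exp_ofReal_mul_I, one_mul]
    · simp
  | cnot c q =>
    have hinv : Function.Involutive fun s : Finset ℕ =>
        if c ∈ s ∧ c ≠ q then symmDiff s {q} else s := by
      intro s
      by_cases hcq : c = q
      · simp [hcq]
      · by_cases hc : c ∈ s
        · have : c ∈ symmDiff s {q} := by simp [Finset.mem_symmDiff, hc, hcq]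
          simp [hc, hcq, this, symmDiff_assoc]
        · simp [hc]
    refine normSq_of_perm hinv fun s => ?_
    rw [Gate.apply_of_involutive F hinv (c := fun _ => 1) (fun s => rfl), one_mul]
  | oracle => exact normSq_of_perm (oracle_involutive F) fun s => by rw [Gate.apply_oracle]

end
end HKP

namespace HKP

/-! ### Branch probabilities -/

theorem branchProb_nil (E : Config → Prop) : branchProb [] E = 0 := by simp [branchProb]

open Classical in
theorem branchProb_cons (c : Config) (l : List Config) (E : Config → Prop) :
    branchProb (c :: l) E = (if E c then c.data.prob else 0) + branchProb l E := by
  simp [branchProb]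

theorem branchProb_append (l l' : List Config) (E : Config → Prop) :
    branchProb (l ++ l') E = branchProb l E + branchProb l' E := by
  simp [branchProb]

theorem branchProb_flatMap {α : Type*} (l : List α) (g : α → List Config) (E : Config → Prop) :
    branchProb (l.flatMap g) E = (l.map fun c => branchProb (g c) E).sum := by
  induction l with
  | nil => simp [branchProb_nil]
  | cons c l ih => simp [branchProb_append, ih]

theorem list_sum_map_le {α : Type*} {l : List α} {f g : α → ℝ} (h : ∀ x ∈ l, f x ≤ g x) :
    (l.map f).sum ≤ (l.map g).sum := List.sum_le_sum h

section
variable {n : ℕ} (F : (Fin n → Bool) → (Fin n → Bool))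

theorem branchProb_run_succ (T : ℕ) (c : Config) (E : Config → Prop) :
    branchProb (c.run F (T + 1)) E = ((c.step F).map fun c' => branchProb (c'.run F T) E).sum := by
  rw [Config.run, branchProb_flatMap]

theorem Config.step_weight {c c' : Config} (h : 0 ≤ c.data.weight) (hc : c' ∈ c.step F) :
    0 ≤ c'.data.weight := by
  obtain ⟨k, d⟩ := c
  match k with
  | [] => simp [Config.step] at hc; subst hc; exact h
  | .instr i :: k =>
    simp only [Config.step, List.mem_map] at hc
    obtain ⟨d', hd, rfl⟩ := hc
    cases i <;> simp [Instr.exec] at hd <;> (try rcases hd with rfl | rfl) <;> (try subst hd) <;>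
      simp at h ⊢ <;> linarith
  | .seq p q :: k => simp [Config.step] at hc; subst hc; exact h
  | .ite e p q :: k => simp [Config.step] at hc; subst hc; exact h
  | .loop e p :: k => simp [Config.step] at hc; subst hc; exact h

/-- Conservation of probability: coin tosses halve the weight, measurements split the norm, gates
preserve it. -/
theorem Config.step_prob (c : Config) :
    ((c.step F).map fun c' => c'.data.prob).sum = c.data.prob := by
  obtain ⟨k, d⟩ := c
  match k with
  | [] => simp [Config.step]
  | .instr i :: k =>
    cases i with
    | measure q a i j =>
      simp only [Config.step, Instr.exec, List.map_cons, List.map_nil, List.sum_cons,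
        List.sum_nil, Data.prob]
      rw [← QState.normSq_filter_add d.ψ fun s => q.eval n d.mem ∈ s]
      ring
    | coin => simp [Config.step, Instr.exec, Data.prob]; ring
    | gate g => simp [Config.step, Instr.exec, Data.prob, Gate.normSq_apply]
    | assign => simp [Config.step, Instr.exec, Data.prob]
    | query => simp [Config.step, Instr.exec, Data.prob]
    | emit => simp [Config.step, Instr.exec, Data.prob]
  | .seq p q :: k => simp [Config.step]
  | .ite e p q :: k => simp [Config.step]
  | .loop e p :: k => simp [Config.step]

theorem Data.prob_nonneg {d : Data} (h : 0 ≤ d.weight) : 0 ≤ d.prob :=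
  mul_nonneg h (QState.normSq_nonneg _)

open Classical in
theorem branchProb_run_nonneg (T : ℕ) {c : Config} (h : 0 ≤ c.data.weight) (E : Config → Prop) :
    0 ≤ branchProb (c.run F T) E := by
  induction T generalizing c with
  | zero =>
    simp only [Config.run, branchProb_cons, branchProb_nil, add_zero]
    split_ifs
    exacts [Data.prob_nonneg h, le_rfl]
  | succ T ih =>
    rw [branchProb_run_succ]
    refine List.sum_nonneg fun x hx => ?_
    obtain ⟨c', hc', rfl⟩ := List.mem_map.1 hx
    exact ih (Config.step_weight F h hc')

-- Disjoint events share the initial probability. Applied to two different correct answers, it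
-- bounds the probability of a wrong one.
open Classical in
theorem branchProb_run_add_le (T : ℕ) {c : Config} (h : 0 ≤ c.data.weight) {E E' : Config → Prop}
    (hE : ∀ c, E c → ¬ E' c) :
    branchProb (c.run F T) E + branchProb (c.run F T) E' ≤ c.data.prob := by
  induction T generalizing c with
  | zero =>
    have := Data.prob_nonneg h
    simp only [Config.run, branchProb_cons, branchProb_nil, add_zero]
    by_cases h1 : E c
    · simp [h1, hE c h1]
    · by_cases h2 : E' c <;> simp [h1, h2, this]
  | succ T ih =>
    rw [branchProb_run_succ, branchProb_run_succ, ← List.sum_map_add, ← Config.step_prob F c]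
    exact list_sum_map_le fun c' hc' => ih (Config.step_weight F h hc')

theorem branchProb_run_le (T : ℕ) {c : Config} (h : 0 ≤ c.data.weight) (E : Config → Prop) :
    branchProb (c.run F T) E ≤ c.data.prob := by
  have := branchProb_run_add_le F T h (E := E) (E' := fun _ => False) (fun _ _ h => h)
  have h2 := branchProb_run_nonneg F T h (fun _ => False)
  linarith

/-- The event that the computation has halted with an output in `A`. -/
def outEvent (A : List Bool → Prop) : Config → Prop := fun c => c.Halted ∧ A c.data.out

/-- As a function of the quantum state, the probability of an output satisfies the inequality that
holds for the square of a seminorm. -/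
theorem branchProb_run_add_state (A : List Bool → Prop) (T : ℕ) {t : ℝ} (ht : 0 < t)
    (k : List Program) (m : Memory) (o : List Bool) {w : ℝ} (hw : 0 ≤ w) (ψ χ : QState) :
    branchProb (Config.run F T ⟨k, ⟨m, o, w, ψ + χ⟩⟩) (outEvent A) ≤
      (1 + t) * branchProb (Config.run F T ⟨k, ⟨m, o, w, ψ⟩⟩) (outEvent A) +
      (1 + 1 / t) * branchProb (Config.run F T ⟨k, ⟨m, o, w, χ⟩⟩) (outEvent A) := by
  -- Control flow depends only on the memory, so the branches for `ψ`, `χ` and `ψ + χ` correspond to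
  -- each other; gates and measurement projections are linear, and at the leaves the claim is
  -- `QState.normSq_add_le`.
  induction T generalizing k m o w ψ χ with
  | zero =>
    simp only [Config.run, branchProb_cons, branchProb_nil, add_zero, outEvent, Config.Halted,
      Data.prob]
    by_cases h : k = [] ∧ A o
    · have := mul_le_mul_of_nonneg_left (QState.normSq_add_le ψ χ ht) hw
      simp only [h, and_self, if_true]
      linarith
    · simp [h]
  | succ T ih =>
    simp only [branchProb_run_succ]
    match k with
    | [] => simpa [Config.step] using ih [] m o hw ψ χ
    | .seq p q :: k => simpa [Config.step] using ih _ m o hw ψ χ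
    | .ite e p q :: k => simpa [Config.step] using ih _ m o hw ψ χ
    | .loop e p :: k => simpa [Config.step] using ih _ m o hw ψ χ
    | .instr i :: k =>
      cases i with
      | assign a i j e => simpa [Config.step, Instr.exec] using ih k _ o hw ψ χ
      | query a i b j => simpa [Config.step, Instr.exec] using ih k _ o hw ψ χ
      | emit e => simpa [Config.step, Instr.exec] using ih k m _ hw ψ χ
      | coin a i j =>
        have h1 := ih k (m.write a (i.eval n m) (j.eval n m) 0) o (w := w / 2) (by positivity) ψ χ
        have h2 := ih k (m.write a (i.eval n m) (j.eval n m) 1) o (w := w / 2) (by positivity) ψ χ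
        simp only [Config.step, Instr.exec, List.map_cons, List.map_nil, List.sum_cons,
          List.sum_nil, add_zero]
        linarith
      | gate g =>
        have := ih k m o hw ((g.map (Expr.eval n m)).apply F ψ) ((g.map (Expr.eval n m)).apply F χ)
        simpa [Config.step, Instr.exec] using this
      | measure q a i j =>
        have h1 := ih k (m.write a (i.eval n m) (j.eval n m) 0) o hw
          (ψ.filter fun s => q.eval n m ∉ s) (χ.filter fun s => q.eval n m ∉ s)
        have h2 := ih k (m.write a (i.eval n m) (j.eval n m) 1) o hw
          (ψ.filter fun s => q.eval n m ∈ s) (χ.filter fun s => q.eval n m ∈ s)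
        simp only [Config.step, Instr.exec, List.map_cons, List.map_nil, List.sum_cons,
          List.sum_nil, add_zero, Finsupp.filter_add]
        linarith

end

/-! ### The hybrid argument -/

/-- The gates differ only on the part `χ` of the state whose queries are answered differently. Both
are isometries, and the weighted triangle inequality at weight 1 gives the factor `2 + 2`. -/
theorem normSq_oracle_sub_le {n : ℕ} (F₀ F₁ : (Fin n → Bool) → (Fin n → Bool)) (ψ : QState) :
    QState.normSq ((Gate.oracle : Gate ℕ).apply F₀ ψ - (Gate.oracle : Gate ℕ).apply F₁ ψ) ≤
      4 * QState.normSq (ψ.filter fun s => F₀ (toVec n s) ≠ F₁ (toVec n s)) := by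
  set χ := ψ.filter fun s => F₀ (toVec n s) ≠ F₁ (toVec n s)
  have e : (Gate.oracle : Gate ℕ).apply F₀ ψ - (Gate.oracle : Gate ℕ).apply F₁ ψ =
      (Gate.oracle : Gate ℕ).apply F₀ χ + (Gate.oracle : Gate ℕ).apply F₁ (-χ) := by
    ext s
    simp only [Finsupp.coe_sub, Finsupp.coe_add, Pi.sub_apply, Pi.add_apply, Gate.apply_oracle, χ,
      Finsupp.filter_apply, toVec_symmDiff_answer, Finsupp.neg_apply]
    by_cases h : F₀ (toVec n s) = F₁ (toVec n s)
    · simp [h]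
    · simp [h, sub_eq_add_neg]
  have h1 := QState.normSq_add_le ((Gate.oracle : Gate ℕ).apply F₀ χ)
    ((Gate.oracle : Gate ℕ).apply F₁ (-χ)) one_pos
  rw [e]
  have h2 : QState.normSq (-χ) = QState.normSq χ :=
    normSq_of_perm (σ := id) (fun _ => rfl) fun s => by simp
  rw [Gate.normSq_apply, Gate.normSq_apply, h2] at h1
  linarith

section
variable {n : ℕ} {ι : Type} [Fintype ι] (F₀ : (Fin n → Bool) → (Fin n → Bool))
  (F : ι → (Fin n → Bool) → (Fin n → Bool)) {K : ℕ}

/-- Each basis state queries a single point, so it is counted for at most `K` indices. -/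
theorem sum_normSq_filter_le (hK : ∀ x, (Finset.univ.filter fun i => F₀ x ≠ F i x).card ≤ K)
    (ψ : QState) :
    ∑ i, QState.normSq (ψ.filter fun s => F₀ (toVec n s) ≠ F i (toVec n s)) ≤
      K * QState.normSq ψ := by
  have : ∀ i, QState.normSq (ψ.filter fun s => F₀ (toVec n s) ≠ F i (toVec n s)) =
      ∑ s ∈ ψ.support, if F₀ (toVec n s) ≠ F i (toVec n s) then ‖ψ s‖ ^ 2 else 0 := by
    intro i
    rw [QState.normSq_eq_sum (P := ψ.support) (Finset.filter_subset _ _)]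
    refine Finset.sum_congr rfl fun s _ => ?_
    rw [Finsupp.filter_apply]
    split_ifs <;> simp
  simp only [this]
  rw [Finset.sum_comm, QState.normSq_eq_sum subset_rfl, Finset.mul_sum]
  refine Finset.sum_le_sum fun s _ => ?_
  rw [← Finset.sum_filter, Finset.sum_const, nsmul_eq_mul]
  gcongr
  exact hK _

/-- The cost of replacing `F₀` by `F i` in one step, summed over `i`, when the remaining `T` steps
already use `F i`. Only queries matter. A classical query loses at most the full branch probability,
for at most `K` indices; the oracle gate is handled with the weighted inequality and
`sum_normSq_filter_le`. -/
theorem sum_step_sub_le (hK : ∀ x, (Finset.univ.filter fun i => F₀ x ≠ F i x).card ≤ K)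
    (A : List Bool → Prop) (T : ℕ) {t : ℝ} (ht : 0 < t) {c : Config} (hc : 0 ≤ c.data.weight) :
    ∑ i, (((c.step F₀).map fun c' => branchProb (c'.run (F i) T) (outEvent A)).sum -
      ((c.step (F i)).map fun c' => branchProb (c'.run (F i) T) (outEvent A)).sum) ≤
      (Fintype.card ι * t + (1 + 1 / t) * (4 * K)) * c.data.prob := by
  have hB : 0 ≤ (Fintype.card ι * t + (1 + 1 / t) * (4 * K)) * c.data.prob := by
    have := Data.prob_nonneg hc
    positivity
  have triv : (∀ i, c.step F₀ = c.step (F i)) →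
      ∑ i, (((c.step F₀).map fun c' => branchProb (c'.run (F i) T) (outEvent A)).sum -
      ((c.step (F i)).map fun c' => branchProb (c'.run (F i) T) (outEvent A)).sum) ≤
      (Fintype.card ι * t + (1 + 1 / t) * (4 * K)) * c.data.prob := by
    intro h
    refine le_trans (le_of_eq (Finset.sum_eq_zero fun i _ => ?_)) hB
    rw [h i, sub_self]
  obtain ⟨k, m, o, w, ψ⟩ := c
  dsimp only at hc
  match k with
  | [] => exact triv fun i => rfl
  | .seq p q :: k => exact triv fun i => rfl
  | .ite e p q :: k => exact triv fun i => rfl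
  | .loop e p :: k => exact triv fun i => rfl
  | .instr (.assign a i j e) :: k => exact triv fun i => rfl
  | .instr (.emit e) :: k => exact triv fun i => rfl
  | .instr (.coin a i j) :: k => exact triv fun i => rfl
  | .instr (.measure q a i j) :: k => exact triv fun i => rfl
  | .instr (.gate (.x q)) :: k => exact triv fun i => rfl
  | .instr (.gate (.h q)) :: k => exact triv fun i => rfl
  | .instr (.gate (.t q)) :: k => exact triv fun i => rfl
  | .instr (.gate (.cnot q q')) :: k => exact triv fun i => rfl
  | .instr (.query a e b e') :: k =>
    set x : Fin n → Bool := fun l => decide (m a (e.eval n m) l.1 ≠ 0) with hx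
    have hp : 0 ≤ w * QState.normSq ψ := mul_nonneg hc (QState.normSq_nonneg _)
    have hle : ∀ i, ((((Config.step F₀ ⟨.instr (.query a e b e') :: k, ⟨m, o, w, ψ⟩⟩)).map
          fun c' => branchProb (c'.run (F i) T) (outEvent A)).sum -
        ((Config.step (F i) ⟨.instr (.query a e b e') :: k, ⟨m, o, w, ψ⟩⟩).map
          fun c' => branchProb (c'.run (F i) T) (outEvent A)).sum) ≤
        if F₀ x ≠ F i x then w * QState.normSq ψ else 0 := by
      intro i
      simp only [Config.step, Instr.exec, List.map_cons, List.map_nil, List.sum_cons,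
        List.sum_nil, add_zero, ← hx]
      split_ifs with h
      · have h1 := fun m' => branchProb_run_le (F i) T (c := ⟨k, ⟨m', o, w, ψ⟩⟩) hc (outEvent A)
        have h2 := fun m' => branchProb_run_nonneg (F i) T (c := ⟨k, ⟨m', o, w, ψ⟩⟩) hc (outEvent A)
        simp only [Data.prob] at h1
        exact (sub_le_self _ (h2 _)).trans (h1 _)
      · push Not at h
        rw [h, sub_self]
    refine (Finset.sum_le_sum fun i _ => hle i).trans ?_
    rw [← Finset.sum_filter, Finset.sum_const, nsmul_eq_mul]
    refine mul_le_mul_of_nonneg_right ?_ hp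
    have h1 : ((Finset.univ.filter fun i => F₀ x ≠ F i x).card : ℝ) ≤ K := by exact_mod_cast hK x
    have h2 : (0 : ℝ) ≤ Fintype.card ι * t := by positivity
    have h3 : (0 : ℝ) ≤ 1 / t * (4 * K) := by positivity
    have h4 : (0 : ℝ) ≤ K := by positivity
    linarith
  | .instr (.gate .oracle) :: k =>
    have hle : ∀ i, ((((Config.step F₀ ⟨.instr (.gate .oracle) :: k, ⟨m, o, w, ψ⟩⟩)).map
          fun c' => branchProb (c'.run (F i) T) (outEvent A)).sum -
        ((Config.step (F i) ⟨.instr (.gate .oracle) :: k, ⟨m, o, w, ψ⟩⟩).map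
          fun c' => branchProb (c'.run (F i) T) (outEvent A)).sum) ≤
        t * (w * QState.normSq ψ) + (1 + 1 / t) * (w * (4 *
          QState.normSq (ψ.filter fun s => F₀ (toVec n s) ≠ F i (toVec n s)))) := by
      intro i
      simp only [Config.step, Instr.exec, List.map_cons, List.map_nil, List.sum_cons,
        List.sum_nil, add_zero, Gate.map]
      set ψ₀ := (Gate.oracle : Gate ℕ).apply F₀ ψ
      set ψ₁ := (Gate.oracle : Gate ℕ).apply (F i) ψ with hψ₁
      -- The state after `F₀` is the state after `F i` plus a deviation: the first costs an excess
      -- of `t` times its probability, the second is small on average over `i`.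
      have h1 := branchProb_run_add_state (F i) A T ht k m o hc ψ₁ (ψ₀ - ψ₁)
      rw [add_sub_cancel] at h1
      have h2 := branchProb_run_le (F i) T (c := ⟨k, ⟨m, o, w, ψ₁⟩⟩) hc (outEvent A)
      have h3 := branchProb_run_le (F i) T (c := ⟨k, ⟨m, o, w, ψ₀ - ψ₁⟩⟩) hc (outEvent A)
      simp only [Data.prob] at h2 h3
      rw [hψ₁, Gate.normSq_apply] at h2
      have h4 := mul_le_mul_of_nonneg_left (normSq_oracle_sub_le F₀ (F i) ψ) hc
      have h5 := mul_le_mul_of_nonneg_left (h3.trans h4) (show 0 ≤ 1 + 1 / t by positivity)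
      have h6 := mul_le_mul_of_nonneg_left h2 ht.le
      linarith
    refine (Finset.sum_le_sum fun i _ => hle i).trans ?_
    have h7 := sum_normSq_filter_le F₀ F hK ψ
    rw [Finset.sum_add_distrib, Finset.sum_const, nsmul_eq_mul, Finset.card_univ,
      ← Finset.mul_sum, ← Finset.mul_sum, ← Finset.mul_sum]
    have h8 := mul_le_mul_of_nonneg_left h7 (show 0 ≤ (1 + 1 / t) * (w * 4) by positivity)
    simp only [Data.prob]
    linarith

/-- Telescoping: the oracle is exchanged one step at a time, and each step costs at most the bound
of `sum_step_sub_le` times the probability, which is conserved. -/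
theorem hybrid (hK : ∀ x, (Finset.univ.filter fun i => F₀ x ≠ F i x).card ≤ K)
    (A : List Bool → Prop) (T : ℕ) {t : ℝ} (ht : 0 < t) {c : Config} (hc : 0 ≤ c.data.weight) :
    ∑ i, (branchProb (c.run F₀ T) (outEvent A) - branchProb (c.run (F i) T) (outEvent A)) ≤
      T * ((Fintype.card ι * t + (1 + 1 / t) * (4 * K)) * c.data.prob) := by
  induction T generalizing c with
  | zero => simp [Config.run]
  | succ T ih =>
    set B := Fintype.card ι * t + (1 + 1 / t) * (4 * K) with hB
    have h1 := sum_step_sub_le F₀ F hK A T ht hc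
    have h2 : ∑ i, (((c.step F₀).map fun c' => branchProb (c'.run F₀ T) (outEvent A)).sum -
        ((c.step F₀).map fun c' => branchProb (c'.run (F i) T) (outEvent A)).sum) ≤
        T * (B * c.data.prob) := by
      rw [← Config.step_prob F₀ c, ← List.sum_map_mul_left, ← List.sum_map_mul_left]
      have : ∀ l : List Config, (∀ c' ∈ l, 0 ≤ c'.data.weight) →
          ∑ i, ((l.map fun c' => branchProb (c'.run F₀ T) (outEvent A)).sum -
            (l.map fun c' => branchProb (c'.run (F i) T) (outEvent A)).sum) ≤
          (l.map fun c' => T * (B * c'.data.prob)).sum := by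
        intro l hl
        induction l with
        | nil => simp
        | cons c' l ihl =>
          have h3 := ihl fun c'' h => hl _ (List.mem_cons_of_mem _ h)
          have h4 := ih (hl c' (List.mem_cons_self ..))
          simp only [List.map_cons, List.sum_cons]
          refine le_trans (le_of_eq ?_) (add_le_add h4 h3)
          rw [← Finset.sum_add_distrib]
          exact Finset.sum_congr rfl fun i _ => by ring
      exact this _ fun c' hc' => Config.step_weight F₀ hc hc'
    simp only [branchProb_run_succ]
    have h5 := add_le_add h2 h1
    rw [← Finset.sum_add_distrib] at h5
    refine le_trans (le_of_eq (Finset.sum_congr rfl fun i _ => ?_)) (h5.trans (le_of_eq ?_))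
    · ring
    · push_cast; ring

end

/-! ### From the hybrid bound to the absence of quantum algorithms -/

theorem exists_eval_lt_two_pow (q : Polynomial ℕ) : ∃ N, ∀ m ≥ N, q.eval m < 2 ^ m := by
  have key : Filter.Tendsto (fun m : ℕ => ((q.eval m : ℕ) : ℝ) / 2 ^ m) Filter.atTop (nhds 0) := by
    induction q using Polynomial.induction_on' with
    | add p q hp hq => simpa [add_div] using hp.add hq
    | monomial k a =>
      have := (tendsto_pow_const_div_const_pow_of_one_lt k (r := (2 : ℝ)) (by norm_num)).const_mul (a : ℝ)
      simpa [mul_div_assoc] using this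
  have h1 := key.eventually (gt_mem_nhds (zero_lt_one))
  obtain ⟨N, hN⟩ := Filter.eventually_atTop.1 h1
  refine ⟨N, fun m hm => ?_⟩
  have := hN m hm
  rw [div_lt_one (by positivity)] at this
  exact_mod_cast this

theorem Program.prob_init (P : Program) : P.init.data.prob = 1 := by
  simp [Program.init, Data.prob, QState.normSq_single]

section
open FirstOrder
variable {L : Language} [L.Structure Bool]

theorem SolvesInPolyTime.mono {fmt : OutputFormat} {δ δ' : ℝ} {P : Program} (h : δ' ≤ δ)
    (hP : SolvesInPolyTime L fmt δ P) : SolvesInPolyTime L fmt δ' P := by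
  obtain ⟨p, hp⟩ := hP
  exact ⟨p, fun n I => ⟨(hp n I).1, h.trans (hp n I).2⟩⟩

/-- There is no quantum algorithm if there are many instances whose oracles differ from the one of a
fixed instance in few places. -/
theorem not_hasQuantumAlgorithm [L.IsAlgebraic]
    (h : ∀ m : ℕ, 1 ≤ m → ∃ (ι : Type) (_ : Fintype ι) (F₀ : (Fin (2 * m) → Bool) → Fin (2 * m) → Bool)
      (F : ι → (Fin (2 * m) → Bool) → Fin (2 * m) → Bool), 2 ^ m ≤ Fintype.card ι ∧
      IsCongruence L (Setoid.ker F₀) ∧ (∀ i, IsCongruence L (Setoid.ker (F i))) ∧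
      (∀ i, Setoid.ker (F i) ≠ Setoid.ker F₀) ∧
      ∀ x, (Finset.univ.filter fun i => F₀ x ≠ F i x).card ≤ 2) (fmt : OutputFormat) :
    ¬ HasQuantumAlgorithm L fmt := by
  rintro ⟨P, p, hp⟩
  -- With `T = p(2m)` the hybrid bound will give `card ι / 3 ≤ card ι / 6 + 8T(6T + 7)`, hence at
  -- most `48T(6T + 7)` instances, against the `2^m` available.
  obtain ⟨N, hN⟩ := exists_eval_lt_two_pow
    (48 * p.comp (2 * Polynomial.X) * (6 * p.comp (2 * Polynomial.X) + 7))
  set m := max N 1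
  obtain ⟨ι, _, F₀, F, hcard, h0, hF, hne, hK⟩ := h m (le_max_right _ _)
  have hlt := hN m (le_max_left _ _)
  set T := p.eval (2 * m) with hT
  simp only [Polynomial.eval_mul, Polynomial.eval_add, Polynomial.eval_comp, Polynomial.eval_X,
    Polynomial.eval_ofNat, ← hT] at hlt
  set A : List Bool → Prop := fun o => fmt (2 * m) o = Setoid.ker F₀
  have g0 : (2 / 3 : ℝ) ≤ branchProb (P.init.run F₀ T) (outEvent A) :=
    (hp (2 * m) (Instance.ofFun F₀ h0)).2
  have hw : 0 ≤ P.init.data.weight := by simp [Program.init]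
  have gi : ∀ i, branchProb (P.init.run (F i) T) (outEvent A) ≤ 1 / 3 := by
    intro i
    have h1 : (2 / 3 : ℝ) ≤ branchProb (P.init.run (F i) T) _ :=
      (hp (2 * m) (Instance.ofFun (F i) (hF i))).2
    have h2 := branchProb_run_add_le (F i) T hw (E := outEvent A)
      (E' := fun c => c.Halted ∧ fmt (2 * m) c.data.out = (Instance.ofFun (F i) (hF i)).kernel)
      (fun c hc hc' => hne i (hc'.2.symm.trans hc.2))
    rw [Program.prob_init] at h2
    linarith
  -- This weight makes the term `T · t` at most 1/6, half of the gap 1/3 between the success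
  -- probabilities; also `1 + 1/t = 6T + 7`.
  have ht : (0 : ℝ) < 1 / (6 * (T + 1)) := by positivity
  have hy := hybrid F₀ F hK A T ht hw
  rw [Program.prob_init, mul_one] at hy
  have hlow : (Fintype.card ι : ℝ) * (1 / 3) ≤ ∑ i, (branchProb (P.init.run F₀ T) (outEvent A) -
      branchProb (P.init.run (F i) T) (outEvent A)) := by
    rw [← nsmul_eq_mul, ← Finset.card_univ]
    refine Finset.card_nsmul_le_sum _ _ _ fun i _ => ?_
    have := gi i
    linarith
  have h1 : (T : ℝ) * (1 / (6 * (T + 1))) ≤ 1 / 6 := by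
    rw [mul_one_div, div_le_div_iff₀ (by positivity) (by norm_num)]; linarith
  have h2 : (Fintype.card ι : ℝ) * (T * (1 / (6 * (T + 1)))) ≤ Fintype.card ι * (1 / 6) :=
    mul_le_mul_of_nonneg_left h1 (by positivity)
  have h3 : (Fintype.card ι : ℝ) ≤ 48 * T * (6 * T + 7) := by
    have e : (T : ℝ) * (Fintype.card ι * (1 / (6 * (T + 1))) + (1 + 1 / (1 / (6 * ((T : ℝ) + 1)))) *
        (4 * (2 : ℕ))) = Fintype.card ι * (T * (1 / (6 * (T + 1)))) + 8 * T * (6 * T + 7) := by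
      rw [one_div_one_div]; push_cast; ring
    rw [e] at hy
    linarith
  have h4 : ((2 : ℝ) ^ m) ≤ Fintype.card ι := by exact_mod_cast hcard
  have h5 : (48 * T * (6 * T + 7) : ℝ) < 2 ^ m := by exact_mod_cast hlt
  linarith

theorem HasClassicalAlgorithm.quantum {fmt : OutputFormat} (h : HasClassicalAlgorithm L fmt) :
    HasQuantumAlgorithm L fmt := by
  obtain ⟨P, -, hP⟩ := h
  exact ⟨P, hP⟩

end
end HKP

namespace HKP

/-! ### Instances that are hard for quantum algorithms -/

section
variable {m : ℕ}

def loIdx (j : Fin m) : Fin (2 * m) := ⟨j, by omega⟩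
def hiIdx (j : Fin m) : Fin (2 * m) := ⟨m + j, by omega⟩

/-- A bit string followed by its complement. -/
def balanced (b : Fin m → Bool) : Fin (2 * m) → Bool := fun j =>
  if h : j.1 < m then b ⟨j, h⟩ else !b ⟨j - m, by omega⟩

theorem balanced_lo (b : Fin m → Bool) (j : Fin m) : balanced b (loIdx j) = b j := by
  simp [balanced, loIdx]

theorem balanced_hi (b : Fin m → Bool) (j : Fin m) : balanced b (hiIdx j) = !b j := by
  simp [balanced, hiIdx]

theorem balanced_injective : Function.Injective (balanced : (Fin m → Bool) → _) := by
  intro b b' h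
  funext j
  rw [← balanced_lo b, h, balanced_lo]

theorem lo_or_hi (i : Fin (2 * m)) : (∃ j, i = loIdx j) ∨ ∃ j, i = hiIdx j := by
  by_cases h : i.1 < m
  · exact Or.inl ⟨⟨i, h⟩, rfl⟩
  · exact Or.inr ⟨⟨i - m, by omega⟩, Fin.ext (by simp [hiIdx]; omega)⟩

theorem not_balanced (b : Fin m → Bool) :
    (fun i => !balanced b i) = balanced fun j => !b j := by
  funext i
  rcases lo_or_hi i with ⟨j, rfl⟩ | ⟨j, rfl⟩
  · simp [balanced_lo]
  · simp [balanced_hi]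

theorem card_balanced_eq_le (x : Fin (2 * m) → Bool) :
    (Finset.univ.filter fun b : Fin m → Bool => x = balanced b).card ≤ 1 := by
  refine Finset.card_le_one.2 fun a ha b hb => balanced_injective ?_
  simp only [Finset.mem_filter, Finset.mem_univ, true_and] at ha hb
  rw [← ha, ← hb]

/-- Conjunction for `c = false`, disjunction for `c = true`. -/
def semi (c p q : Bool) : Bool := xor c (xor c p && xor c q)

/-- Collapsing the set `J` to a point. -/
noncomputable def collapse {n : ℕ} (c : Bool) (J : (Fin n → Bool) → Prop) :
    (Fin n → Bool) → Fin n → Bool := fun x =>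
  open Classical in if J x then fun _ => c else x

/-- The collapsed value is itself a point of `J`, so no point outside `J` is accidentally identified
with it. -/
theorem collapse_eq_iff {n : ℕ} {c : Bool} {J : (Fin n → Bool) → Prop} (hJ : J fun _ => c)
    (x y : Fin n → Bool) : collapse c J x = collapse c J y ↔ x = y ∨ (J x ∧ J y) := by
  unfold collapse
  by_cases hx : J x <;> by_cases hy : J y <;> simp only [hx, hy, if_true, if_false]
  · simp
  · refine ⟨fun h => absurd (h ▸ hJ) hy, ?_⟩
    rintro (rfl | h)
    exacts [absurd hx hy, h.2.elim]
  · refine ⟨fun h => absurd (h.symm ▸ hJ) hx, ?_⟩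
    rintro (rfl | h)
    exacts [absurd hy hx, h.1.elim]
  · simp

/-- Rees congruence: identifying the points of an absorbing set is compatible with the semilattice
operation. -/
theorem compatible_collapse {n : ℕ} {c : Bool} {J : (Fin n → Bool) → Prop} (hJ : J fun _ => c)
    (h1 : ∀ x y : Fin n → Bool, J x → J fun j => semi c (x j) (y j))
    (h2 : ∀ x y : Fin n → Bool, J y → J fun j => semi c (x j) (y j)) :
    Compatible (Setoid.ker (collapse c J)) fun x : Fin 2 → Bool => semi c (x 0) (x 1) := by
  intro a b h
  have h0 := (collapse_eq_iff hJ _ _).1 (h 0)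
  have h1' := (collapse_eq_iff hJ _ _).1 (h 1)
  refine (collapse_eq_iff hJ _ _).2 ?_
  rcases h0 with h0 | h0
  · rcases h1' with h1' | h1'
    · left; dsimp only; rw [h0, h1']
    · exact Or.inr ⟨h2 _ _ h1'.1, h2 _ _ h1'.2⟩
  · exact Or.inr ⟨h1 _ _ h0.1, h1 _ _ h0.2⟩

/-- The bit strings below some balanced one (for `c = false`) or above some (for `c = true`). -/
def Unbalanced (c : Bool) (x : Fin (2 * m) → Bool) : Prop :=
  ∃ j : Fin m, x (loIdx j) = c ∧ x (hiIdx j) = c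

theorem semi_comm (c p q : Bool) : semi c p q = semi c q p := by
  revert c p q; decide

theorem semi_self (c q : Bool) : semi c c q = c := by
  revert c q; decide

theorem Unbalanced.semi {c : Bool} {x : Fin (2 * m) → Bool} (h : Unbalanced c x)
    (y : Fin (2 * m) → Bool) : Unbalanced c fun j => semi c (x j) (y j) := by
  obtain ⟨j, h1, h2⟩ := h
  refine ⟨j, ?_, ?_⟩
  · dsimp only; rw [h1, semi_self]
  · dsimp only; rw [h2, semi_self]

theorem not_unbalanced_balanced (c : Bool) (b : Fin m → Bool) : ¬ Unbalanced c (balanced b) := by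
  rintro ⟨j, h1, h2⟩
  rw [balanced_lo] at h1
  rw [balanced_hi, h1] at h2
  cases c <;> simp at h2

/-- If the operation changes an entry of a balanced string, that entry was `¬c` and becomes `c`,
while its partner was already the absorbing value `c`. Hence a single balanced string can be added
to the absorbing set of unbalanced ones. -/
theorem balanced_semi (c : Bool) (b : Fin m → Bool) (y : Fin (2 * m) → Bool) :
    Unbalanced c (fun j => semi c (balanced b j) (y j)) ∨
      (fun j => semi c (balanced b j) (y j)) = balanced b := by
  by_cases h : (fun j => HKP.semi c (balanced b j) (y j)) = balanced b
  · exact Or.inr h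
  left
  obtain ⟨i, hi⟩ := Function.ne_iff.1 h
  have key : ∀ c p q q' : Bool, HKP.semi c p q ≠ p → HKP.semi c p q = c ∧ HKP.semi c (!p) q' = c := by
    decide
  rcases lo_or_hi i with ⟨j, rfl⟩ | ⟨j, rfl⟩
  · have := key _ _ _ (y (hiIdx j)) hi
    refine ⟨j, this.1, ?_⟩
    dsimp only
    rw [balanced_hi]
    rw [balanced_lo] at this
    exact this.2
  · have := key _ _ _ (y (loIdx j)) hi
    refine ⟨j, ?_, this.1⟩
    dsimp only
    rw [balanced_lo]
    rw [balanced_hi, Bool.not_not] at this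
    exact this.2

end

open FirstOrder
variable {L : Language} [L.IsAlgebraic] [L.Structure Bool]

/-- Search for `b`: the unbalanced strings are collapsed, either alone or together with `balanced
b`. Both sets are absorbing, and the two oracles differ only at `balanced b`. Constant operations
are compatible with every equivalence relation. -/
theorem not_hasQuantumAlgorithm_semilattice (c : Bool)
    (h : termClone L Bool ⊆ clo {⟨2, fun x => semi c (x 0) (x 1)⟩, ⟨0, fun _ => false⟩,
      ⟨0, fun _ => true⟩}) (fmt : OutputFormat) : ¬ HasQuantumAlgorithm L fmt := by
  refine not_hasQuantumAlgorithm (fun m hm => ?_) fmt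
  have hc0 : Unbalanced c (fun _ : Fin (2 * m) => c) := ⟨⟨0, hm⟩, rfl, rfl⟩
  have hcong : ∀ J : (Fin (2 * m) → Bool) → Prop, (J fun _ => c) →
      (∀ x y : Fin (2 * m) → Bool, J x → J fun j => semi c (x j) (y j)) →
      IsCongruence L (Setoid.ker (collapse c J)) := by
    intro J h0 h1
    refine isCongruence_of_compatible h ?_
    rintro f (rfl | rfl | rfl)
    · refine compatible_collapse h0 h1 fun x y hy => ?_
      simpa only [semi_comm] using h1 y x hy
    · exact fun a b _ => Setoid.refl' _ _
    · exact fun a b _ => Setoid.refl' _ _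
  refine ⟨Fin m → Bool, inferInstance, collapse c (Unbalanced c),
    fun b => collapse c fun x => Unbalanced c x ∨ x = balanced b, by simp,
    hcong _ hc0 fun x y hx => hx.semi y, fun b => hcong _ (Or.inl hc0) ?_, fun b heq => ?_, fun x => ?_⟩
  · rintro x y (hx | rfl)
    · exact Or.inl (hx.semi y)
    · exact balanced_semi c b y
  · have h1 : Setoid.ker (collapse c fun x => Unbalanced c x ∨ x = balanced b) (fun _ => c) (balanced b) :=
      (collapse_eq_iff (Or.inl hc0) _ _).2 (Or.inr ⟨Or.inl hc0, Or.inr rfl⟩)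
    rw [heq] at h1
    rcases (collapse_eq_iff hc0 _ _).1 h1 with h2 | h2
    · exact not_unbalanced_balanced c b (h2 ▸ hc0)
    · exact not_unbalanced_balanced c b h2.2
  · refine le_trans (Finset.card_le_card ?_) ((card_balanced_eq_le x).trans one_le_two)
    intro b
    simp only [Finset.mem_filter, Finset.mem_univ, true_and]
    intro hne
    by_contra hx
    apply hne
    by_cases hu : Unbalanced c x <;> simp [collapse, hx, hu]

/-- Here the oracle has to commute with complementation, so `balanced b` is glued to zero and its
complement simultaneously to the all-ones string. A query point then affects both `b` and its
complement, whence the bound 2 in `not_hasQuantumAlgorithm`. -/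
theorem not_hasQuantumAlgorithm_unary (h : termClone L Bool ⊆ cloneU) (fmt : OutputFormat) :
    ¬ HasQuantumAlgorithm L fmt := by
  refine not_hasQuantumAlgorithm (fun m hm => ?_) fmt
  let F : (Fin m → Bool) → (Fin (2 * m) → Bool) → Fin (2 * m) → Bool := fun b x =>
    if x = balanced b then fun _ => false else if x = balanced (fun j => !b j) then fun _ => true else x
  have hcong : ∀ G : (Fin (2 * m) → Bool) → Fin (2 * m) → Bool, (∀ x, G (fun j => !x j) = fun j => !G x j) →
      IsCongruence L (Setoid.ker G) := by
    intro G hG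
    refine isCongruence_of_compatible h ?_
    rintro f (rfl | rfl)
    · intro a b hab
      have : G (a 0) = G (b 0) := hab 0
      change G (fun j => !a 0 j) = G (fun j => !b 0 j)
      rw [hG, hG, this]
    · exact fun a b _ => Setoid.refl' _ _
  have hinj : ∀ x y : Fin (2 * m) → Bool, (fun j => !x j) = (fun j => !y j) ↔ x = y := by
    intro x y
    refine ⟨fun h => funext fun j => ?_, fun h => by rw [h]⟩
    simpa using congrFun h j
  have hbb : ∀ b : Fin m → Bool, balanced b ≠ balanced fun j => !b j := by
    intro b h
    have := congrFun (balanced_injective h) ⟨0, hm⟩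
    simp at this
  refine ⟨Fin m → Bool, inferInstance, id, F, by simp, hcong _ fun x => rfl, fun b => hcong _ fun x => ?_,
    fun b heq => ?_, fun x => ?_⟩
  · by_cases h1 : x = balanced b
    · subst h1
      simp [F, not_balanced, (hbb b).symm]
    · by_cases h2 : x = balanced fun j => !b j
      · subst h2
        simp [F, not_balanced, (hbb b).symm]
      · have h3 : (fun j => !x j) ≠ balanced b := by
          intro h; apply h2
          rw [← not_balanced, ← h]; simp
        have h4 : (fun j => !x j) ≠ balanced fun j => !b j := by
          rw [← not_balanced]; exact fun h => h1 ((hinj _ _).1 h)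
        simp [F, h1, h2, h3, h4]
  · have h1 : Setoid.ker (F b) (fun _ => false) (balanced b) := by
      change F b _ = F b _
      have h3 : (fun _ : Fin (2 * m) => false) ≠ balanced b := fun h => by
        have h5 := congrFun h (loIdx ⟨0, hm⟩)
        have h6 := congrFun h (hiIdx ⟨0, hm⟩)
        rw [balanced_lo] at h5; rw [balanced_hi, ← h5] at h6; simp at h6
      have h4 : (fun _ : Fin (2 * m) => false) ≠ balanced fun j => !b j := fun h => by
        have h5 := congrFun h (loIdx ⟨0, hm⟩)
        have h6 := congrFun h (hiIdx ⟨0, hm⟩)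
        rw [balanced_lo] at h5; rw [balanced_hi, ← h5] at h6; simp at h6
      simp [F, h3, h4]
    rw [heq] at h1
    have h2 : (fun _ => false) = balanced b := h1
    have h5 := congrFun h2 (loIdx ⟨0, hm⟩)
    have h6 := congrFun h2 (hiIdx ⟨0, hm⟩)
    rw [balanced_lo] at h5; rw [balanced_hi, ← h5] at h6; simp at h6
  · have h2 := card_balanced_eq_le x
    have h3 := card_balanced_eq_le fun j => !x j
    refine le_trans (Finset.card_le_card (t := (Finset.univ.filter fun b : Fin m → Bool => x = balanced b) ∪
      (Finset.univ.filter fun b : Fin m → Bool => (fun j => !x j) = balanced b)) ?_)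
      ((Finset.card_union_le _ _).trans (Nat.add_le_add h2 h3))
    intro b
    simp only [Finset.mem_filter, Finset.mem_univ, true_and, Finset.mem_union, id]
    intro hne
    by_contra hx
    push Not at hx
    apply hne
    have h4 : x ≠ balanced fun j => !b j := by
      intro h; apply hx.2
      rw [← not_balanced] at h
      rw [h]; simp
    simp [F, hx.1, h4]

theorem not_hasQuantumAlgorithm_of_le (h : termClone L Bool ⊆ cloneMeet ∨
    termClone L Bool ⊆ cloneJoin ∨ termClone L Bool ⊆ cloneU) (fmt : OutputFormat) :
    ¬ HasQuantumAlgorithm L fmt := by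
  rcases h with h | h | h
  · refine not_hasQuantumAlgorithm_semilattice false (h.trans (le_of_eq ?_)) fmt
    simp [cloneMeet, semi]
  · refine not_hasQuantumAlgorithm_semilattice true (h.trans (le_of_eq ?_)) fmt
    simp [cloneJoin, semi]
  · exact not_hasQuantumAlgorithm_unary h fmt

end HKP

namespace HKP

/-! ### Classical programs -/

/-- A configuration whose remaining program is classical. -/
def Config.IsClassical (c : Config) : Prop := ∀ p ∈ c.control, p.IsClassical

section
variable {n : ℕ}

/-- The point at which the next step of a configuration queries the oracle. -/
def Config.queried (n : ℕ) : Config → Finset (Fin n → Bool)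
  | ⟨.instr (.query a i _ _) :: _, d⟩ => {fun l => decide (d.mem a (i.eval n d.mem) l.1 ≠ 0)}
  | _ => ∅

theorem Config.card_queried_le (c : Config) : (c.queried n).card ≤ 1 := by
  unfold queried; split <;> simp

/-- A classical step reads the oracle at no point except the queried one. -/
theorem Config.step_congr {F F' : (Fin n → Bool) → (Fin n → Bool)} {c : Config}
    (hc : c.IsClassical) (h : ∀ x ∈ c.queried n, F x = F' x) : c.step F = c.step F' := by
  obtain ⟨k, d⟩ := c
  match k with
  | [] => rfl
  | .seq p q :: k => rfl
  | .ite e p q :: k => rfl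
  | .loop e p :: k => rfl
  | .instr (.assign a i j e) :: k => rfl
  | .instr (.emit e) :: k => rfl
  | .instr (.coin a i j) :: k => rfl
  | .instr (.measure q a i j) :: k => exact (hc _ (List.mem_cons_self ..)).elim
  | .instr (.gate g) :: k => exact (hc _ (List.mem_cons_self ..)).elim
  | .instr (.query a i b j) :: k =>
    have := h _ (Finset.mem_singleton_self _)
    simp only [Config.step, Instr.exec]
    rw [this]

theorem Config.IsClassical.step (F : (Fin n → Bool) → (Fin n → Bool)) {c : Config}
    (hc : c.IsClassical) :
    (∃ c', c.step F = [c'] ∧ c'.data.prob = c.data.prob ∧ c'.IsClassical) ∨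
    ∃ c₀ c₁, c.step F = [c₀, c₁] ∧ c₀.data.prob = c.data.prob / 2 ∧
      c₁.data.prob = c.data.prob / 2 ∧ c₀.IsClassical ∧ c₁.IsClassical := by
  obtain ⟨k, d⟩ := c
  match k with
  | [] => exact Or.inl ⟨_, rfl, rfl, hc⟩
  | .seq p q :: k =>
    refine Or.inl ⟨_, rfl, rfl, fun p' hp' => ?_⟩
    have h1 := hc _ (List.mem_cons_self ..)
    simp only [List.mem_cons] at hp'
    rcases hp' with rfl | rfl | hp'
    exacts [h1.1, h1.2, hc _ (List.mem_cons_of_mem _ hp')]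
  | .ite e p q :: k =>
    refine Or.inl ⟨_, rfl, rfl, fun p' hp' => ?_⟩
    have h1 := hc _ (List.mem_cons_self ..)
    simp only [List.mem_cons] at hp'
    rcases hp' with rfl | hp'
    · split_ifs
      exacts [h1.1, h1.2]
    · exact hc _ (List.mem_cons_of_mem _ hp')
  | .loop e p :: k =>
    refine Or.inl ⟨_, rfl, rfl, fun p' hp' => ?_⟩
    have h1 := hc _ (List.mem_cons_self ..)
    dsimp only at hp'
    split_ifs at hp'
    · simp only [List.mem_cons] at hp'
      rcases hp' with rfl | rfl | hp'
      exacts [h1, h1, hc _ (List.mem_cons_of_mem _ hp')]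
    · exact hc _ (List.mem_cons_of_mem _ hp')
  | .instr (.assign a i j e) :: k =>
    exact Or.inl ⟨_, rfl, rfl, fun p' hp' => hc _ (List.mem_cons_of_mem _ hp')⟩
  | .instr (.emit e) :: k =>
    exact Or.inl ⟨_, rfl, rfl, fun p' hp' => hc _ (List.mem_cons_of_mem _ hp')⟩
  | .instr (.query a i b j) :: k =>
    exact Or.inl ⟨_, rfl, rfl, fun p' hp' => hc _ (List.mem_cons_of_mem _ hp')⟩
  | .instr (.coin a i j) :: k =>
    refine Or.inr ⟨_, _, rfl, ?_, ?_, fun p' hp' => hc _ (List.mem_cons_of_mem _ hp'),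
      fun p' hp' => hc _ (List.mem_cons_of_mem _ hp')⟩ <;>
    · simp only [Data.prob]; ring
  | .instr (.measure q a i j) :: k => exact (hc _ (List.mem_cons_self ..)).elim
  | .instr (.gate g) :: k => exact (hc _ (List.mem_cons_self ..)).elim

/-- One step of a computation in which the outcome of a coin toss is given. -/
noncomputable def Config.coinStep (F : (Fin n → Bool) → (Fin n → Bool)) (b : Bool) (c : Config) : Config :=
  match c.step F with
  | c₀ :: c₁ :: _ => if b then c₁ else c₀
  | [c₀] => c₀
  | [] => c

theorem Config.IsClassical.coinStep (F : (Fin n → Bool) → (Fin n → Bool)) {c : Config}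
    (hc : c.IsClassical) (b : Bool) : (c.coinStep F b).IsClassical := by
  rcases hc.step F with ⟨c', h, -, h'⟩ | ⟨c₀, c₁, h, -, -, h0, h1⟩
  · simpa [Config.coinStep, h] using h'
  · cases b
    · simpa [Config.coinStep, h] using h0
    · simpa [Config.coinStep, h] using h1

/-- A computation with given outcomes of the coin tosses. -/
noncomputable def Config.coinRun (F : (Fin n → Bool) → (Fin n → Bool)) :
    ∀ T : ℕ, (Fin T → Bool) → Config → Config
  | 0, _, c => c
  | T + 1, w, c => Config.coinRun F T (Fin.tail w) (c.coinStep F (w 0))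

/-- The points at which the oracle is queried. -/
noncomputable def Config.queries (F : (Fin n → Bool) → (Fin n → Bool)) :
    ∀ T : ℕ, (Fin T → Bool) → Config → Finset (Fin n → Bool)
  | 0, _, _ => ∅
  | T + 1, w, c => c.queried n ∪ Config.queries F T (Fin.tail w) (c.coinStep F (w 0))

theorem Config.card_queries_le (F : (Fin n → Bool) → (Fin n → Bool)) (T : ℕ) (w : Fin T → Bool)
    (c : Config) : (c.queries F T w).card ≤ T := by
  induction T generalizing c with
  | zero => simp [queries]
  | succ T ih =>
    have := Finset.card_union_le (c.queried n) (Config.queries F T (Fin.tail w) (c.coinStep F (w 0)))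
    have h1 := c.card_queried_le (n := n)
    have h2 := ih (Fin.tail w) (c.coinStep F (w 0))
    rw [queries]
    omega

theorem Config.coinRun_congr {F F' : (Fin n → Bool) → (Fin n → Bool)} (T : ℕ) (w : Fin T → Bool)
    {c : Config} (hc : c.IsClassical) (h : ∀ x ∈ c.queries F T w, F x = F' x) :
    c.coinRun F T w = c.coinRun F' T w ∧ c.queries F T w = c.queries F' T w := by
  induction T generalizing c with
  | zero => exact ⟨rfl, rfl⟩
  | succ T ih =>
    rw [queries] at h
    have h1 : c.step F = c.step F' :=
      Config.step_congr hc fun x hx => h x (Finset.mem_union_left _ hx)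
    have h2 : ∀ b, c.coinStep F b = c.coinStep F' b := by
      intro b; simp only [Config.coinStep, h1]
    have h3 := ih (Fin.tail w) (hc.coinStep F (w 0)) fun x hx => h x (Finset.mem_union_right _ hx)
    simp only [coinRun, queries, ← h2, h3, and_self]

theorem sum_fin_succ_bool {T : ℕ} (f : (Fin (T + 1) → Bool) → ℝ) :
    ∑ w, f w = ∑ w, f (Fin.cons false w) + ∑ w, f (Fin.cons true w) := by
  rw [← (Fin.consEquiv fun _ => Bool).sum_comp, Fintype.sum_prod_type, Fintype.sum_bool, add_comm]
  rfl

-- A step without a coin toss ignores its bit, so both values of the bit contribute equally; a coin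
-- toss distributes its two halves over them. The randomized run is thus uniform over `T`
-- predetermined bits.
open Classical in
theorem branchProb_run_eq_coinRun (F : (Fin n → Bool) → (Fin n → Bool)) (T : ℕ) {c : Config}
    (hc : c.IsClassical) (E : Config → Prop) :
    2 ^ T * branchProb (c.run F T) E =
      ∑ w : Fin T → Bool, if E (c.coinRun F T w) then c.data.prob else 0 := by
  have pull : ∀ (T : ℕ) (p : (Fin T → Bool) → Prop) (a : ℝ),
      (∑ w, if p w then a / 2 else 0) = (∑ w, if p w then a else 0) / 2 := by
    intro T p a
    rw [Finset.sum_div]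
    refine Finset.sum_congr rfl fun w _ => ?_
    split_ifs <;> simp
  induction T generalizing c with
  | zero =>
    by_cases h : E c <;> simp [Config.run, branchProb_cons, branchProb_nil, Config.coinRun, h]
  | succ T ih =>
    rw [branchProb_run_succ, sum_fin_succ_bool]
    simp only [Config.coinRun, Fin.tail_cons, Fin.cons_zero]
    rcases hc.step F with ⟨c', h, hp, h'⟩ | ⟨c₀, c₁, h, hp0, hp1, h0, h1⟩
    · simp only [Config.coinStep, h, List.map_cons, List.map_nil, List.sum_cons, List.sum_nil,
        add_zero, ← hp, ← ih h']
      ring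
    · have e0 := ih h0
      have e1 := ih h1
      rw [hp0, pull] at e0
      rw [hp1, pull] at e1
      simp only [Config.coinStep, h, List.map_cons, List.map_nil, List.sum_cons, List.sum_nil,
        add_zero, if_true, Bool.false_eq_true, if_false]
      rw [pow_succ]
      linarith

end

/-! ### The classical lower bound for hidden subgroups -/

section
variable {n : ℕ}

def vxor (x h : Fin n → Bool) : Fin n → Bool := fun j => xor (x j) (h j)

theorem vxor_vxor (x h : Fin n → Bool) : vxor (vxor x h) h = x := by
  funext j; simp [vxor, Bool.xor_assoc]

/-- Two elements of `Q` are in the same coset modulo `{0, h}`. -/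
def HitsCoset (h : Fin n → Bool) (Q : Finset (Fin n → Bool)) : Prop := ∃ x ∈ Q, vxor x h ∈ Q

/-- The representative of the coset of `x` modulo `{0, h}`, where the bit `i` of `h` is `1`. -/
def cosetRep (h : Fin n → Bool) (i : Fin n) (x : Fin n → Bool) : Fin n → Bool :=
  if x i = true then vxor x h else x

/-- The permutation that moves all elements of `Q` to the representatives of their cosets. -/
def cosetSwap (h : Fin n → Bool) (i : Fin n) (Q : Finset (Fin n → Bool)) (x : Fin n → Bool) :
    Fin n → Bool :=
  if (x ∈ Q ∧ x i = true) ∨ (vxor x h ∈ Q ∧ vxor x h i = true) then vxor x h else x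

theorem cosetSwap_involutive (h : Fin n → Bool) (i : Fin n) (Q : Finset (Fin n → Bool)) :
    Function.Involutive (cosetSwap h i Q) := by
  intro x
  by_cases hx : (x ∈ Q ∧ x i = true) ∨ (vxor x h ∈ Q ∧ vxor x h i = true)
  · have e : cosetSwap h i Q x = vxor x h := if_pos hx
    rw [e, cosetSwap, vxor_vxor, if_pos hx.symm]
  · have e : cosetSwap h i Q x = x := if_neg hx
    rw [e, e]

/-- If `Q` meets each coset at most once, the involution `cosetSwap` sends the points of `Q` to
their representatives, hence the representatives back. -/
theorem cosetSwap_cosetRep {h : Fin n → Bool} {i : Fin n}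
    {Q : Finset (Fin n → Bool)} (hQ : ¬ HitsCoset h Q) {x : Fin n → Bool} (hx : x ∈ Q) :
    cosetSwap h i Q (cosetRep h i x) = x := by
  have : cosetSwap h i Q x = cosetRep h i x := by
    have hn : vxor x h ∉ Q := fun h' => hQ ⟨x, hx, h'⟩
    unfold cosetSwap cosetRep
    simp [hx, hn]
  rw [← this, cosetSwap_involutive]

/-- Because `h i = 1`, exactly one of `x` and `x + h` has bit `i` equal to 0, so the representative
determines the coset. -/
theorem ker_cosetRep {h : Fin n → Bool} {i : Fin n} (hi : h i = true)
    {π : (Fin n → Bool) → Fin n → Bool} (hπ : Function.Injective π) (x y : Fin n → Bool) :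
    Setoid.ker (π ∘ cosetRep h i) x y ↔ ∃ e : Bool, ∀ j, y j = xor (x j) (e && h j) := by
  change π (cosetRep h i x) = π (cosetRep h i y) ↔ _
  rw [hπ.eq_iff]
  unfold cosetRep
  constructor
  · intro hxy
    split_ifs at hxy with h1 h2 h2
    · exact ⟨false, fun j => by rw [← vxor_vxor x h, hxy, vxor_vxor]; simp⟩
    · exact ⟨true, fun j => by rw [← hxy]; simp [vxor]⟩
    · exact ⟨true, fun j => by rw [hxy]; simp [vxor, Bool.xor_assoc]⟩
    · exact ⟨false, fun j => by rw [hxy]; simp⟩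
  · rintro ⟨e, he⟩
    cases e
    · have : y = x := funext fun j => by simpa using he j
      rw [this]
    · have : y = vxor x h := funext fun j => by simpa [vxor] using he j
      subst this
      have h1 : vxor x h i = !x i := by simp [vxor, hi]
      rw [h1, vxor_vxor]
      cases x i <;> simp

-- A run on `π` that never sees two points of one coset can be reproduced on an oracle with period
-- `h`: precompose `π` with the swap that moves the queried points to representatives. This change
-- of `π` is injective, so the event `A` is about as likely on periodic oracles as on injective
-- ones.
open Classical in
theorem card_perm_le (A : Config → Prop) (T : ℕ) (w : Fin T → Bool) {c : Config}
    (hc : c.IsClassical) (h : Fin n → Bool) (i : Fin n) :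
    (Finset.univ.filter fun π : Equiv.Perm (Fin n → Bool) => A (c.coinRun π T w)).card ≤
    (Finset.univ.filter fun π : Equiv.Perm (Fin n → Bool) =>
      A (c.coinRun (π ∘ cosetRep h i) T w)).card +
    (Finset.univ.filter fun π : Equiv.Perm (Fin n → Bool) =>
      HitsCoset h (c.queries π T w)).card := by
  rw [← Finset.card_filter_add_card_filter_not
    (s := Finset.univ.filter fun π : Equiv.Perm (Fin n → Bool) => A (c.coinRun π T w))
    (fun π : Equiv.Perm (Fin n → Bool) => ¬ HitsCoset h (c.queries π T w))]
  refine Nat.add_le_add ?_ (Finset.card_le_card ?_)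
  · let Ψ : Equiv.Perm (Fin n → Bool) → Equiv.Perm (Fin n → Bool) := fun π =>
      ((cosetSwap_involutive h i (c.queries π T w)).toPerm).trans π
    have key : ∀ π : Equiv.Perm (Fin n → Bool), ¬ HitsCoset h (c.queries π T w) →
        c.coinRun π T w = c.coinRun (Ψ π ∘ cosetRep h i) T w ∧
        c.queries π T w = c.queries (Ψ π ∘ cosetRep h i) T w := by
      intro π hπ
      refine Config.coinRun_congr T w hc fun x hx => ?_
      simp only [Ψ, Function.comp_apply, Equiv.trans_apply, Function.Involutive.coe_toPerm]
      rw [cosetSwap_cosetRep hπ hx]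
    refine Finset.card_le_card_of_injOn Ψ ?_ ?_
    · intro π hπ
      simp only [Finset.coe_filter, Finset.mem_filter, Finset.mem_univ, true_and, Set.mem_ofPred_eq] at hπ ⊢
      rw [← (key π hπ.2).1]
      exact hπ.1
    -- The query set of `π` can be read off from the image, as the two runs are identical; it
    -- determines the swap, which is an involution and can be undone.
    · intro π hπ π' hπ' heq
      simp only [Finset.coe_filter, Finset.mem_filter, Finset.mem_univ, true_and, Set.mem_ofPred_eq] at hπ hπ'
      have h1 := (key π hπ.2).2
      have h2 := (key π' hπ'.2).2
      rw [← heq, ← h1] at h2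
      ext1 x
      have h3 := congrArg (fun f : Equiv.Perm (Fin n → Bool) => f (cosetSwap h i (c.queries π T w) x)) heq
      simp only [Ψ, Equiv.trans_apply, Function.Involutive.coe_toPerm, h2] at h3
      rwa [cosetSwap_involutive] at h3
  · intro π hπ
    simp only [Finset.mem_filter, Finset.mem_univ, true_and, not_not] at hπ ⊢
    exact hπ.2

end

/-! ### Injective and two-to-one oracles -/

open FirstOrder
variable {L : Language} [L.Structure Bool]

theorem isCongruence_of_injective {n : ℕ} {F : (Fin n → Bool) → Fin n → Bool}
    (hF : Function.Injective F) : IsCongruence L (Setoid.ker F) := by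
  intro k f a b h
  have : a = b := funext fun i => hF (h i)
  rw [this]

theorem isCongruence_cosetRep (hL : termClone L Bool ⊆ cloneA) {n : ℕ} {h : Fin n → Bool}
    {i : Fin n} (hi : h i = true) {π : (Fin n → Bool) → Fin n → Bool} (hπ : Function.Injective π) :
    IsCongruence L (Setoid.ker (π ∘ cosetRep h i)) := by
  refine isCongruence_of_compatible hL ?_
  rintro f (rfl | rfl)
  · intro a b hab
    obtain ⟨e, he⟩ := (ker_cosetRep hi hπ _ _).1 (hab 0)
    obtain ⟨e', he'⟩ := (ker_cosetRep hi hπ _ _).1 (hab 1)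
    refine (ker_cosetRep hi hπ _ _).2 ⟨xor e e', fun j => ?_⟩
    dsimp only
    rw [he, he']
    cases a 0 j <;> cases a 1 j <;> cases h j <;> cases e <;> cases e' <;> rfl
  · exact fun a b _ => Setoid.refl' _ _

theorem Program.isClassical_init {P : Program} (h : P.IsClassical) : P.init.IsClassical := by
  intro p hp
  simp only [Program.init, List.mem_singleton] at hp
  exact hp ▸ h

open Classical in
theorem not_hasClassicalAlgorithm [L.IsAlgebraic] (hL : termClone L Bool ⊆ cloneA) (fmt : OutputFormat) :
    ¬ HasClassicalAlgorithm L fmt := by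
  rintro ⟨P, hPc, p, hp⟩
  -- The counting below forces `2^n - 1 ≤ 3T²`.
  obtain ⟨N, hN⟩ := exists_eval_lt_two_pow (3 * p * p + 1)
  have hlt := hN N le_rfl
  generalize N = n at hlt
  set T := p.eval n with hT
  simp only [Polynomial.eval_mul, Polynomial.eval_add, Polynomial.eval_one,
    Polynomial.eval_ofNat, ← hT] at hlt
  have hc := Program.isClassical_init hPc
  set c := P.init with hcdef
  have hpc : c.data.prob = 1 := P.prob_init
  have hw : 0 ≤ c.data.weight := by simp [hcdef, Program.init]
  obtain ⟨A, hA⟩ : ∃ A : Config → Prop, ∀ c, A c ↔ c.Halted ∧ fmt n c.data.out = ⊥ :=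
    ⟨_, fun _ => Iff.rfl⟩
  set M := Fintype.card (Equiv.Perm (Fin n → Bool)) with hM
  have hMpos : 0 < M := Fintype.card_pos
  have count : ∀ (G : Equiv.Perm (Fin n → Bool) → (Fin n → Bool) → Fin n → Bool),
      2 ^ T * ∑ π, branchProb (c.run (G π) T) A = ∑ w : Fin T → Bool,
        ((Finset.univ.filter fun π => A (c.coinRun (G π) T w)).card : ℝ) := by
    intro G
    rw [Finset.mul_sum]
    simp only [branchProb_run_eq_coinRun _ T hc, hpc]
    rw [Finset.sum_comm]
    refine Finset.sum_congr rfl fun w _ => ?_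
    rw [← Finset.sum_filter, Finset.sum_const, nsmul_eq_mul, mul_one]
  have hlow : (2 / 3 : ℝ) * M ≤ ∑ π : Equiv.Perm (Fin n → Bool), branchProb (c.run π T) A := by
    rw [mul_comm, ← nsmul_eq_mul, hM, ← Finset.card_univ]
    refine Finset.card_nsmul_le_sum _ _ _ fun π _ => ?_
    have h1 := (hp n (Instance.ofFun π (isCongruence_of_injective π.injective))).2
    have h2 : (Instance.ofFun (L := L) π (isCongruence_of_injective π.injective)).kernel = ⊥ :=
      Setoid.ker_eq_bot_iff.2 π.injective
    rw [h2] at h1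
    simp only [← hA] at h1
    exact h1
  have hup : ∀ (h : Fin n → Bool) (i : Fin n), h i = true →
      ∑ π : Equiv.Perm (Fin n → Bool), branchProb (c.run (π ∘ cosetRep h i) T) A ≤ (1 / 3 : ℝ) * M := by
    intro h i hi
    rw [mul_comm, ← nsmul_eq_mul, hM, ← Finset.card_univ]
    refine Finset.sum_le_card_nsmul _ _ _ fun π _ => ?_
    have hcg := isCongruence_cosetRep hL hi π.injective
    have h1 := (hp n (Instance.ofFun _ hcg)).2
    have h2 := branchProb_run_add_le (π ∘ cosetRep h i) T hw (E := A)
      (E' := fun c => c.Halted ∧ fmt n c.data.out = (Instance.ofFun _ hcg).kernel)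
      (fun c hc hc' => by
        have h3 : Setoid.ker (π ∘ cosetRep h i) = ⊥ := hc'.2.symm.trans ((hA c).1 hc).2
        have h4 : Setoid.ker (π ∘ cosetRep h i) (fun _ => false) h :=
          (ker_cosetRep hi π.injective _ _).2 ⟨true, fun j => by simp⟩
        rw [h3] at h4
        have h5 : (fun _ => false) = h := h4
        rw [← h5] at hi
        exact Bool.false_ne_true hi)
    have h6 : (2 / 3 : ℝ) ≤ branchProb (c.run (π ∘ cosetRep h i) T) _ := h1
    rw [hpc] at h2
    linarith
  -- On average over `π`, the output is the identity congruence with probability at least 2/3 on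
  -- injective oracles and at most 1/3 on oracles with period `h`. By `card_perm_le` the difference
  -- is covered by runs that query two points of one coset.
  have hbad : ∀ h : Fin n → Bool, h ≠ (fun _ => false) → (1 / 3 : ℝ) * M * 2 ^ T ≤
      ∑ w : Fin T → Bool, ((Finset.univ.filter fun π : Equiv.Perm (Fin n → Bool) =>
        HitsCoset h (c.queries π T w)).card : ℝ) := by
    intro h hne
    obtain ⟨i, hi⟩ := Function.ne_iff.1 hne
    have hi : h i = true := by simpa using hi
    have h1 : ∑ w : Fin T → Bool, ((Finset.univ.filter fun π : Equiv.Perm (Fin n → Bool) =>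
        A (c.coinRun π T w)).card : ℝ) ≤ ∑ w : Fin T → Bool,
        (((Finset.univ.filter fun π : Equiv.Perm (Fin n → Bool) =>
          A (c.coinRun (π ∘ cosetRep h i) T w)).card : ℝ) +
        ((Finset.univ.filter fun π : Equiv.Perm (Fin n → Bool) =>
        HitsCoset h (c.queries π T w)).card : ℝ)) :=
      Finset.sum_le_sum fun w _ => by exact_mod_cast card_perm_le A T w hc h i
    rw [Finset.sum_add_distrib, ← count (fun π => π), ← count (fun π => π ∘ cosetRep h i)] at h1
    have h2 : (0 : ℝ) < 2 ^ T := by positivity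
    have h3 := mul_le_mul_of_nonneg_left hlow h2.le
    have h4 := mul_le_mul_of_nonneg_left (hup h i hi) h2.le
    linarith
  -- For fixed `π` and coins, every such `h` is a difference of two query points, and there are at
  -- most `T²` of these.
  have hsum : (∑ h ∈ Finset.univ.erase (fun _ : Fin n => false), ∑ w : Fin T → Bool,
      ((Finset.univ.filter fun π : Equiv.Perm (Fin n → Bool) =>
        HitsCoset h (c.queries π T w)).card : ℝ)) ≤ 2 ^ T * (M * (T * T)) := by
    rw [Finset.sum_comm]
    have : ∀ w : Fin T → Bool, (∑ h ∈ Finset.univ.erase (fun _ : Fin n => false),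
      ((Finset.univ.filter fun π : Equiv.Perm (Fin n → Bool) =>
        HitsCoset h (c.queries π T w)).card : ℝ)) ≤ M * (T * T) := by
      intro w
      have h1 := Finset.sum_card_bipartiteAbove_eq_sum_card_bipartiteBelow
        (s := Finset.univ.erase (fun _ : Fin n => false))
        (t := (Finset.univ : Finset (Equiv.Perm (Fin n → Bool))))
        (fun h (π : Equiv.Perm (Fin n → Bool)) => HitsCoset h (c.queries π T w))
      have h2 : ∑ π ∈ (Finset.univ : Finset (Equiv.Perm (Fin n → Bool))),
          (Finset.bipartiteBelow (fun h (π : Equiv.Perm (Fin n → Bool)) =>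
            HitsCoset h (c.queries π T w))
            (Finset.univ.erase (fun _ : Fin n => false)) π).card ≤ M * (T * T) := by
        rw [hM, ← Finset.card_univ, ← smul_eq_mul]
        refine Finset.sum_le_card_nsmul _ _ _ fun π _ => ?_
        refine (Finset.card_le_card (t := (c.queries π T w ×ˢ c.queries π T w).image
          fun q => vxor q.1 q.2) ?_).trans (Finset.card_image_le.trans ?_)
        · intro h hh
          simp only [Finset.bipartiteBelow, Finset.mem_filter] at hh
          obtain ⟨-, x, hx, hxh⟩ := hh
          refine Finset.mem_image.2 ⟨(x, vxor x h), Finset.mem_product.2 ⟨hx, hxh⟩, ?_⟩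
          funext j
          simp [vxor, ← Bool.xor_assoc]
        · rw [Finset.card_product]
          exact Nat.mul_le_mul (c.card_queries_le _ T w) (c.card_queries_le _ T w)
      rw [← h1] at h2
      simp only [Finset.bipartiteAbove] at h2
      exact_mod_cast h2
    refine (Finset.sum_le_card_nsmul _ _ _ fun w _ => this w).trans (le_of_eq ?_)
    rw [nsmul_eq_mul, Finset.card_univ]
    simp
  have hlow2 := (Finset.card_nsmul_le_sum (Finset.univ.erase (fun _ : Fin n => false)) _ _
    fun h hh => hbad h (Finset.ne_of_mem_erase hh)).trans hsum
  rw [Finset.card_erase_of_mem (Finset.mem_univ _), nsmul_eq_mul, Finset.card_univ] at hlow2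
  have hcard : Fintype.card (Fin n → Bool) = 2 ^ n := by simp
  have hbig : 3 * T * T + 1 ≤ Fintype.card (Fin n → Bool) - 1 := by omega
  have hbig' : (3 * T * T + 1 : ℝ) ≤ ((Fintype.card (Fin n → Bool) - 1 : ℕ) : ℝ) := by exact_mod_cast hbig
  have hpos : (0 : ℝ) < M * 2 ^ T := by positivity
  have h9 := mul_le_mul_of_nonneg_right hbig' hpos.le
  nlinarith

end HKP

namespace HKP

/-! ### A program logic -/

section
variable {n : ℕ} (F : (Fin n → Bool) → (Fin n → Bool))

/-- All branches halt within `T` steps, and the output is in `A` with probability at least `v`. -/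
def Good (A : List Bool → Prop) (T : ℕ) (c : Config) (v : ℝ) : Prop :=
  (∀ c' ∈ c.run F T, c'.Halted) ∧ v ≤ branchProb (c.run F T) (outEvent A)

variable {F}

/-- Halted configurations stay put, so a time bound may be enlarged freely; this lets running times
be rounded up in the rules below. -/
theorem Config.run_succ_of_halted {T : ℕ} {c : Config} (h : ∀ c' ∈ c.run F T, c'.Halted) :
    c.run F (T + 1) = c.run F T := by
  induction T generalizing c with
  | zero =>
    obtain ⟨k, d⟩ := c
    have : k = [] := h ⟨k, d⟩ (by simp [Config.run])
    subst this
    simp [Config.run, Config.step]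
  | succ T ih =>
    rw [Config.run]
    conv_rhs => rw [Config.run]
    simp only [List.flatMap_def]
    congr 1
    refine List.map_congr_left fun c' hc' => ih fun c'' hc'' => h _ ?_
    rw [Config.run]
    exact List.mem_flatMap.2 ⟨c', hc', hc''⟩

theorem Good.mono {A : List Bool → Prop} {T T' : ℕ} {c : Config} {v v' : ℝ} (h : Good F A T c v)
    (hT : T ≤ T') (hv : v' ≤ v) : Good F A T' c v' := by
  induction hT with
  | refl => exact ⟨h.1, hv.trans h.2⟩
  | step _ ih =>
    rw [Good, Config.run_succ_of_halted ih.1]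
    exact ih

theorem Good.step {A : List Bool → Prop} {T : ℕ} {c : Config} {v : Config → ℝ}
    (h : ∀ c' ∈ c.step F, Good F A T c' (v c')) :
    Good F A (T + 1) c ((c.step F).map v).sum := by
  refine ⟨fun c' hc' => ?_, ?_⟩
  · rw [Config.run] at hc'
    obtain ⟨c'', h1, h2⟩ := List.mem_flatMap.1 hc'
    exact (h _ h1).1 _ h2
  · rw [branchProb_run_succ]
    exact list_sum_map_le fun c' hc' => (h c' hc').2

variable (F)

/-- If `p` is executed on the data `d` then it terminates within `T` steps with data that satisfy
`Post`, and the sum of the values of `V` over the branches is at least `v`. -/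
def Tri (T : ℕ) (p : Program) (d : Data) (Post : Data → Prop) (V : Data → ℝ) (v : ℝ) : Prop :=
  ∀ A k T', (∀ d', Post d' → Good F A T' ⟨k, d'⟩ (V d')) → Good F A (T + T') ⟨p :: k, d⟩ v

variable {F}

theorem Tri.conseq {T T' : ℕ} {p : Program} {d : Data} {Post Post' : Data → Prop}
    {V V' : Data → ℝ} {v v' : ℝ} (h : Tri F T p d Post V v) (hT : T ≤ T')
    (hP : ∀ d', Post d' → Post' d' ∧ V d' ≤ V' d') (hv : v' ≤ v) : Tri F T' p d Post' V' v' := by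
  intro A k T'' H
  exact (h A k T'' fun d' hd' => (H d' (hP d' hd').1).mono le_rfl (hP d' hd').2).mono (by omega) hv

/-- `Tri` quantifies over the remaining control stack, so `p₂` is simply pushed onto it; the value
function after `p₁` is the value required before `p₂`. -/
theorem Tri.seq {T₁ T₂ : ℕ} {p₁ p₂ : Program} {d : Data} {P₁ P₂ : Data → Prop}
    {V₁ V₂ : Data → ℝ} {v : ℝ} (h₁ : Tri F T₁ p₁ d P₁ V₁ v)
    (h₂ : ∀ d', P₁ d' → Tri F T₂ p₂ d' P₂ V₂ (V₁ d')) :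
    Tri F (T₁ + T₂ + 1) (.seq p₁ p₂) d P₂ V₂ v := by
  intro A k T' H
  have h := h₁ A (p₂ :: k) (T₂ + T') fun d' hd' => h₂ d' hd' A k T' H
  have := Good.step (F := F) (c := ⟨.seq p₁ p₂ :: k, d⟩) (v := fun _ => v) (T := T₁ + (T₂ + T'))
    (A := A) (by intro c' hc'; simp only [Config.step, List.mem_singleton] at hc'; subst hc'; exact h)
  exact this.mono (by omega) (by simp [Config.step])

theorem Tri.ite {T : ℕ} {p₁ p₂ : Program} {e : Expr} {d : Data} {P : Data → Prop}
    {V : Data → ℝ} {v : ℝ} (h₁ : e.eval n d.mem ≠ 0 → Tri F T p₁ d P V v)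
    (h₂ : e.eval n d.mem = 0 → Tri F T p₂ d P V v) :
    Tri F (T + 1) (.ite e p₁ p₂) d P V v := by
  intro A k T' H
  have := Good.step (F := F) (c := ⟨.ite e p₁ p₂ :: k, d⟩) (v := fun _ => v) (T := T + T')
    (A := A) (by
      intro c' hc'
      simp only [Config.step, List.mem_singleton] at hc'
      subst hc'
      split_ifs with h
      · exact h₁ h A k T' H
      · exact h₂ (by simpa using h) A k T' H)
  exact this.mono (by omega) (by simp [Config.step])

theorem Tri.loop_exit {p : Program} {e : Expr} {d : Data} {P : Data → Prop}
    {V : Data → ℝ} (he : e.eval n d.mem = 0) (hP : P d) : Tri F 1 (.loop e p) d P V (V d) := by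
  intro A k T' H
  have := Good.step (F := F) (c := ⟨.loop e p :: k, d⟩) (v := fun _ => V d) (T := T')
    (A := A) (by
      intro c' hc'
      simp only [Config.step, List.mem_singleton, he] at hc'
      subst hc'
      exact H d hP)
  exact this.mono (by omega) (by simp [Config.step])

theorem Tri.loop_step {T₁ T₂ : ℕ} {p : Program} {e : Expr} {d : Data} {P₁ P₂ : Data → Prop}
    {V₁ V₂ : Data → ℝ} {v : ℝ} (he : e.eval n d.mem ≠ 0) (h₁ : Tri F T₁ p d P₁ V₁ v)
    (h₂ : ∀ d', P₁ d' → Tri F T₂ (.loop e p) d' P₂ V₂ (V₁ d')) :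
    Tri F (T₁ + T₂ + 1) (.loop e p) d P₂ V₂ v := by
  intro A k T' H
  have h := h₁ A (.loop e p :: k) (T₂ + T') fun d' hd' => h₂ d' hd' A k T' H
  have := Good.step (F := F) (c := ⟨.loop e p :: k, d⟩) (v := fun _ => v) (T := T₁ + (T₂ + T'))
    (A := A) (by
      intro c' hc'
      simp only [Config.step, List.mem_singleton, if_pos he] at hc'
      subst hc'; exact h)
  exact this.mono (by omega) (by simp [Config.step])

theorem Tri.instr {c : Instr} {d : Data} {P : Data → Prop} {V : Data → ℝ}
    (hP : ∀ d' ∈ c.exec F d, P d') :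
    Tri F 1 (.instr c) d P V ((c.exec F d).map V).sum := by
  intro A k T' H
  have := Good.step (F := F) (c := ⟨.instr c :: k, d⟩) (v := fun c => V c.data) (T := T')
    (A := A) (by
      intro c' hc'
      simp only [Config.step, List.mem_map] at hc'
      obtain ⟨d', hd', rfl⟩ := hc'
      exact H d' (hP d' hd'))
  refine this.mono (by omega) (le_of_eq ?_)
  simp [Config.step, Function.comp_def]

theorem Tri.assign {a : ℕ} {i j e : Expr} {d : Data} {P : Data → Prop} {V : Data → ℝ}
    (hP : P { d with mem := d.mem.write a (i.eval n d.mem) (j.eval n d.mem) (e.eval n d.mem) }) :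
    Tri F 1 (.instr (.assign a i j e)) d P V
      (V { d with mem := d.mem.write a (i.eval n d.mem) (j.eval n d.mem) (e.eval n d.mem) }) := by
  have := Tri.instr (F := F) (c := .assign a i j e) (d := d) (P := P) (V := V)
    (by simpa [Instr.exec] using hP)
  simpa [Instr.exec] using this

theorem Tri.assign_seq {T : ℕ} {a : ℕ} {i j e : Expr} {p : Program} {d : Data} {P : Data → Prop}
    {V : Data → ℝ} {v : ℝ}
    (h : Tri F T p { d with mem := d.mem.write a (i.eval n d.mem) (j.eval n d.mem) (e.eval n d.mem) }
      P V v) : Tri F (T + 2) (.seq (.instr (.assign a i j e)) p) d P V v := by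
  refine (Tri.seq (P₁ := fun d' => d' = _) (V₁ := fun _ => v) (Tri.assign rfl)
    (T₂ := T) ?_).conseq (by omega) (fun _ h => ⟨h, le_rfl⟩) le_rfl
  rintro _ rfl
  exact h

theorem Tri.gate_seq {T : ℕ} {g : Gate Expr} {p : Program} {d : Data} {P : Data → Prop}
    {V : Data → ℝ} {v : ℝ}
    (h : Tri F T p { d with ψ := (g.map (Expr.eval n d.mem)).apply F d.ψ } P V v) :
    Tri F (T + 2) (.seq (.instr (.gate g)) p) d P V v := by
  refine (Tri.seq (P₁ := fun d' => d' = _) (V₁ := fun _ => v) ((Tri.instr (by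
    simp only [Instr.exec, List.mem_singleton]; exact fun _ h => h)).conseq le_rfl
      (fun _ h => ⟨h, le_rfl⟩) (by simp [Instr.exec])) (T₂ := T) ?_).conseq (by omega)
      (fun _ h => ⟨h, le_rfl⟩) le_rfl
  rintro _ rfl
  exact h

/-- Writing the answer to an oracle query to the memory. -/
def queryMem (F : (Fin n → Bool) → (Fin n → Bool)) (m : Memory) (a i b k : ℕ) : Memory :=
  fun a' i' j' => if h : a' = b ∧ i' = k ∧ j' < n then
    (F (fun l => decide (m a i l.1 ≠ 0)) ⟨j', h.2.2⟩).toNat else m a' i' j'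

theorem Tri.query_seq {T : ℕ} {a b : ℕ} {i k : Expr} {p : Program} {d : Data} {P : Data → Prop}
    {V : Data → ℝ} {v : ℝ}
    (h : Tri F T p { d with mem := queryMem F d.mem a (i.eval n d.mem) b (k.eval n d.mem) } P V v) :
    Tri F (T + 2) (.seq (.instr (.query a i b k)) p) d P V v := by
  refine (Tri.seq (P₁ := fun d' => d' = _) (V₁ := fun _ => v) ((Tri.instr (by
    simp only [Instr.exec, List.mem_singleton]; exact fun _ h => h)).conseq le_rfl
      (fun _ h => ⟨h, le_rfl⟩) (by simp [Instr.exec])) (T₂ := T) ?_).conseq (by omega)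
      (fun _ h => ⟨h, le_rfl⟩) le_rfl
  rintro _ rfl
  exact h

theorem Tri.emit {e : Expr} {d : Data} {P : Data → Prop} {V : Data → ℝ}
    (hP : P { d with out := d.out ++ [decide (e.eval n d.mem ≠ 0)] }) :
    Tri F 1 (.instr (.emit e)) d P V (V { d with out := d.out ++ [decide (e.eval n d.mem ≠ 0)] }) := by
  have := Tri.instr (F := F) (c := .emit e) (d := d) (P := P) (V := V)
    (by simpa [Instr.exec] using hP)
  simpa [Instr.exec] using this

theorem Memory.write_ne (m : Memory) {a a' : ℕ} (h : a' ≠ a) (i j v : ℕ) :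
    m.write a i j v a' = m a' := by
  funext i' j'; simp [Memory.write, h]

theorem Memory.write_eq (m : Memory) (a i j v i' j' : ℕ) :
    m.write a i j v a i' j' = if i' = i ∧ j' = j then v else m a i' j' := by
  simp [Memory.write]

theorem queryMem_ne (m : Memory) {a' b : ℕ} (h : a' ≠ b) (a i k : ℕ) :
    queryMem F m a i b k a' = m a' := by
  funext i' j'; simp [queryMem, h]

/-- Setting the variable in the first cell of an array. -/
def Data.set (d : Data) (c v : ℕ) : Data := { d with mem := d.mem.write c 0 0 v }

/-- `for c < N do p`. -/
def forLoop (c : ℕ) (N : Expr) (p : Program) : Program :=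
  .seq (.instr (.assign c (.const 0) (.const 0) (.const 0)))
    (.loop (.sub N (.get c (.const 0) (.const 0)))
      (.seq p (.instr (.assign c (.const 0) (.const 0)
        (.add (.get c (.const 0) (.const 0)) (.const 1))))))

/-- The loop writes its counter outside the body, so invariant and value must tolerate such writes.
Each iteration costs three extra steps (test, sequencing, increment); initialization and exit cost
three more. -/
theorem Tri.forLoop {c : ℕ} {N : Expr} {p : Program} {N₀ T : ℕ} {Inv : ℕ → Data → Prop}
    {V : ℕ → Data → ℝ} (hN : ∀ m, N.eval n m = N₀)
    (hset : ∀ i d v, Inv i d → Inv i (d.set c v) ∧ V i d ≤ V i (d.set c v))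
    (hbody : ∀ i < N₀, ∀ d, Inv i d → d.mem c 0 0 = i →
      Tri F T p d (fun d' => Inv (i + 1) d' ∧ d'.mem c 0 0 = i) (V (i + 1)) (V i d))
    {d : Data} (h0 : Inv 0 d) :
    Tri F (N₀ * (T + 3) + 3) (HKP.forLoop c N p) d (Inv N₀) (V N₀) (V 0 d) := by
  have key : ∀ r i, i + r = N₀ → ∀ d, Inv i d → d.mem c 0 0 = i →
      Tri F (r * (T + 3) + 1) (.loop (.sub N (.get c (.const 0) (.const 0)))
      (.seq p (.instr (.assign c (.const 0) (.const 0)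
        (.add (.get c (.const 0) (.const 0)) (.const 1)))))) d (Inv N₀) (V N₀) (V i d) := by
    intro r
    induction r with
    | zero =>
      intro i hi d hd hc
      obtain rfl : i = N₀ := by omega
      exact (Tri.loop_exit (by simp [Expr.eval, hN, hc]) hd).conseq (by omega)
        (fun _ h => ⟨h, le_rfl⟩) le_rfl
    | succ r ih =>
      intro i hi d hd hc
      refine (Tri.loop_step (T₁ := T + 2) (T₂ := r * (T + 3) + 1)
        (P₁ := fun d' => Inv (i + 1) d' ∧ d'.mem c 0 0 = i + 1) (V₁ := V (i + 1))
        (by simp [Expr.eval, hN, hc]; omega) ?_ ?_).conseq (by ring_nf; omega)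
        (fun _ h => ⟨h, le_rfl⟩) le_rfl
      · refine (Tri.seq (hbody i (by omega) d hd hc) (T₂ := 1)
          (P₂ := fun d' => Inv (i + 1) d' ∧ d'.mem c 0 0 = i + 1) (V₂ := V (i + 1))
          fun d' hd' => ?_).conseq (by omega) (fun _ h => ⟨h, le_rfl⟩) le_rfl
        have e := hset (i + 1) d' (i + 1) hd'.1
        refine (Tri.assign (V := V (i + 1))
          (P := fun d' => Inv (i + 1) d' ∧ d'.mem c 0 0 = i + 1) ?_).conseq le_rfl (fun _ h => ⟨h, le_rfl⟩) ?_
        · simp only [Expr.eval, hd'.2]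
          exact ⟨e.1, by simp [Memory.write]⟩
        · simp only [Expr.eval, hd'.2]
          exact e.2
      · intro d' hd'
        exact ih (i + 1) (by omega) d' hd'.1 hd'.2
  have e := hset 0 d 0 h0
  refine (Tri.assign_seq (T := N₀ * (T + 3) + 1) ?_).conseq (by omega)
    (fun _ h => ⟨h, le_rfl⟩) le_rfl
  exact (key N₀ 0 (by omega) _ e.1 (by simp [Data.set, Memory.write])).conseq le_rfl
    (fun _ h => ⟨h, le_rfl⟩) e.2

variable (F) in
/-- Deterministic execution: `Tri` for all constant `V`. -/
def Det (T : ℕ) (p : Program) (d : Data) (Post : Data → Prop) : Prop :=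
  ∀ v, Tri F T p d Post (fun _ => v) v

theorem Det.conseq {T T' : ℕ} {p : Program} {d : Data} {Post Post' : Data → Prop}
    (h : Det F T p d Post) (hT : T ≤ T') (hP : ∀ d', Post d' → Post' d') : Det F T' p d Post' :=
  fun v => (h v).conseq hT (fun d' hd' => ⟨hP d' hd', le_rfl⟩) le_rfl

theorem Det.seq {T₁ T₂ : ℕ} {p₁ p₂ : Program} {d : Data} {P₁ P₂ : Data → Prop}
    (h₁ : Det F T₁ p₁ d P₁) (h₂ : ∀ d', P₁ d' → Det F T₂ p₂ d' P₂) :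
    Det F (T₁ + T₂ + 1) (.seq p₁ p₂) d P₂ :=
  fun v => (h₁ v).seq fun d' hd' => h₂ d' hd' v

theorem Det.forLoop {c : ℕ} {N : Expr} {p : Program} {N₀ T : ℕ} {Inv : ℕ → Data → Prop}
    (hN : ∀ m, N.eval n m = N₀) (hset : ∀ i d v, Inv i d → Inv i (d.set c v))
    (hbody : ∀ i < N₀, ∀ d, Inv i d → d.mem c 0 0 = i →
      Det F T p d (fun d' => Inv (i + 1) d' ∧ d'.mem c 0 0 = i))
    {d : Data} (h0 : Inv 0 d) :
    Det F (N₀ * (T + 3) + 3) (HKP.forLoop c N p) d (Inv N₀) :=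
  fun v => Tri.forLoop (V := fun _ _ => v) hN (fun i d v h => ⟨hset i d v h, le_rfl⟩)
    (fun i hi d hd hc => hbody i hi d hd hc v) h0

/-- A failed branch may only claim a value at most 0, a successful one at most its probability; then
the initial value bounds the success probability from below. -/
theorem Tri.solves {A : List Bool → Prop} {T : ℕ} {P : Program} {Post : Data → Prop}
    {V : Data → ℝ} {v : ℝ} (h : Tri F T P P.init.data Post V v)
    (hV : ∀ d, Post d → V d ≤ 0 ∧ 0 ≤ d.prob ∨ A d.out ∧ V d ≤ d.prob) : Good F A T P.init v := by
  refine (h A [] 0 fun d hd => ⟨?_, ?_⟩).mono (by omega) le_rfl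
  · intro c' hc'
    simp only [Config.run, List.mem_singleton] at hc'
    subst hc'; rfl
  · rw [Config.run, branchProb_cons, branchProb_nil, add_zero]
    rcases hV d hd with ⟨h1, h2⟩ | ⟨h1, h2⟩
    · split_ifs
      exacts [h1.trans h2, h1]
    · rw [if_pos ⟨rfl, h1⟩]; exact h2

end
end HKP

namespace HKP

/-! ### Frame conditions for the data -/

theorem Data.set_mem_ne (d : Data) {a c : ℕ} (h : a ≠ c) (v : ℕ) : (d.set c v).mem a = d.mem a :=
  Memory.write_ne _ h _ _ _

/-- The data agree, except possibly for the output and the arrays in `S`. -/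
structure Data.Frame (S : Finset ℕ) (d₀ d : Data) : Prop where
  mem : ∀ a, a ∉ S → d.mem a = d₀.mem a
  weight : d.weight = d₀.weight
  ψ : d.ψ = d₀.ψ

theorem Data.Frame.refl (S : Finset ℕ) (d : Data) : Data.Frame S d d := ⟨fun _ _ => rfl, rfl, rfl⟩

theorem Data.Frame.set {S : Finset ℕ} {d₀ d : Data} (h : Data.Frame S d₀ d) {c : ℕ} (hc : c ∈ S)
    (v : ℕ) : Data.Frame S d₀ (d.set c v) :=
  ⟨fun a ha => by
    rw [← h.mem a ha]
    exact Memory.write_ne _ (show a ≠ c from fun h => ha (h ▸ hc)) _ _ _, h.weight, h.ψ⟩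

theorem Data.Frame.write {S : Finset ℕ} {d₀ d : Data} (h : Data.Frame S d₀ d) {c : ℕ} (hc : c ∈ S)
    (i j v : ℕ) : Data.Frame S d₀ { d with mem := d.mem.write c i j v } :=
  ⟨fun a ha => by
    rw [← h.mem a ha]
    exact Memory.write_ne _ (show a ≠ c from fun h => ha (h ▸ hc)) _ _ _, h.weight, h.ψ⟩

theorem Data.Frame.trans {S S' : Finset ℕ} {d₀ d d' : Data} (h : Data.Frame S d₀ d)
    (h' : Data.Frame S' d d') (hS : S' ⊆ S) : Data.Frame S d₀ d' :=
  ⟨fun a ha => (h'.mem a fun h => ha (hS h)).trans (h.mem a ha), h'.weight.trans h.weight,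
    h'.ψ.trans h.ψ⟩

theorem Data.Frame.prob {S : Finset ℕ} {d₀ d : Data} (h : Data.Frame S d₀ d) : d.prob = d₀.prob := by
  rw [Data.prob, Data.prob, h.weight, h.ψ]

/-! ### Printing a list of generators -/

/-- The value of the variable in the first cell of an array. -/
abbrev Expr.var (c : ℕ) : Expr := .get c (.const 0) (.const 0)

/-- Print the pairs whose first components are zero and whose second components are the rows of
array `4`. -/
def emitRows : Program :=
  forLoop 10 .size (.seq (forLoop 11 .size (.instr (.emit (.const 0))))
    (forLoop 11 .size (.instr (.emit (.get 4 (.var 10) (.var 11))))))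

/-- The bits printed for one row. -/
def rowOut (n : ℕ) (g : ℕ → ℕ) : List Bool :=
  List.replicate n false ++ (List.range n).map fun j => decide (g j ≠ 0)

theorem length_rowOut (n : ℕ) (g : ℕ → ℕ) : (rowOut n g).length = 2 * n := by
  simp [rowOut]; omega

section
variable {n : ℕ} {F : (Fin n → Bool) → (Fin n → Bool)}

theorem det_emitRows (d : Data) :
    Det F (n * (n * 8 + 10) + 3) emitRows d fun d' =>
      Data.Frame {10, 11} d d' ∧ d'.out = d.out ++ (List.range n).flatMap fun k => rowOut n (d.mem 4 k) := by
  refine (Det.forLoop (T := n * 8 + 7) (N₀ := n) (Inv := fun i d' => Data.Frame {10, 11} d d' ∧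
    d'.out = d.out ++ (List.range i).flatMap fun k => rowOut n (d.mem 4 k)) (fun m => rfl)
    (fun i d' v h => ⟨h.1.set (by simp) v, h.2⟩) ?_ ⟨Data.Frame.refl _ d, by simp⟩).conseq
    le_rfl fun _ h => h
  rintro k hk d₁ ⟨hF, ho⟩ hc
  have e4 : d₁.mem 4 = d.mem 4 := hF.mem 4 (by simp)
  refine (Det.seq (T₁ := n * 4 + 3) (T₂ := n * 4 + 3)
    (P₁ := fun d' => Data.Frame {11} d₁ d' ∧ d'.out = d₁.out ++ List.replicate n false)
    ?_ ?_).conseq (by omega) fun _ h => h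
  · refine Det.forLoop (T := 1) (N₀ := n) (Inv := fun i d' => Data.Frame {11} d₁ d' ∧
      d'.out = d₁.out ++ List.replicate i false) (fun m => rfl)
      (fun i d' v h => ⟨h.1.set (by simp) v, h.2⟩) ?_ ⟨Data.Frame.refl _ _, by simp⟩
    rintro i hi d₂ ⟨hF₂, ho₂⟩ hc₂ v
    refine Tri.emit (V := fun _ => v) ?_
    refine ⟨⟨⟨hF₂.mem, hF₂.weight, hF₂.ψ⟩, ?_⟩, hc₂⟩
    simp [ho₂, Expr.eval, List.replicate_succ']
  · rintro d₂ ⟨hF₂, ho₂⟩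
    refine (Det.forLoop (T := 1) (N₀ := n) (Inv := fun i d' => Data.Frame {11} d₁ d' ∧
      d'.out = d₂.out ++ (List.range i).map fun j => decide (d.mem 4 k j ≠ 0)) (fun m => rfl)
      (fun i d' v h => ⟨h.1.set (by simp) v, h.2⟩) ?_ ⟨hF₂, by simp⟩).conseq le_rfl ?_
    · rintro i hi d₃ ⟨hF₃, ho₃⟩ hc₃ v
      refine Tri.emit (V := fun _ => v) ?_
      refine ⟨⟨⟨hF₃.mem, hF₃.weight, hF₃.ψ⟩, ?_⟩, hc₃⟩
      have e10 : d₃.mem 10 = d₁.mem 10 := hF₃.mem 10 (by simp)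
      have e4' : d₃.mem 4 = d.mem 4 := (hF₃.mem 4 (by simp)).trans e4
      simp only [ho₃, Expr.eval, e10, e4', hc, hc₃, List.range_succ, List.map_append,
        List.map_cons, List.map_nil, List.append_assoc]
    · rintro d₃ ⟨hF₃, ho₃⟩
      refine ⟨⟨hF.trans hF₃ (by simp), ?_⟩, by rw [hF₃.mem 10 (by simp)]; exact hc⟩
      rw [ho₃, ho₂, ho, List.range_succ, List.flatMap_append]
      simp [rowOut]

end

theorem getD_flatMap_range {B : ℕ} {f : ℕ → List Bool} (hf : ∀ k, (f k).length = B) {N j i : ℕ}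
    (hj : j < N) (hi : i < B) :
    ((List.range N).flatMap f).getD (B * j + i) false = (f j).getD i false := by
  have hlen : ∀ N, ((List.range N).flatMap f).length = B * N := by
    intro N
    simp [List.length_flatMap, hf, mul_comm]
  induction N with
  | zero => omega
  | succ N ih =>
    rw [List.range_succ, List.flatMap_append]
    by_cases h : j < N
    · rw [List.getD_append, ih h]
      rw [hlen]
      calc B * j + i < B * j + B := by omega
        _ = B * (j + 1) := by ring
        _ ≤ B * N := Nat.mul_le_mul_left _ h
    · obtain rfl : j = N := by omega
      rw [List.getD_append_right _ _ _ _ (by rw [hlen]; omega), hlen]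
      simp

open FirstOrder in
theorem generatorFormat_rows {L : Language} [L.Structure Bool] {n : ℕ} (g : ℕ → ℕ → ℕ) :
    generatorFormat L n ((List.range n).flatMap fun k => rowOut n (g k)) =
      congruenceGen L (Set.range fun k : Fin n =>
        ((fun _ => false : Fin n → Bool), fun j : Fin n => decide (g k j ≠ 0))) := by
  -- For `n = 0` the blocks are empty and block counting breaks down, but `{0,1}^0` has only one
  -- point.
  rcases Nat.eq_zero_or_pos n with rfl | hn
  · refine Setoid.ext fun a b => ?_
    rw [Subsingleton.elim a b]
    exact iff_of_true (Setoid.refl' _ _) (Setoid.refl' _ _)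
  · unfold generatorFormat
    congr 1
    have hlen : ((List.range n).flatMap fun k => rowOut n (g k)).length = 2 * n * n := by
      simp [List.length_flatMap, length_rowOut]; ring
    have h1 : ∀ j < n, ∀ i : Fin n, ((List.range n).flatMap fun k => rowOut n (g k)).getD
        (2 * n * j + i) false = false := by
      intro j hj i
      rw [getD_flatMap_range (fun k => length_rowOut n (g k)) hj (by omega), rowOut,
        List.getD_append _ _ _ _ (by simp)]
      simp
    have h2 : ∀ j < n, ∀ i : Fin n, ((List.range n).flatMap fun k => rowOut n (g k)).getD
        (2 * n * j + n + i) false = decide (g j i ≠ 0) := by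
      intro j hj i
      rw [add_assoc, getD_flatMap_range (fun k => length_rowOut n (g k)) hj (by omega), rowOut,
        List.getD_append_right _ _ _ _ (by simp)]
      simp [List.getD_eq_getElem?_getD]
    ext ⟨p, q⟩
    simp only [Set.mem_ofPred_eq, Set.mem_range, Prod.mk.injEq, hlen]
    constructor
    · rintro ⟨j, hj, hpq⟩
      have hjn : j < n := by
        have := Nat.le_of_mul_le_mul_left hj (by omega)
        omega
      refine ⟨⟨j, hjn⟩, funext fun i => ?_, funext fun i => ?_⟩
      · rw [(hpq i).1, h1 j hjn]
      · rw [(hpq i).2, h2 j hjn]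
    · rintro ⟨j, rfl, rfl⟩
      refine ⟨j, Nat.mul_le_mul_left _ j.2, fun i => ⟨?_, ?_⟩⟩
      · rw [h1 j j.2]
      · rw [h2 j j.2]

end HKP

namespace HKP

/-! ### The deterministic algorithm -/

/-- Compare the answers to the zero string and to the `i`-th unit vector, where `i` is the variable
`12`, and store the result on the diagonal of array `4`. -/
def compareUnit : Program :=
  .seq (.instr (.assign 1 (.const 1) (.var 12) (.const 1)))
  (.seq (.instr (.query 1 (.const 1) 2 (.const 1)))
  (.seq (.instr (.assign 1 (.const 1) (.var 12) (.const 0)))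
  (.seq (.instr (.assign 3 (.const 0) (.const 0) (.const 0)))
  -- The two truncated differences add up to `|a - b|`, so variable `3` counts the places where the
  -- answers differ, and `1 - x` below tests it for zero.
  (.seq (forLoop 11 .size (.instr (.assign 3 (.const 0) (.const 0) (.add (.var 3)
    (.add (.sub (.get 2 (.const 0) (.var 11)) (.get 2 (.const 1) (.var 11)))
      (.sub (.get 2 (.const 1) (.var 11)) (.get 2 (.const 0) (.var 11))))))))
  (.instr (.assign 4 (.var 12) (.var 12) (.sub (.const 1) (.var 3))))))))

/-- Find the coordinates that the kernel ignores. -/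
def coordinateProgram : Program :=
  .seq (.instr (.query 1 (.const 0) 2 (.const 0)))
  (.seq (forLoop 12 .size compareUnit) emitRows)

theorem coordinateProgram_isDeterministic : coordinateProgram.IsDeterministic := by
  simp [coordinateProgram, compareUnit, emitRows, forLoop, Program.IsDeterministic]

section
variable {n : ℕ} {F : (Fin n → Bool) → (Fin n → Bool)}

def unitVec (n k : ℕ) : Fin n → Bool := fun j => decide (j.1 = k)

/-- Invariant after `i` coordinates. Array `1` is zero between rounds: its row 1 holds a unit vector
only during a round, so one bit suffices to prepare the next query. -/
structure CoordInv (F : (Fin n → Bool) → (Fin n → Bool)) (i : ℕ) (d : Data) : Prop where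
  zero : ∀ a b, d.mem 1 a b = 0
  ans : ∀ j : Fin n, d.mem 2 0 j = (F (fun _ => false) j).toNat
  row : ∀ k l, d.mem 4 k l = if k = l ∧ k < i ∧ F (fun _ => false) = F (unitVec n k) then 1 else 0
  out : d.out = []
  prob : d.prob = 1

theorem det_compareUnit {i : ℕ} {d : Data} (h : CoordInv F i d) (hc : d.mem 12 0 0 = i)
    (hi : i < n) :
    Det F (n * 4 + 15) compareUnit d fun d' => CoordInv F (i + 1) d' ∧ d'.mem 12 0 0 = i := by
  intro v
  unfold compareUnit
  refine (Tri.assign_seq (T := n * 4 + 13) (Tri.query_seq (T := n * 4 + 11)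
    (Tri.assign_seq (T := n * 4 + 9) (Tri.assign_seq (T := n * 4 + 7) ?_)))).conseq
    le_rfl (fun _ h => ⟨h, le_rfl⟩) le_rfl
  simp only [Expr.eval, hc]
  set m₁ := d.mem.write 1 1 i 1 with hm₁
  set m₂ := queryMem F m₁ 1 1 2 1 with hm₂
  have e12 : m₂ 12 = d.mem 12 := by rw [hm₂, queryMem_ne _ (by decide), hm₁, Memory.write_ne _ (by decide)]
  rw [e12, hc]
  set m₃ := m₂.write 1 1 i 0 with hm₃
  set d₀ : Data := ⟨m₃.write 3 0 0 0, d.out, d.weight, d.ψ⟩ with hd₀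
  have a1 : ∀ a b, d₀.mem 1 a b = 0 := by
    intro a b
    simp only [hd₀, hm₃]
    rw [Memory.write_ne _ (by decide), Memory.write_eq, hm₂, queryMem_ne _ (by decide), hm₁,
      Memory.write_eq, h.zero]
    split_ifs <;> rfl
  have a20 : ∀ j : Fin n, d₀.mem 2 0 j = (F (fun _ => false) j).toNat := by
    intro j
    simp only [hd₀, hm₃]
    rw [Memory.write_ne _ (by decide), Memory.write_ne _ (by decide), hm₂]
    simp only [queryMem, zero_ne_one, false_and, and_false, dite_false]
    rw [hm₁, Memory.write_ne _ (by decide)]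
    exact h.ans j
  have a21 : ∀ j : Fin n, d₀.mem 2 1 j = (F (unitVec n i) j).toNat := by
    intro j
    simp only [hd₀, hm₃]
    rw [Memory.write_ne _ (by decide), Memory.write_ne _ (by decide), hm₂]
    simp only [queryMem, true_and, j.2, dite_true]
    congr 2
    congr 1
    funext l
    rw [hm₁, Memory.write_eq, h.zero]
    by_cases hl : l.1 = i <;> simp [hl, unitVec]
  have a4 : d₀.mem 4 = d.mem 4 := by
    simp only [hd₀, hm₃]
    rw [Memory.write_ne _ (by decide), Memory.write_ne _ (by decide), hm₂,
      queryMem_ne _ (by decide), hm₁, Memory.write_ne _ (by decide)]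
  have a12 : d₀.mem 12 0 0 = i := by
    simp only [hd₀, hm₃]
    rw [Memory.write_ne _ (by decide), Memory.write_ne _ (by decide), e12, hc]
  have loop : Det F (n * 4 + 3) (forLoop 11 .size (.instr (.assign 3 (.const 0) (.const 0) (.add (.var 3)
    (.add (.sub (.get 2 (.const 0) (.var 11)) (.get 2 (.const 1) (.var 11)))
      (.sub (.get 2 (.const 1) (.var 11)) (.get 2 (.const 0) (.var 11)))))))) d₀ fun d' =>
      (Data.Frame {3, 11} d₀ d' ∧ d'.out = d₀.out) ∧
        (d'.mem 3 0 0 = 0 ↔ ∀ j < n, d₀.mem 2 0 j = d₀.mem 2 1 j) := by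
    refine Det.forLoop (T := 1) (N₀ := n) (Inv := fun i d' =>
      (Data.Frame {3, 11} d₀ d' ∧ d'.out = d₀.out) ∧
        (d'.mem 3 0 0 = 0 ↔ ∀ j < i, d₀.mem 2 0 j = d₀.mem 2 1 j)) (fun m => rfl) ?_ ?_ ?_
    · rintro i d' v ⟨⟨h1, h2⟩, h3⟩
      refine ⟨⟨h1.set (by simp) v, h2⟩, ?_⟩
      rw [← h3, Data.set_mem_ne _ (by decide)]
    · rintro j hj d' ⟨⟨h1, h2⟩, h3⟩ hc' v
      refine Tri.assign (V := fun _ => v) ?_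
      refine ⟨⟨⟨h1.write (by simp) _ _ _, h2⟩, ?_⟩, ?_⟩
      · have e2 : d'.mem 2 = d₀.mem 2 := h1.mem 2 (by simp)
        simp only [Expr.eval, Memory.write_eq, and_self, if_true, hc', e2, Nat.add_eq_zero_iff, h3]
        simp only [Nat.forall_lt_succ_right, Nat.sub_eq_zero_iff_le]
        constructor
        · rintro ⟨h4, h5, h6⟩
          exact ⟨h4, le_antisymm h5 h6⟩
        · rintro ⟨h4, h5⟩
          exact ⟨h4, h5.le, h5.ge⟩
      · dsimp only
        rw [Memory.write_ne _ (by decide)]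
        exact hc'
    · exact ⟨⟨Data.Frame.refl _ _, rfl⟩, by simp [hd₀, Memory.write]⟩
  refine (Tri.seq (loop v) (T₂ := 1) fun d' hd' => ?_).conseq (by omega)
    (fun _ h => ⟨h, le_rfl⟩) le_rfl
  obtain ⟨⟨hF, ho⟩, hflag⟩ := hd'
  have b12 : d'.mem 12 0 0 = i := by rw [hF.mem 12 (by simp)]; exact a12
  have hflag' : d'.mem 3 0 0 = 0 ↔ F (fun _ => false) = F (unitVec n i) := by
    rw [hflag]
    constructor
    · intro hh
      funext j
      have := hh j j.2
      rw [a20, a21] at this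
      revert this
      cases F (fun _ => false) j <;> cases F (unitVec n i) j <;> simp
    · intro hh j hj
      have h1 := a20 ⟨j, hj⟩
      have h2 := a21 ⟨j, hj⟩
      dsimp only at h1 h2
      rw [h1, h2, hh]
  refine Tri.assign (V := fun _ => v) ⟨⟨fun a b => ?_, fun j => ?_, fun k l => ?_, ho.trans h.out, ?_⟩, ?_⟩
  · dsimp only
    rw [Memory.write_ne _ (by decide), hF.mem 1 (by simp), a1]
  · dsimp only
    rw [Memory.write_ne _ (by decide), hF.mem 2 (by simp), a20]
  · dsimp only
    simp only [Memory.write_eq, Expr.eval, b12]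
    rw [hF.mem 4 (by simp), a4, h.row]
    by_cases hk : k = i
    · subst hk
      by_cases hl : l = k
      · subst hl
        by_cases hr : F (fun _ => false) = F (unitVec n l)
        · simp [hr, hflag'.2 hr]
        · have : d'.mem 3 0 0 ≠ 0 := fun h => hr (hflag'.1 h)
          simp [hr]; omega
      · have : ¬ k = l := fun h => hl h.symm
        simp [hl, this]
    · have : k < i + 1 ↔ k < i := by omega
      simp [hk, this]
  · exact hF.prob.trans h.prob
  · dsimp only
    rw [Memory.write_ne _ (by decide), b12]

theorem det_coordinateProgram : Det F (n * (n * 12 + 28) + 10) coordinateProgram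
    coordinateProgram.init.data fun d => d.prob = 1 ∧ d.out = (List.range n).flatMap fun k =>
      rowOut n fun l => if k = l ∧ k < n ∧ F (fun _ => false) = F (unitVec n k) then 1 else 0 := by
  intro v
  unfold coordinateProgram
  refine (Tri.query_seq (T := n * (n * 12 + 28) + 8) ?_).conseq le_rfl (fun _ h => ⟨h, le_rfl⟩) le_rfl
  refine (Det.seq (T₁ := n * (n * 4 + 18) + 3) (P₁ := CoordInv F n) (Det.forLoop (T := n * 4 + 15)
    (N₀ := n) (Inv := CoordInv F) (fun m => rfl) ?_ (fun i hi d hd hc => det_compareUnit hd hc hi) ?_)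
    (T₂ := n * (n * 8 + 10) + 3) ?_).conseq (by ring_nf; omega) (fun _ h => h) v
  · intro i d v h
    have e : ∀ a, a ≠ 12 → (d.set 12 v).mem a = d.mem a := fun a ha => d.set_mem_ne ha v
    refine ⟨?_, ?_, ?_, h.out, h.prob⟩
    · rw [e 1 (by decide)]; exact h.zero
    · rw [e 2 (by decide)]; exact h.ans
    · rw [e 4 (by decide)]; exact h.row
  · refine ⟨fun a b => rfl, fun j => ?_, fun k l => ?_, rfl, Program.prob_init coordinateProgram⟩
    · simp [Expr.eval, Program.init, queryMem]
    · simp [Expr.eval, Program.init, queryMem]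
  · intro d hd
    refine (det_emitRows d).conseq le_rfl fun d' ⟨hF, ho⟩ => ⟨hF.prob.trans hd.prob, ?_⟩
    rw [ho, hd.out, List.nil_append]
    congr 1
    funext k
    congr 1
    funext l
    exact hd.row k l

end

/-! ### Correctness of the deterministic algorithm -/

open FirstOrder
variable {L : Language} [L.Structure Bool]

theorem hasDeterministicAlgorithm (h : cloneMPT0 ⊆ termClone L Bool ∨
    cloneMPT1 ⊆ termClone L Bool ∨ cloneDM ⊆ termClone L Bool) :
    HasDeterministicAlgorithm L (generatorFormat L) := by
  obtain ⟨t, c, ht, hL⟩ := exists_separating h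
  refine ⟨coordinateProgram, coordinateProgram_isDeterministic,
    Polynomial.X * (Polynomial.X * 12 + 28) + 10, fun n I => ?_⟩
  have hg : Good I.oracle (fun o => generatorFormat L n o = I.kernel)
      (n * (n * 12 + 28) + 10) coordinateProgram.init 1 := by
    refine Tri.solves (det_coordinateProgram 1) fun d hd => Or.inr ⟨?_, hd.1.ge⟩
    rw [hd.2, generatorFormat_rows]
    have hu : ∀ i : Fin n, (fun j : Fin n => decide (j = i)) = unitVec n i := by
      intro i; funext j; simp [unitVec, Fin.ext_iff]
    refine ht.congruenceGen_eq hL I.isCongruence_kernel (fun i hi => ?_) fun i hi => ?_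
    · rw [I.kernel_iff, hu] at hi
      rw [hu]
      funext j
      simp [hi, unitVec, eq_comm]
    · rw [I.kernel_iff, hu] at hi
      funext j
      simp [hi]
  have e : (Polynomial.X * (Polynomial.X * 12 + 28) + 10 : Polynomial ℕ).eval n =
      n * (n * 12 + 28) + 10 := by simp
  rw [e]
  exact ⟨fun c hc _ => hg.1 c hc, hg.2⟩

theorem HasDeterministicAlgorithm.quantum {fmt : OutputFormat}
    (h : HasDeterministicAlgorithm L fmt) : HasQuantumAlgorithm L fmt := by
  obtain ⟨P, -, hP⟩ := h
  exact ⟨P, hP.mono (by norm_num)⟩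

end HKP

namespace HKP

/-! ### Characters and spans over the two-element field -/

/-- The sign `(-1) ^ |s ∩ h ∩ {0, …, q - 1}|`. -/
def chi (q : ℕ) (s h : Finset ℕ) : ℝ := ∏ j ∈ Finset.range q, if j ∈ s ∧ j ∈ h then -1 else 1

theorem chi_zero (s h : Finset ℕ) : chi 0 s h = 1 := by simp [chi]

theorem chi_succ (q : ℕ) (s h : Finset ℕ) :
    chi (q + 1) s h = chi q s h * if q ∈ s ∧ q ∈ h then -1 else 1 := by
  rw [chi, Finset.prod_range_succ, chi]

theorem chi_eq_one_or (q : ℕ) (s h : Finset ℕ) : chi q s h = 1 ∨ chi q s h = -1 := by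
  induction q with
  | zero => simp [chi]
  | succ q ih =>
    rw [chi_succ]
    rcases ih with h1 | h1 <;> rw [h1] <;> split_ifs <;> simp

theorem chi_symmDiff (q : ℕ) (s t h : Finset ℕ) :
    chi q (symmDiff s t) h = chi q s h * chi q t h := by
  rw [chi, chi, chi, ← Finset.prod_mul_distrib]
  refine Finset.prod_congr rfl fun j _ => ?_
  by_cases h1 : j ∈ s <;> by_cases h2 : j ∈ t <;> by_cases h3 : j ∈ h <;>
    simp [Finset.mem_symmDiff, h1, h2, h3]

theorem chi_comm (q : ℕ) (s h : Finset ℕ) : chi q s h = chi q h s := by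
  simp only [chi, and_comm]

theorem chi_empty (q : ℕ) (h : Finset ℕ) : chi q ∅ h = 1 := by simp [chi]

theorem chi_insert (q : ℕ) (s h : Finset ℕ) : chi q (insert q s) h = chi q s h := by
  refine Finset.prod_congr rfl fun j hj => ?_
  have : j ≠ q := by rw [Finset.mem_range] at hj; omega
  simp [this]

/-- The sums modulo 2 of the first `n` sets. -/
inductive SetSpan (n : ℕ) (g : ℕ → Finset ℕ) : Finset ℕ → Prop
  | zero : SetSpan n g ∅
  | add (x : Finset ℕ) (k : ℕ) (hk : k < n) : SetSpan n g x → SetSpan n g (symmDiff x (g k))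

theorem SetSpan.congr {n : ℕ} {g g' : ℕ → Finset ℕ} (h : ∀ k < n, g k = g' k) {x : Finset ℕ}
    (hx : SetSpan n g x) : SetSpan n g' x := by
  induction hx with
  | zero => exact zero
  | add x k hk _ ih => rw [h k hk]; exact ih.add x k hk

theorem SetSpan.subset {n : ℕ} {g : ℕ → Finset ℕ} (h : ∀ k < n, g k ⊆ Finset.range n) {x : Finset ℕ}
    (hx : SetSpan n g x) : x ⊆ Finset.range n := by
  induction hx with
  | zero => simp
  | add x k hk _ ih => exact Finset.symmDiff_subset_union.trans (Finset.union_subset ih (h k hk))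

theorem SetSpan.singletons {n : ℕ} {x : Finset ℕ} (hx : x ⊆ Finset.range n) :
    SetSpan n (fun k => {k}) x := by
  induction x using Finset.induction_on with
  | empty => exact zero
  | insert k x hk ih =>
    rw [← symmDiff_singleton_of_notMem hk]
    exact (ih ((Finset.subset_insert _ _).trans hx)).add x k
      (by simpa using hx (Finset.mem_insert_self k x))

/-- Intersecting the span with the annihilator of `y`, with the help of a pivot `w`. -/
theorem setSpan_pivot {n : ℕ} {g g' : ℕ → Finset ℕ} {w y : Finset ℕ} (hw : ∃ k < n, w = g k)
    (hwy : chi n w y = -1)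
    (hg : ∀ k < n, g' k = if chi n (g k) y = -1 then symmDiff (g k) w else g k) (x : Finset ℕ) :
    SetSpan n g' x ↔ SetSpan n g x ∧ chi n x y = 1 := by
  constructor
  · intro hx
    induction hx with
    | zero => exact ⟨.zero, chi_empty _ _⟩
    | add x k hk _ ih =>
      rw [hg k hk]
      split_ifs with h
      · obtain ⟨k', hk', rfl⟩ := hw
        refine ⟨?_, by rw [chi_symmDiff, chi_symmDiff, h, hwy, ih.2]; norm_num⟩
        rw [← symmDiff_assoc]
        exact (ih.1.add _ k hk).add _ k' hk'
      · refine ⟨ih.1.add _ k hk, ?_⟩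
        rw [chi_symmDiff, ih.2, (chi_eq_one_or n (g k) y).resolve_right h, one_mul]
  · rintro ⟨hx, hxy⟩
    -- Both signs are tracked: an element of the span with sign `-1` enters the annihilator after
    -- the pivot is added.
    have key : ∀ x, SetSpan n g x → (chi n x y = 1 → SetSpan n g' x) ∧
        (chi n x y = -1 → SetSpan n g' (symmDiff x w)) := by
      intro x hx
      induction hx with
      | zero => exact ⟨fun _ => .zero, fun h => by rw [chi_empty] at h; norm_num at h⟩
      | add x k hk _ ih =>
        rw [chi_symmDiff]
        by_cases h : chi n (g k) y = -1
        · have e : g' k = symmDiff (g k) w := by rw [hg k hk, if_pos h]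
          rw [h]
          refine ⟨fun h1 => ?_, fun h1 => ?_⟩
          · have := (ih.2 (by linarith)).add _ k hk
            rw [e] at this
            convert this using 1
            rw [symmDiff_assoc, ← symmDiff_assoc w, symmDiff_comm w (g k), symmDiff_assoc (g k),
              symmDiff_self, symmDiff_bot]
          · have := (ih.1 (by linarith)).add _ k hk
            rw [e, ← symmDiff_assoc] at this
            exact this
        · have e : g' k = g k := by rw [hg k hk, if_neg h]
          rw [(chi_eq_one_or n (g k) y).resolve_right h, mul_one]
          refine ⟨fun h1 => ?_, fun h1 => ?_⟩
          · have := (ih.1 h1).add _ k hk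
            rwa [e] at this
          · have := (ih.2 h1).add _ k hk
            rw [e] at this
            rwa [symmDiff_assoc, symmDiff_comm (g k) w, ← symmDiff_assoc]
    exact (key x hx).1 hxy

theorem SetSpan.chi_eq_one {n : ℕ} {g : ℕ → Finset ℕ} {y : Finset ℕ}
    (hg : ∀ k < n, chi n (g k) y = 1) {x : Finset ℕ} (hx : SetSpan n g x) : chi n x y = 1 := by
  induction hx with
  | zero => exact chi_empty _ _
  | add x k hk _ ih => rw [chi_symmDiff, ih, hg k hk, one_mul]

/-! ### Hadamard gates and translations -/

section
variable {n : ℕ} (F : (Fin n → Bool) → (Fin n → Bool))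

/-- Qubit `q` is 0 on the whole support of `ψ`, so only one of the two terms of the gate is nonzero.
-/
theorem hadamard_uniform {q : ℕ} {ψ : QState} {a : ℂ}
    (h : ∀ s, ψ s = if s ⊆ Finset.range q then a else 0) (s : Finset ℕ) :
    (Gate.h q).apply F ψ s =
      if s ⊆ Finset.range (q + 1) then ((1 / Real.sqrt 2 : ℝ) : ℂ) * a else 0 := by
  have h1 : ¬ insert q s ⊆ Finset.range q := fun h' => by
    simpa using h' (Finset.mem_insert_self q s)
  have h2 : s.erase q ⊆ Finset.range q ↔ s ⊆ Finset.range (q + 1) := by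
    rw [Finset.range_add_one, Finset.subset_insert_iff]
  rw [Gate.apply_h, h, h, if_neg h1, mul_zero, add_zero]
  simp only [h2, mul_ite, mul_zero]

/-- The overlap of a state with its translate by `h`, after the qubits below `q` have been
transformed. -/
noncomputable def overlap (N q : ℕ) (h : Finset ℕ) (ψ : QState) : ℂ :=
  ∑ s ∈ (Finset.range N).powerset,
    (chi q s h : ℂ) * (ψ s * starRingEnd ℂ (ψ (symmDiff s (h \ Finset.range q))))

theorem insert_symmDiff_of_notMem {q : ℕ} {s u : Finset ℕ} (hs : q ∉ s) (hu : q ∉ u) :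
    symmDiff (insert q s) u = insert q (symmDiff s u) := by
  ext j
  by_cases hj : j = q
  · subst hj; simp [Finset.mem_symmDiff, hs, hu]
  · simp [Finset.mem_symmDiff, hj]

/-- Conjugation by a Hadamard gate turns the bit flip of qubit `q` into its sign flip. The part of
the translation at `q` therefore becomes the factor of `chi` at `q`, and the overlap is unchanged;
on pairs of basis states this is an identity using that the squared gate constant is 1/2. -/
theorem overlap_h {N q : ℕ} (hq : q < N) (h : Finset ℕ) (ψ : QState) :
    overlap N (q + 1) h ((Gate.h q).apply F ψ) = overlap N q h ψ := by
  unfold overlap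
  refine sum_powerset_eq_of_pair hq fun s hs => ?_
  set u := h \ Finset.range (q + 1) with hu
  have hqu : q ∉ u := by simp [hu]
  have hsu : q ∉ symmDiff s u := by simp [Finset.mem_symmDiff, hs, hqu]
  have cc := Complex.conj_ofReal (1 / Real.sqrt 2)
  have c2 := sqrt_two_inv_sq
  rw [insert_symmDiff_of_notMem hs hqu]
  simp only [Gate.apply_h, hs, hsu, Finset.mem_insert_self, if_true, if_false,
    Finset.erase_insert hs, Finset.erase_insert hsu, Finset.erase_eq_of_notMem hs,
    Finset.erase_eq_of_notMem hsu, Finset.insert_idem, chi_succ, chi_insert, map_mul, map_add, cc,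
    map_neg, false_and, true_and, mul_one, one_mul, neg_mul]
  generalize ((1 / Real.sqrt 2 : ℝ) : ℂ) = c at *
  by_cases hqh : q ∈ h
  · have e : h \ Finset.range q = insert q u := by
      ext j
      simp only [hu, Finset.mem_sdiff, Finset.mem_range, Finset.mem_insert, not_lt]
      constructor
      · rintro ⟨h1, h2⟩
        by_cases hj : j = q
        · exact Or.inl hj
        · exact Or.inr ⟨h1, by omega⟩
      · rintro (rfl | ⟨h1, h2⟩)
        · exact ⟨hqh, le_rfl⟩
        · exact ⟨h1, by omega⟩
    have e1 : symmDiff s (insert q u) = insert q (symmDiff s u) := by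
      rw [symmDiff_comm, insert_symmDiff_of_notMem hqu hs, symmDiff_comm]
    have e2 : symmDiff (insert q s) (insert q u) = symmDiff s u := by
      ext j
      by_cases hj : j = q
      · subst hj; simp [Finset.mem_symmDiff, hs, hqu]
      · simp [Finset.mem_symmDiff, hj]
    rw [e, e1, e2]
    simp only [hqh, if_true]
    push_cast
    linear_combination (chi q s h : ℂ) * (2 * ψ s * starRingEnd ℂ (ψ (insert q (symmDiff s u))) +
      2 * ψ (insert q s) * starRingEnd ℂ (ψ (symmDiff s u))) * c2
  · have e : h \ Finset.range q = u := by
      ext j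
      simp only [hu, Finset.mem_sdiff, Finset.mem_range, not_lt]
      refine and_congr_right fun h1 => ?_
      have : j ≠ q := fun h2 => hqh (h2 ▸ h1)
      omega
    rw [e, insert_symmDiff_of_notMem hs hqu]
    simp only [hqh, if_false]
    push_cast
    linear_combination (chi q s h : ℂ) * (2 * ψ s * starRingEnd ℂ (ψ (symmDiff s u)) +
      2 * ψ (insert q s) * starRingEnd ℂ (ψ (insert q (symmDiff s u)))) * c2

theorem answer_injective : Function.Injective (answer : (Fin n → Bool) → Finset ℕ) := by
  intro v w h
  funext i
  have : ∀ v : Fin n → Bool, v i = true ↔ n + i.1 ∈ answer v := by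
    intro v
    rw [mem_answer]
    refine ⟨fun h => ⟨i, h, rfl⟩, ?_⟩
    rintro ⟨j, hj, hji⟩
    have : j = i := Fin.ext (by omega)
    exact this ▸ hj
  rw [Bool.eq_iff_iff, this, this, h]

theorem answer_subset (v : Fin n → Bool) : answer v ⊆ Finset.range (n + n) := by
  intro q hq
  rw [mem_answer] at hq
  obtain ⟨i, -, rfl⟩ := hq
  have := i.2
  simp

theorem answer_disjoint (v : Fin n → Bool) {q : ℕ} (hq : q ∈ answer v) : n ≤ q := by
  rw [mem_answer] at hq
  obtain ⟨i, -, rfl⟩ := hq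
  omega

theorem support_apply_oracle {ψ : QState} (h : ψ.support ⊆ (Finset.range (n + n)).powerset) :
    ((Gate.oracle : Gate ℕ).apply F ψ).support ⊆ (Finset.range (n + n)).powerset := by
  intro s hs
  rw [Finsupp.mem_support_iff, Gate.apply_oracle, ← Finsupp.mem_support_iff] at hs
  have h1 := Finset.mem_powerset.1 (h hs)
  rw [Finset.mem_powerset, ← symmDiff_symmDiff_cancel_right (answer (F (toVec n s))) s]
  exact Finset.symmDiff_subset_union.trans (Finset.union_subset h1 (answer_subset _))

theorem support_of_uniform {q N : ℕ} (hq : q ≤ N) {ψ : QState} {b : ℂ}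
    (h : ∀ s, ψ s = if s ⊆ Finset.range q then b else 0) :
    ψ.support ⊆ (Finset.range N).powerset := by
  intro s hs
  rw [Finsupp.mem_support_iff, h] at hs
  rw [Finset.mem_powerset]
  by_contra hn
  exact hs (if_neg fun h' => hn (h'.trans (Finset.range_subset_range.2 hq)))

/-- The overlap of the state `∑ |x, F x⟩` with its translates detects the periods of `F`. -/
theorem overlap_oracle {P : Finset ℕ → Prop} [DecidablePred P]
    (hP : ∀ s t, F (toVec n s) = F (toVec n t) ↔ P (symmDiff s t)) {ψ : QState} {b : ℂ}
    (hψ : ∀ s, ψ s = if s ⊆ Finset.range n then b else 0) {h : Finset ℕ} (hh : h ⊆ Finset.range n) :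
    overlap (n + n) 0 h ((Gate.oracle : Gate ℕ).apply F ψ) =
      if P h then (QState.normSq ψ : ℂ) else 0 := by
  set χ := (Gate.oracle : Gate ℕ).apply F ψ with hχ
  have hχs : ∀ s, χ s = if symmDiff s (answer (F (toVec n s))) ⊆ Finset.range n then b else 0 := by
    intro s
    rw [hχ, Gate.apply_oracle, hψ]
  have hsub : ∀ {a b : Finset ℕ} {M}, a ⊆ Finset.range M → b ⊆ Finset.range M →
      symmDiff a b ⊆ Finset.range M :=
    fun ha hb => Finset.symmDiff_subset_union.trans (Finset.union_subset ha hb)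
  have hsupp : χ.support ⊆ (Finset.range (n + n)).powerset :=
    support_apply_oracle F (support_of_uniform (by omega) hψ)
  have hperiod : ∀ s, F (toVec n s) = F (toVec n (symmDiff s h)) ↔ P h := by
    intro s
    rw [hP, symmDiff_symmDiff_cancel_left]
  unfold overlap
  simp only [chi_zero, Complex.ofReal_one, one_mul, Finset.range_zero, Finset.sdiff_empty]
  split_ifs with hPh
  · have hn : QState.normSq ψ = QState.normSq χ := (Gate.normSq_apply F _ ψ).symm
    rw [hn, QState.normSq_eq_sum hsupp]
    push_cast
    refine Finset.sum_congr rfl fun s _ => ?_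
    have : χ (symmDiff s h) = χ s := by
      rw [hχs, hχs, ← (hperiod s).2 hPh]
      congr 1
      rw [eq_iff_iff, symmDiff_right_comm]
      refine ⟨fun h1 => ?_, fun h1 => hsub h1 hh⟩
      have := hsub h1 hh
      rwa [symmDiff_symmDiff_cancel_right] at this
    rw [this, Complex.mul_conj, Complex.normSq_eq_norm_sq]
    push_cast; rfl
  · refine Finset.sum_eq_zero fun s _ => ?_
    rw [hχs, hχs]
    split_ifs with h1 h2
    -- If both amplitudes are nonzero, the answer registers of `s` and of its translate differ only
    -- below `n`, where they have no elements. The answers then coincide, and `h` is a period.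
    · exfalso
      apply hPh
      rw [← hperiod s]
      apply answer_injective
      set A := answer (F (toVec n s))
      set B := answer (F (toVec n (symmDiff s h)))
      have h3 := hsub (hsub h1 h2) hh
      have e : symmDiff (symmDiff (symmDiff s A) (symmDiff (symmDiff s h) B)) h = symmDiff A B := by
        rw [symmDiff_symmDiff_symmDiff_comm, symmDiff_symmDiff_cancel_left, symmDiff_comm h,
          symmDiff_symmDiff_cancel_right]
      rw [e] at h3
      rw [← symmDiff_eq_bot]
      refine Finset.eq_empty_of_forall_notMem fun j hj => ?_
      have h4 := h3 hj
      rw [Finset.mem_range] at h4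
      rw [Finset.mem_symmDiff] at hj
      rcases hj with hj | hj
      · have := answer_disjoint _ hj.1; omega
      · have := answer_disjoint _ hj.1; omega
    · simp
    · simp
    · simp

end
end HKP

namespace HKP

/-! ### Fourier sampling -/

section
variable {n : ℕ} (F : (Fin n → Bool) → (Fin n → Bool))

/-- Hadamard gates on the first qubits. -/
noncomputable def hadamards : ℕ → QState → QState
  | 0, ψ => ψ
  | q + 1, ψ => (Gate.h q).apply F (hadamards q ψ)

theorem hadamards_uniform {ψ : QState} {a : ℂ} (h : ∀ s, ψ s = if s = ∅ then a else 0) (q : ℕ)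
    (s : Finset ℕ) : hadamards F q ψ s =
      if s ⊆ Finset.range q then ((1 / Real.sqrt 2 : ℝ) : ℂ) ^ q * a else 0 := by
  induction q generalizing s with
  | zero => simp [hadamards, h]
  | succ q ih => rw [hadamards, hadamard_uniform F ih, pow_succ', mul_assoc]

theorem normSq_hadamards (q : ℕ) (ψ : QState) :
    QState.normSq (hadamards F q ψ) = QState.normSq ψ := by
  induction q with
  | zero => rfl
  | succ q ih => rw [hadamards, Gate.normSq_apply, ih]

theorem support_hadamards {N q : ℕ} (hq : q ≤ N) {ψ : QState}
    (h : ψ.support ⊆ (Finset.range N).powerset) :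
    (hadamards F q ψ).support ⊆ (Finset.range N).powerset := by
  induction q with
  | zero => exact h
  | succ q ih => exact support_apply_h F hq (ih (by omega))

theorem overlap_hadamards {N q : ℕ} (hq : q ≤ N) (h : Finset ℕ) (ψ : QState) :
    overlap N q h (hadamards F q ψ) = overlap N 0 h ψ := by
  induction q with
  | zero => rfl
  | succ q ih => rw [hadamards, overlap_h F hq, ih (by omega)]

/-- The state that is measured in Simon's algorithm. -/
noncomputable def sampleState (ψ : QState) : QState :=
  hadamards F n ((Gate.oracle : Gate ℕ).apply F (hadamards F n ψ))

theorem support_sampleState {ψ : QState} (h : ∀ s, s ≠ ∅ → ψ s = 0) :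
    (sampleState F ψ).support ⊆ (Finset.range (n + n)).powerset := by
  refine support_hadamards F (by omega) (support_apply_oracle F (support_hadamards F (by omega) ?_))
  intro s hs
  have : s = ∅ := by
    by_contra hn
    exact Finsupp.mem_support_iff.1 hs (h s hn)
  simp [this]

/-- The Fourier coefficients of the distribution of the samples. -/
theorem sum_chi_sampleState {P : Finset ℕ → Prop} [DecidablePred P]
    (hP : ∀ s t, F (toVec n s) = F (toVec n t) ↔ P (symmDiff s t)) {ψ : QState}
    (hψ : ∀ s, s ≠ ∅ → ψ s = 0) {h : Finset ℕ} (hh : h ⊆ Finset.range n) :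
    ∑ s ∈ (Finset.range (n + n)).powerset, chi n h s * ‖sampleState F ψ s‖ ^ 2 =
      if P h then QState.normSq ψ else 0 := by
  have h0 : ∀ s, ψ s = if s = ∅ then ψ ∅ else 0 := by
    intro s
    split_ifs with hs
    · rw [hs]
    · exact hψ s hs
  have h1 := overlap_oracle F hP (hadamards_uniform F h0 n) hh
  rw [← overlap_hadamards F (q := n) (by omega), normSq_hadamards] at h1
  change overlap (n + n) n h (sampleState F ψ) = _ at h1
  have h2 : overlap (n + n) n h (sampleState F ψ) =
      ((∑ s ∈ (Finset.range (n + n)).powerset, chi n h s * ‖sampleState F ψ s‖ ^ 2 : ℝ) : ℂ) := by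
    unfold overlap
    -- All of `h` lies below `n`, so after the last Hadamard gate no translation remains and the
    -- overlap is a character sum over squared amplitudes.
    rw [Finset.sdiff_eq_empty_iff_subset.2 hh]
    push_cast
    refine Finset.sum_congr rfl fun s _ => ?_
    rw [← Finset.bot_eq_empty, symmDiff_bot, Complex.mul_conj, Complex.normSq_eq_norm_sq, chi_comm]
    push_cast; rfl
  rw [h2] at h1
  split_ifs at h1 ⊢ <;> exact_mod_cast h1

end

/-- The data agree, except possibly for the quantum register and the arrays in `S`. -/
structure Data.MemFrame (S : Finset ℕ) (d₀ d : Data) : Prop where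
  mem : ∀ a, a ∉ S → d.mem a = d₀.mem a
  weight : d.weight = d₀.weight
  out : d.out = d₀.out

theorem Data.MemFrame.refl (S : Finset ℕ) (d : Data) : Data.MemFrame S d d :=
  ⟨fun _ _ => rfl, rfl, rfl⟩

theorem Data.MemFrame.write {S : Finset ℕ} {d₀ d : Data} (h : Data.MemFrame S d₀ d) {c : ℕ}
    (hc : c ∈ S) (i j v : ℕ) (ψ : QState) :
    Data.MemFrame S d₀ { d with mem := d.mem.write c i j v, ψ := ψ } :=
  ⟨fun a ha => by
    rw [← h.mem a ha]
    exact Memory.write_ne _ (show a ≠ c from fun h => ha (h ▸ hc)) _ _ _, h.weight, h.out⟩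

theorem Data.MemFrame.trans {S S' : Finset ℕ} {d₀ d d' : Data} (h : Data.MemFrame S d₀ d)
    (h' : Data.MemFrame S' d d') (hS : S' ⊆ S) : Data.MemFrame S d₀ d' :=
  ⟨fun a ha => (h'.mem a fun h => ha (hS h)).trans (h.mem a ha), h'.weight.trans h.weight,
    h'.out.trans h.out⟩

/-- Apply Hadamard gates to the query register. -/
def hadamardLoop : Program := forLoop 20 .size (.instr (.gate (.h (.var 20))))

/-- Measure all qubits, store the outcomes in row `0` of array `5` and reset the qubits. -/
def measureLoop : Program :=
  forLoop 20 (.add .size .size) (.seq (.instr (.measure (.var 20) 5 (.const 0) (.var 20)))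
    (.ite (.get 5 (.const 0) (.var 20)) (.instr (.gate (.x (.var 20))))
      (.instr (.assign 21 (.const 0) (.const 0) (.const 0)))))

/-- One round of Fourier sampling. -/
def sampleProgram : Program :=
  .seq hadamardLoop (.seq (.instr (.gate .oracle)) (.seq hadamardLoop measureLoop))

section
variable {n : ℕ} {F : (Fin n → Bool) → (Fin n → Bool)}

theorem det_hadamardLoop (d : Data) : Det F (n * 4 + 3) hadamardLoop d fun d' =>
    Data.MemFrame {20} d d' ∧ d'.ψ = hadamards F n d.ψ := by
  refine Det.forLoop (T := 1) (N₀ := n) (Inv := fun i d' =>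
    Data.MemFrame {20} d d' ∧ d'.ψ = hadamards F i d.ψ) (fun m => rfl)
    (fun i d' v h => ⟨h.1.write (by simp) _ _ _ _, h.2⟩) ?_ ⟨.refl _ _, rfl⟩
  rintro i hi d' ⟨h1, h2⟩ hc v
  refine (Tri.instr (V := fun _ => v) (P := fun d'' =>
    (Data.MemFrame {20} d d'' ∧ d''.ψ = hadamards F (i + 1) d.ψ) ∧ d''.mem 20 0 0 = i) ?_).conseq
    le_rfl (fun _ h => ⟨h, le_rfl⟩) (by simp [Instr.exec])
  intro d'' hd''
  simp only [Instr.exec, List.mem_singleton] at hd''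
  subst hd''
  exact ⟨⟨⟨h1.mem, h1.weight, h1.out⟩, by simp [Gate.map, Expr.eval, hc, h2, hadamards]⟩, hc⟩

/-- The nonzero entries of row `0` of array `5`, up to a bound. -/
def Data.sample (N : ℕ) (d : Data) : Finset ℕ := (Finset.range N).filter fun j => d.mem 5 0 j ≠ 0

/-- The expected value of `g` if the remaining qubits are measured. -/
noncomputable def Data.expect (N : ℕ) (g : Finset ℕ → ℝ) (i : ℕ) (d : Data) : ℝ :=
  d.weight * ∑ s ∈ (Finset.range N).powerset, ‖d.ψ s‖ ^ 2 * g (d.sample i ∪ s)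

theorem Data.expect_congr {N : ℕ} {g : Finset ℕ → ℝ} {i : ℕ} {d d' : Data}
    (hw : d'.weight = d.weight) (hψ : d'.ψ = d.ψ) (hm : d'.mem 5 = d.mem 5) :
    d'.expect N g i = d.expect N g i := by
  rw [Data.expect, Data.expect, hw, hψ, Data.sample, Data.sample, hm]

/-- The value function is the expectation over the qubits not yet measured. Measuring qubit `i`
splits the sum according to `i ∈ s`, and resetting the qubit moves `i` from the state to the
recorded sample. At the end only the zero basis state is left, ready for another round. -/
theorem tri_measureLoop (g : Finset ℕ → ℝ) {d : Data}
    (hd : d.ψ.support ⊆ (Finset.range (n + n)).powerset) :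
    Tri F ((n + n) * 7 + 3) measureLoop d
      (fun d' => Data.MemFrame {5, 20, 21} d d' ∧ ∀ s, s ≠ ∅ → d'.ψ s = 0)
      (fun d' => d'.prob * g (d'.sample (n + n)))
      (d.weight * ∑ s ∈ (Finset.range (n + n)).powerset, ‖d.ψ s‖ ^ 2 * g s) := by
  set N := n + n with hN
  let Inv : ℕ → Data → Prop := fun i d' => Data.MemFrame {5, 20, 21} d d' ∧
    ∀ s, d'.ψ s ≠ 0 → s ⊆ Finset.range N ∧ ∀ j ∈ s, i ≤ j
  refine (Tri.forLoop (T := 4) (N₀ := N) (Inv := Inv) (V := fun i d' => d'.expect N g i)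
    (fun m => rfl) (fun i d' v h => ⟨⟨h.1.write (by simp) _ _ _ _, h.2⟩, ?_⟩) ?_ ?_).conseq le_rfl
    ?_ ?_
  · exact (Data.expect_congr (d' := d'.set 20 v) (d := d') rfl rfl
      (Data.set_mem_ne _ (by decide) v)).ge
  · rintro i hi d' ⟨h1, h2⟩ hc
    let flip : Data → Data := fun d' => { d' with ψ := (Gate.x i).apply F d'.ψ }
    -- Between measurement and reset, the value is computed as if the reset had taken place.
    let V₁ : Data → ℝ := fun d' =>
      if d'.mem 5 0 i ≠ 0 then (flip d').expect N g (i + 1) else d'.expect N g (i + 1)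
    let P₁ : Data → Prop := fun d' => Data.MemFrame {5, 20, 21} d d' ∧ d'.mem 20 0 0 = i ∧
      ∀ s, d'.ψ s ≠ 0 → (s ⊆ Finset.range N ∧ ∀ j ∈ s, i ≤ j) ∧ (i ∈ s ↔ d'.mem 5 0 i ≠ 0)
    refine (Tri.seq (P₁ := P₁) (V₁ := V₁) (T₁ := 1) (T₂ := 2) (Tri.instr ?_) ?_).conseq (by omega)
      (fun _ h => ⟨h, le_rfl⟩) ?_
    · intro d'' hd''
      simp only [Instr.exec, Expr.eval, hc, List.mem_cons, List.not_mem_nil, or_false] at hd''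
      rcases hd'' with rfl | rfl
      · refine ⟨h1.write (by simp) _ _ _ _, ?_, fun s hs => ?_⟩
        · dsimp only; rw [Memory.write_ne _ (by decide), hc]
        · dsimp only at hs ⊢
          by_cases h3 : i ∈ s
          · simp [h3] at hs
          · refine ⟨h2 s ?_, by simp [Memory.write_eq, h3]⟩
            simpa [Finsupp.filter_apply, h3] using hs
      · refine ⟨h1.write (by simp) _ _ _ _, ?_, fun s hs => ?_⟩
        · dsimp only; rw [Memory.write_ne _ (by decide), hc]
        · dsimp only at hs ⊢
          by_cases h3 : i ∈ s
          · refine ⟨h2 s ?_, by simp [Memory.write_eq, h3]⟩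
            simpa [Finsupp.filter_apply, h3] using hs
          · simp [h3] at hs
    · rintro d₁ ⟨h3, h4, h5⟩
      refine Tri.ite (T := 1) (fun he => ?_) fun he => ?_
      · simp only [Expr.eval, h4] at he
        refine (Tri.instr (V := fun d' => d'.expect N g (i + 1)) ?_).conseq le_rfl
          (fun _ h => ⟨h, le_rfl⟩) ?_
        · intro d₂ hd₂
          simp only [Instr.exec, List.mem_singleton, Gate.map, Expr.eval, h4] at hd₂
          subst hd₂
          refine ⟨⟨⟨h3.mem, h3.weight, h3.out⟩, fun s hs => ?_⟩, h4⟩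
          dsimp only at hs
          rw [Gate.apply_x] at hs
          obtain ⟨⟨h6, h7⟩, h8⟩ := h5 _ hs
          have h9 : i ∉ s := by
            have := h8.2 he
            simpa [Finset.mem_symmDiff] using this
          rw [symmDiff_singleton_of_notMem h9] at h6 h7
          refine ⟨(Finset.subset_insert _ _).trans h6, fun j hj => ?_⟩
          have h10 := h7 j (Finset.mem_insert_of_mem hj)
          have h11 : j ≠ i := fun h => h9 (h ▸ hj)
          omega
        · simp only [V₁, if_pos he, Instr.exec, Gate.map, Expr.eval, h4, flip, List.map_cons,
            List.map_nil, List.sum_singleton]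
          exact le_rfl
      · simp only [Expr.eval, h4] at he
        refine (Tri.assign (V := fun d' => d'.expect N g (i + 1)) ?_).conseq le_rfl
          (fun _ h => ⟨h, le_rfl⟩) ?_
        · refine ⟨⟨h3.write (by simp) _ _ _ _, fun s hs => ?_⟩, ?_⟩
          · dsimp only at hs
            obtain ⟨⟨h6, h7⟩, h8⟩ := h5 _ hs
            refine ⟨h6, fun j hj => ?_⟩
            have h10 := h7 j hj
            have h11 : j ≠ i := fun h => h8.1 (h ▸ hj) he
            omega
          · dsimp only; rw [Memory.write_ne _ (by decide), h4]
        · have : ¬ d₁.mem 5 0 i ≠ 0 := by simpa using he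
          simp only [V₁, if_neg this]
          refine le_of_eq (Data.expect_congr rfl rfl ?_).symm
          exact Memory.write_ne d₁.mem (show 5 ≠ 21 by decide) 0 0 0
    · simp only [Instr.exec, Expr.eval, hc, List.map_cons, List.map_nil, List.sum_cons,
        List.sum_nil, add_zero, V₁, Memory.write_eq, and_self, if_true, ne_eq, not_true_eq_false,
        if_false, one_ne_zero, not_false_eq_true, flip]
      refine le_of_eq ?_
      simp only [Data.expect, ← mul_add, ← Finset.sum_add_distrib]
      congr 1
      refine sum_powerset_eq_of_pair hi fun s hs => ?_
      have e0 : (⟨d'.mem.write 5 0 i 0, d'.out, d'.weight,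
          d'.ψ.filter fun s => i ∉ s⟩ : Data).sample (i + 1) = d'.sample i := by
        ext j
        simp only [Data.sample, Finset.mem_filter, Finset.mem_range, Memory.write_eq, true_and]
        by_cases hj : j = i
        · simp [hj]
        · have : j < i + 1 ↔ j < i := by omega
          simp [hj, this]
      have e1 : (⟨d'.mem.write 5 0 i 1, d'.out, d'.weight, (Gate.x i).apply F
          (d'.ψ.filter fun s => i ∈ s)⟩ : Data).sample (i + 1) = insert i (d'.sample i) := by
        ext j
        simp only [Data.sample, Finset.mem_filter, Finset.mem_range, Memory.write_eq, true_and,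
          Finset.mem_insert]
        by_cases hj : j = i
        · simp [hj]
        · have : j < i + 1 ↔ j < i := by omega
          simp [hj, this]
      rw [e0, e1]
      simp only [Gate.apply_x, symmDiff_singleton_of_notMem hs,
        symmDiff_singleton_of_mem (Finset.mem_insert_self i s), Finset.erase_insert hs,
        Finsupp.filter_apply, Finset.mem_insert_self, hs, not_true_eq_false, not_false_eq_true,
        if_true, if_false, norm_zero]
      rw [Finset.insert_union, Finset.union_insert]
      ring
  · refine ⟨.refl _ _, fun s hs => ⟨?_, by simp⟩⟩
    exact Finset.mem_powerset.1 (hd (Finsupp.mem_support_iff.2 hs))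
  · rintro d' ⟨h1, h2⟩
    have h3 : ∀ s, s ≠ ∅ → d'.ψ s = 0 := by
      intro s hs
      by_contra hn
      obtain ⟨h4, h5⟩ := h2 s hn
      obtain ⟨j, hj⟩ := Finset.nonempty_iff_ne_empty.2 hs
      have h6 := Finset.mem_range.1 (h4 hj)
      have h7 := h5 j hj
      omega
    refine ⟨⟨h1, h3⟩, le_of_eq ?_⟩
    have h4 : d'.ψ.support ⊆ (Finset.range N).powerset := fun s hs =>
      Finset.mem_powerset.2 (h2 s (Finsupp.mem_support_iff.1 hs)).1
    rw [Data.expect, Data.prob, QState.normSq_eq_sum h4, mul_assoc, Finset.sum_mul]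
    congr 1
    refine Finset.sum_congr rfl fun s _ => ?_
    by_cases hs : s = ∅
    · rw [hs, Finset.union_empty]
    · simp [h3 s hs]
  · simp [Data.expect, Data.sample]

theorem tri_sampleProgram (g : Finset ℕ → ℝ) {d : Data} (hd : ∀ s, s ≠ ∅ → d.ψ s = 0) :
    Tri F (n * 22 + 13) sampleProgram d
      (fun d' => Data.MemFrame {5, 20, 21} d d' ∧ ∀ s, s ≠ ∅ → d'.ψ s = 0)
      (fun d' => d'.prob * g (d'.sample (n + n)))
      (d.weight * ∑ s ∈ (Finset.range (n + n)).powerset, ‖sampleState F d.ψ s‖ ^ 2 * g s) := by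
  set v := d.weight * ∑ s ∈ (Finset.range (n + n)).powerset, ‖sampleState F d.ψ s‖ ^ 2 * g s with hv
  refine (Tri.seq (det_hadamardLoop d v) (T₂ := n * 18 + 9) ?_).conseq (by omega)
    (fun _ h => ⟨h, le_rfl⟩) le_rfl
  rintro d₁ ⟨h1, h2⟩
  refine Tri.gate_seq (T := n * 18 + 7) ?_
  refine (Tri.seq (det_hadamardLoop _ v) (T₂ := (n + n) * 7 + 3) ?_).conseq (by omega)
    (fun _ h => ⟨h, le_rfl⟩) le_rfl
  rintro d₂ ⟨h3, h4⟩
  have h5 : d₂.ψ = sampleState F d.ψ := by rw [h4, sampleState, Gate.map, h2]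
  have h6 : Data.MemFrame {5, 20, 21} d d₂ :=
    ⟨fun a ha => (h3.mem a (by simp at ha ⊢; tauto)).trans (h1.mem a (by simp at ha ⊢; tauto)),
      h3.weight.trans h1.weight, h3.out.trans h1.out⟩
  refine (tri_measureLoop g (by rw [h5]; exact support_sampleState F hd)).conseq le_rfl
    (fun d₃ h => ⟨⟨h6.trans h.1 subset_rfl, h.2⟩, le_rfl⟩) ?_
  rw [hv, h5, h6.weight]

end
end HKP

namespace HKP

/-! ### Intersecting a span with the annihilator of a sample -/

/-- The data agree, except possibly for the arrays in `S`. -/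
structure Data.Same (S : Finset ℕ) (d₀ d : Data) : Prop extends Data.Frame S d₀ d where
  out : d.out = d₀.out

theorem Data.Same.refl (S : Finset ℕ) (d : Data) : Data.Same S d d := ⟨.refl S d, rfl⟩

theorem Data.Same.write {S : Finset ℕ} {d₀ d : Data} (h : Data.Same S d₀ d) {c : ℕ} (hc : c ∈ S)
    (i j v : ℕ) : Data.Same S d₀ { d with mem := d.mem.write c i j v } :=
  ⟨h.toFrame.write hc i j v, h.out⟩

theorem Data.Same.set {S : Finset ℕ} {d₀ d : Data} (h : Data.Same S d₀ d) {c : ℕ} (hc : c ∈ S)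
    (v : ℕ) : Data.Same S d₀ (d.set c v) := h.write hc 0 0 v

theorem Data.Same.trans {S S' : Finset ℕ} {d₀ d d' : Data} (h : Data.Same S d₀ d)
    (h' : Data.Same S' d d') (hS : S' ⊆ S) : Data.Same S d₀ d' :=
  ⟨h.toFrame.trans h'.toFrame hS, h'.out.trans h.out⟩

/-- The matrix `A` has the characteristic vectors of the sets `g k` as rows. -/
def IsRows (n : ℕ) (A : ℕ → ℕ → ℕ) (g : ℕ → Finset ℕ) : Prop :=
  ∀ k < n, ∀ j < n, A k j = if j ∈ g k then 1 else 0

theorem IsRows.congr {n : ℕ} {A : ℕ → ℕ → ℕ} {g g' : ℕ → Finset ℕ} (h : IsRows n A g)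
    (hg : ∀ k < n, g k = g' k) : IsRows n A g' := fun k hk j hj => by rw [h k hk j hj, hg k hk]

/-- An idle instruction: array `21` is never read. -/
def skip : Program := .instr (.assign 21 (.const 0) (.const 0) (.const 0))

/-- Store the parity of the intersection of the current row with the sample in the variable `8`. -/
def parityLoop : Program :=
  forLoop 11 .size (.ite (.get 4 (.var 12) (.var 11)) (.ite (.get 5 (.const 0) (.var 11))
    (.instr (.assign 8 (.const 0) (.const 0) (.sub (.const 1) (.var 8)))) skip) skip)

/-- Copy the current row to row `0` of array `7`. -/
def copyLoop : Program :=
  forLoop 11 .size (.instr (.assign 7 (.const 0) (.var 11) (.get 4 (.var 12) (.var 11))))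

/-- Add row `0` of array `7` to the current row. -/
def addLoop : Program :=
  forLoop 11 .size (.instr (.assign 4 (.var 12) (.var 11)
    (.add (.sub (.get 4 (.var 12) (.var 11)) (.get 7 (.const 0) (.var 11)))
      (.sub (.get 7 (.const 0) (.var 11)) (.get 4 (.var 12) (.var 11))))))

/-- Choose the current row as the pivot, unless a pivot has been chosen before. -/
def choosePivot : Program :=
  .ite (.var 6) skip (.seq (.instr (.assign 6 (.const 0) (.const 0) (.const 1))) copyLoop)

def updateRow : Program :=
  .seq (.instr (.assign 8 (.const 0) (.const 0) (.const 0))) (.seq parityLoop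
    (.ite (.var 8) (.seq choosePivot addLoop) skip))

/-- Replace the rows of array `4` by generators of the annihilator of the sample in their span. -/
def updateProgram : Program :=
  .seq (.instr (.assign 6 (.const 0) (.const 0) (.const 0))) (forLoop 12 .size updateRow)

section
variable {n : ℕ} {F : (Fin n → Bool) → (Fin n → Bool)}

theorem det_skip {d : Data} {T : ℕ} (hT : 1 ≤ T) : Det F T skip d (Data.Same {21} d) := fun v =>
  (Tri.assign (V := fun _ => v) ((Data.Same.refl _ d).write (by simp) _ _ _)).conseq hT
    (fun _ h => ⟨h, le_rfl⟩) le_rfl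

theorem det_parityLoop {d : Data} {g : ℕ → Finset ℕ} {y : Finset ℕ} {k : ℕ}
    (hr : IsRows n (d.mem 4) g) (hy : ∀ j < n, d.mem 5 0 j ≠ 0 ↔ j ∈ y) (hk : d.mem 12 0 0 = k)
    (hkn : k < n) (h8 : d.mem 8 0 0 = 0) :
    Det F (n * 6 + 3) parityLoop d fun d' => Data.Same {8, 11, 21} d d' ∧
      d'.mem 8 0 0 = if chi n (g k) y = -1 then 1 else 0 := by
  refine Det.forLoop (T := 3) (N₀ := n) (Inv := fun i d' => Data.Same {8, 11, 21} d d' ∧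
      d'.mem 8 0 0 = if chi i (g k) y = -1 then 1 else 0) (fun m => rfl)
      (fun i d' v h => ⟨h.1.set (by simp) v, ?_⟩) ?_ ⟨.refl _ _, ?_⟩
  · rw [Data.set_mem_ne _ (by decide)]; exact h.2
  · rintro j hj d₁ ⟨h1, h2⟩ hc v
    have e4 : d₁.mem 4 = d.mem 4 := h1.mem 4 (by simp)
    have e5 : d₁.mem 5 = d.mem 5 := h1.mem 5 (by simp)
    have e12 : d₁.mem 12 = d.mem 12 := h1.mem 12 (by simp)
    have hrow := hr k hkn j hj
    have skipped : ¬ (j ∈ g k ∧ j ∈ y) → ∀ T, 1 ≤ T → Tri F T skip d₁ (fun d' =>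
        (Data.Same {8, 11, 21} d d' ∧ d'.mem 8 0 0 = if chi (j + 1) (g k) y = -1 then 1 else 0) ∧
          d'.mem 11 0 0 = j) (fun _ => v) v := by
      intro hn T hT
      refine (det_skip hT v).conseq le_rfl (fun d' h => ⟨⟨⟨h1.trans h (by simp), ?_⟩, ?_⟩, le_rfl⟩)
        le_rfl
      · rw [h.mem 8 (by simp), h2, chi_succ, if_neg hn, mul_one]
      · rw [h.mem 11 (by simp), hc]
    refine Tri.ite (T := 2) (fun he => Tri.ite (T := 1) (fun he' => ?_) fun he' => ?_) fun he => ?_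
    · simp only [Expr.eval, e4, e5, e12, hk, hc, hrow] at he he'
      have hjg : j ∈ g k := by by_contra hn; simp [hn] at he
      have hjy := (hy j hj).1 he'
      refine Tri.assign (V := fun _ => v) ⟨⟨h1.write (by simp) _ _ _, ?_⟩, ?_⟩
      · simp only [Expr.eval, Memory.write_eq, and_self, if_true, h2, chi_succ, if_pos (And.intro hjg hjy)]
        rcases chi_eq_one_or j (g k) y with h | h <;> rw [h] <;> norm_num
      · dsimp only
        rw [Memory.write_ne _ (by decide), hc]
    · simp only [Expr.eval, e5, hc] at he'
      exact skipped (fun h => (hy j hj).2 h.2 he') 1 le_rfl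
    · simp only [Expr.eval, e4, e12, hk, hc, hrow] at he
      exact skipped (fun h => by simp [h.1] at he) 2 (by omega)
  · rw [h8, chi_zero]; norm_num

theorem det_copyLoop {d : Data} {k : ℕ} (hk : d.mem 12 0 0 = k) :
    Det F (n * 4 + 3) copyLoop d fun d' => Data.Same {7, 11} d d' ∧
      ∀ j < n, d'.mem 7 0 j = d.mem 4 k j := by
  refine Det.forLoop (T := 1) (N₀ := n) (Inv := fun i d' => Data.Same {7, 11} d d' ∧
      ∀ j < i, d'.mem 7 0 j = d.mem 4 k j) (fun m => rfl)
      (fun i d' v h => ⟨h.1.set (by simp) v, ?_⟩) ?_ ⟨.refl _ _, by simp⟩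
  · rw [Data.set_mem_ne _ (by decide)]; exact h.2
  · rintro i hi d₁ ⟨h1, h2⟩ hc v
    have e4 : d₁.mem 4 = d.mem 4 := h1.mem 4 (by simp)
    have e12 : d₁.mem 12 = d.mem 12 := h1.mem 12 (by simp)
    refine Tri.assign (V := fun _ => v) ⟨⟨h1.write (by simp) _ _ _, fun j hj => ?_⟩, ?_⟩
    · simp only [Expr.eval, Memory.write_eq, hc, e4, e12, hk, true_and]
      split_ifs with h
      · rw [h]
      · exact h2 j (by omega)
    · dsimp only
      rw [Memory.write_ne _ (by decide), hc]

/-- For entries 0 and 1 the sum of the two truncated differences is their sum modulo 2. -/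
theorem det_addLoop {d : Data} {g : ℕ → Finset ℕ} {w : Finset ℕ} {k : ℕ}
    (hr : IsRows n (d.mem 4) g) (hw : ∀ j < n, d.mem 7 0 j = if j ∈ w then 1 else 0)
    (hk : d.mem 12 0 0 = k) :
    Det F (n * 4 + 3) addLoop d fun d' => Data.Same {4, 11} d d' ∧
      IsRows n (d'.mem 4) fun l => if l = k then symmDiff (g l) w else g l := by
  refine (Det.forLoop (T := 1) (N₀ := n) (Inv := fun i d' => Data.Same {4, 11} d d' ∧
      ∀ l < n, ∀ j < n, d'.mem 4 l j = if l = k ∧ j < i then (if j ∈ symmDiff (g l) w then 1 else 0)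
        else if j ∈ g l then 1 else 0) (fun m => rfl)
      (fun i d' v h => ⟨h.1.set (by simp) v, ?_⟩) ?_ ⟨.refl _ _, ?_⟩).conseq le_rfl ?_
  · rw [Data.set_mem_ne _ (by decide)]; exact h.2
  · rintro i hi d₁ ⟨h1, h2⟩ hc v
    have e7 : d₁.mem 7 = d.mem 7 := h1.mem 7 (by simp)
    have e12 : d₁.mem 12 = d.mem 12 := h1.mem 12 (by simp)
    refine Tri.assign (V := fun _ => v) ⟨⟨h1.write (by simp) _ _ _, fun l hl j hj => ?_⟩, ?_⟩
    · simp only [Expr.eval, Memory.write_eq, hc, e7, e12, hk]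
      by_cases h : l = k ∧ j = i
      · obtain ⟨rfl, rfl⟩ := h
        rw [if_pos ⟨rfl, rfl⟩, if_pos ⟨rfl, by omega⟩, h2 l hl j hj, hw j hj,
          if_neg (by omega)]
        by_cases h3 : j ∈ g l <;> by_cases h4 : j ∈ w <;> simp [Finset.mem_symmDiff, h3, h4]
      · rw [if_neg h, h2 l hl j hj]
        have : (l = k ∧ j < i) ↔ (l = k ∧ j < i + 1) := by
          constructor
          · rintro ⟨h3, h4⟩; exact ⟨h3, by omega⟩
          · rintro ⟨h3, h4⟩
            have : j ≠ i := fun h5 => h ⟨h3, h5⟩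
            exact ⟨h3, by omega⟩
        simp only [this]
    · dsimp only
      rw [Memory.write_ne _ (by decide), hc]
  · intro l hl j hj
    rw [if_neg (by omega), hr l hl j hj]
  · rintro d' ⟨h1, h2⟩
    refine ⟨h1, fun l hl j hj => ?_⟩
    rw [h2 l hl j hj]
    by_cases h : l = k <;> simp [h, hj]

/-- The rows after the first `i` rows have been treated. -/
noncomputable def pivotRows (n : ℕ) (g : ℕ → Finset ℕ) (y w : Finset ℕ) (i k : ℕ) : Finset ℕ :=
  if k < i ∧ chi n (g k) y = -1 then symmDiff (g k) w else g k

/-- The pivot `w` has been chosen, and the first `i` rows have been treated. -/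
structure Pivot (n : ℕ) (g : ℕ → Finset ℕ) (y : Finset ℕ) (i : ℕ) (w : Finset ℕ) (d : Data) :
    Prop where
  flag : d.mem 6 0 0 ≠ 0
  mem : ∃ k < n, w = g k
  chi : chi n w y = -1
  saved : ∀ j < n, d.mem 7 0 j = if j ∈ w then 1 else 0
  rows : IsRows n (d.mem 4) (pivotRows n g y w i)

/-- No pivot has been found among the first `i` rows. -/
structure NoPivot (n : ℕ) (g : ℕ → Finset ℕ) (y : Finset ℕ) (i : ℕ) (d : Data) : Prop where
  flag : d.mem 6 0 0 = 0
  chi : ∀ k < i, chi n (g k) y ≠ -1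
  rows : IsRows n (d.mem 4) g

theorem Pivot.same {g : ℕ → Finset ℕ} {y w : Finset ℕ} {i : ℕ} {d d' : Data}
    (h : Pivot n g y i w d) {S : Finset ℕ} (h' : Data.Same S d d') (h4 : 4 ∉ S) (h6 : 6 ∉ S)
    (h7 : 7 ∉ S) : Pivot n g y i w d' :=
  ⟨by rw [h'.mem 6 h6]; exact h.flag, h.mem, h.chi, by rw [h'.mem 7 h7]; exact h.saved,
    by rw [h'.mem 4 h4]; exact h.rows⟩

theorem NoPivot.same {g : ℕ → Finset ℕ} {y : Finset ℕ} {i : ℕ} {d d' : Data}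
    (h : NoPivot n g y i d) {S : Finset ℕ} (h' : Data.Same S d d') (h4 : 4 ∉ S) (h6 : 6 ∉ S) :
    NoPivot n g y i d' :=
  ⟨by rw [h'.mem 6 h6]; exact h.flag, h.chi, by rw [h'.mem 4 h4]; exact h.rows⟩

theorem pivotRows_of_le {g : ℕ → Finset ℕ} {y w : Finset ℕ} {i k : ℕ} (h : i ≤ k) :
    pivotRows n g y w i k = g k := if_neg (by omega)

theorem pivotRows_succ_of_ne {g : ℕ → Finset ℕ} {y w : Finset ℕ} {i : ℕ}
    (h : chi n (g i) y ≠ -1) : pivotRows n g y w (i + 1) = pivotRows n g y w i := by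
  funext k
  unfold pivotRows
  by_cases hk : k = i
  · simp [hk, h]
  · have : k < i + 1 ↔ k < i := by omega
    simp only [this]

/-- Up to the first row with sign `-1` nothing has been changed, so the rows have the form
`pivotRows` for any pivot. The pivot is saved because adding it to its own row will erase it. -/
theorem det_choosePivot {g : ℕ → Finset ℕ} {y : Finset ℕ} {i : ℕ} (hi : i < n)
    (hy : chi n (g i) y = -1) {d : Data} (h : NoPivot n g y i d ∨ ∃ w, Pivot n g y i w d)
    (hc : d.mem 12 0 0 = i) :
    Det F (n * 4 + 6) choosePivot d fun d' => Data.Same {6, 7, 11, 21} d d' ∧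
      ∃ w, Pivot n g y i w d' := by
  intro v
  refine Tri.ite (T := n * 4 + 5) (fun he => ?_) fun he => ?_
  · simp only [Expr.eval] at he
    obtain ⟨w, hw⟩ := h.resolve_left fun h => he h.flag
    exact (det_skip (by omega) v).conseq le_rfl (fun d' hd => ⟨⟨(Data.Same.refl _ d).trans hd (by simp),
      w, hw.same hd (by simp) (by simp) (by simp)⟩, le_rfl⟩) le_rfl
  · simp only [Expr.eval] at he
    have hn : NoPivot n g y i d := h.resolve_right fun ⟨w, hw⟩ => hw.flag he
    refine Tri.assign_seq (T := n * 4 + 3) ?_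
    have hs : Data.Same {6, 7, 11, 21} d ⟨d.mem.write 6 0 0 1, d.out, d.weight, d.ψ⟩ :=
      (Data.Same.refl _ d).write (by simp) _ _ _
    refine (det_copyLoop (k := i) ?_ v).conseq le_rfl ?_ le_rfl
    · dsimp only
      rw [Memory.write_ne _ (by decide), hc]
    · rintro d' ⟨h1, h2⟩
      refine ⟨⟨hs.trans h1 (by decide), g i, ?_⟩, le_rfl⟩
      refine ⟨?_, ⟨i, hi, rfl⟩, hy, fun j hj => ?_, ?_⟩
      · rw [h1.mem 6 (by simp)]
        simp [Expr.eval, Memory.write_eq]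
      · rw [h2 j hj]
        dsimp only
        rw [Memory.write_ne _ (by decide), hn.rows i hi j hj]
      · rw [h1.mem 4 (by simp)]
        dsimp only
        rw [Memory.write_ne _ (by decide)]
        refine hn.rows.congr fun k _ => ?_
        rw [pivotRows, if_neg fun h => hn.chi k h.1 h.2]

theorem det_updateRow {g : ℕ → Finset ℕ} {y : Finset ℕ} {i : ℕ} (hi : i < n) {d : Data}
    (hy : ∀ j < n, d.mem 5 0 j ≠ 0 ↔ j ∈ y)
    (h : NoPivot n g y i d ∨ ∃ w, Pivot n g y i w d) (hc : d.mem 12 0 0 = i) :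
    Det F (n * 14 + 17) updateRow d fun d' => Data.Same {4, 6, 7, 8, 11, 21} d d' ∧
      (NoPivot n g y (i + 1) d' ∨ ∃ w, Pivot n g y (i + 1) w d') := by
  intro v
  refine Tri.assign_seq (T := n * 14 + 15) ?_
  have hs : Data.Same {8} d ⟨d.mem.write 8 0 0 0, d.out, d.weight, d.ψ⟩ :=
    (Data.Same.refl _ d).write (by simp) _ _ _
  simp only [Expr.eval]
  set d₀ : Data := ⟨d.mem.write 8 0 0 0, d.out, d.weight, d.ψ⟩
  -- Rows from `i` on have not been touched, so the parity computed is that of the original row.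
  obtain ⟨gc, hgc, hrow⟩ : ∃ gc : ℕ → Finset ℕ, IsRows n (d₀.mem 4) gc ∧ gc i = g i := by
    rw [hs.mem 4 (by simp)]
    rcases h with h | ⟨w, h⟩
    · exact ⟨g, h.rows, rfl⟩
    · exact ⟨_, h.rows, pivotRows_of_le le_rfl⟩
  refine (Tri.seq (det_parityLoop (k := i) hgc (by rw [hs.mem 5 (by simp)]; exact hy)
    (by rw [hs.mem 12 (by simp)]; exact hc) hi (by simp [d₀, Memory.write_eq]) v)
    (T₂ := n * 8 + 11) ?_).conseq (by omega) (fun _ h => ⟨h, le_rfl⟩) le_rfl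
  rintro d₁ ⟨h1, h2⟩
  rw [hrow] at h2
  have hs₁ : Data.Same {8, 11, 21} d d₁ :=
    ((Data.Same.refl _ d).trans hs (by simp)).trans h1 subset_rfl
  have hh : NoPivot n g y i d₁ ∨ ∃ w, Pivot n g y i w d₁ := by
    rcases h with h | ⟨w, h⟩
    · exact Or.inl (h.same hs₁ (by simp) (by simp))
    · exact Or.inr ⟨w, h.same hs₁ (by simp) (by simp) (by simp)⟩
  have hc₁ : d₁.mem 12 0 0 = i := by rw [hs₁.mem 12 (by simp), hc]
  have hs₁' : Data.Same {4, 6, 7, 8, 11, 21} d d₁ := (Data.Same.refl _ d).trans hs₁ (by decide)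
  refine Tri.ite (T := n * 8 + 10) (fun he => ?_) fun he => ?_
  · simp only [Expr.eval, h2] at he
    have hchi : chi n (g i) y = -1 := by by_contra hn; simp [hn] at he
    refine (Tri.seq (det_choosePivot hi hchi hh hc₁ v) (T₂ := n * 4 + 3) ?_).conseq (by omega)
      (fun _ h => ⟨h, le_rfl⟩) le_rfl
    rintro d₂ ⟨h3, w, hw⟩
    refine (det_addLoop hw.rows hw.saved (k := i) (by rw [h3.mem 12 (by simp), hc₁]) v).conseq le_rfl
      (fun d₃ h4 => ⟨⟨(hs₁'.trans h3 (by decide)).trans h4.1 (by decide), Or.inr ⟨w, ?_⟩⟩, le_rfl⟩)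
      le_rfl
    obtain ⟨h4, h5⟩ := h4
    refine ⟨?_, hw.mem, hw.chi, ?_, h5.congr fun k _ => ?_⟩
    · rw [h4.mem 6 (by simp)]; exact hw.flag
    · rw [h4.mem 7 (by simp)]; exact hw.saved
    · by_cases hk : k = i
      · subst hk
        rw [if_pos rfl, pivotRows_of_le le_rfl, pivotRows, if_pos ⟨by omega, hchi⟩]
      · rw [if_neg hk, pivotRows, pivotRows]
        have : k < i + 1 ↔ k < i := by omega
        simp only [this]
  · simp only [Expr.eval, h2] at he
    have hchi : chi n (g i) y ≠ -1 := by intro hn; simp [hn] at he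
    refine (det_skip (by omega) v).conseq le_rfl (fun d₂ h3 => ⟨⟨hs₁'.trans h3 (by decide), ?_⟩, le_rfl⟩)
      le_rfl
    rcases hh with h4 | ⟨w, h4⟩
    · have h5 := h4.same h3 (by simp) (by simp)
      refine Or.inl ⟨h5.flag, fun k hk => ?_, h5.rows⟩
      by_cases hki : k = i
      · rw [hki]; exact hchi
      · exact h5.chi k (by omega)
    · have h5 := h4.same h3 (by simp) (by simp) (by simp)
      exact Or.inr ⟨w, h5.flag, h5.mem, h5.chi, h5.saved, by
        rw [pivotRows_succ_of_ne hchi]; exact h5.rows⟩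

/-- Without a pivot all rows, and hence their span, already annihilate `y`; otherwise
`setSpan_pivot` applies. The number of rows stays `n`, the pivot row becoming zero. -/
theorem det_updateProgram {g : ℕ → Finset ℕ} {y : Finset ℕ} {d : Data}
    (hr : IsRows n (d.mem 4) g) (hg : ∀ k < n, g k ⊆ Finset.range n)
    (hy : ∀ j < n, d.mem 5 0 j ≠ 0 ↔ j ∈ y) :
    Det F (n * (n * 14 + 20) + 5) updateProgram d fun d' =>
      Data.Same {4, 6, 7, 8, 11, 12, 21} d d' ∧ ∃ g' : ℕ → Finset ℕ, IsRows n (d'.mem 4) g' ∧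
        (∀ k < n, g' k ⊆ Finset.range n) ∧
        ∀ x, SetSpan n g' x ↔ SetSpan n g x ∧ chi n x y = 1 := by
  intro v
  refine Tri.assign_seq (T := n * (n * 14 + 20) + 3) ?_
  have hs : Data.Same {6} d ⟨d.mem.write 6 0 0 0, d.out, d.weight, d.ψ⟩ :=
    (Data.Same.refl _ d).write (by simp) _ _ _
  simp only [Expr.eval]
  set d₀ : Data := ⟨d.mem.write 6 0 0 0, d.out, d.weight, d.ψ⟩
  refine (Det.forLoop (T := n * 14 + 17) (N₀ := n) (Inv := fun i d' =>
    Data.Same {4, 6, 7, 8, 11, 12, 21} d d' ∧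
      (NoPivot n g y i d' ∨ ∃ w, Pivot n g y i w d')) (fun m => rfl) ?_ ?_ ?_ v).conseq
    le_rfl ?_ le_rfl
  · rintro i d' u ⟨h1, h2⟩
    have h3 : Data.Same {12} d' (d'.set 12 u) := (Data.Same.refl _ d').set (by simp) u
    refine ⟨h1.trans h3 (by decide), ?_⟩
    rcases h2 with h2 | ⟨w, h2⟩
    · exact Or.inl (h2.same h3 (by simp) (by simp))
    · exact Or.inr ⟨w, h2.same h3 (by simp) (by simp) (by simp)⟩
  · rintro i hi d' ⟨h1, h2⟩ hc
    refine (det_updateRow hi (by rw [h1.mem 5 (by simp)]; exact hy) h2 hc).conseq le_rfl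
      fun d'' h => ⟨⟨h1.trans h.1 (by decide), h.2⟩, by rw [h.1.mem 12 (by simp), hc]⟩
  · refine ⟨(Data.Same.refl _ d).trans hs (by decide), Or.inl ⟨?_, by simp, ?_⟩⟩
    · simp [d₀, Memory.write_eq]
    · rw [hs.mem 4 (by simp)]; exact hr
  · rintro d' ⟨h1, h2⟩
    refine ⟨⟨h1, ?_⟩, le_rfl⟩
    rcases h2 with h2 | ⟨w, h2⟩
    · refine ⟨g, h2.rows, hg, fun x => ⟨fun hx => ⟨hx, hx.chi_eq_one fun k hk => ?_⟩, fun hx => hx.1⟩⟩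
      exact (chi_eq_one_or n (g k) y).resolve_right (h2.chi k hk)
    · have e : ∀ k < n, pivotRows n g y w n k =
          if chi n (g k) y = -1 then symmDiff (g k) w else g k := by
        intro k hk
        simp only [pivotRows, hk, true_and]
      refine ⟨_, h2.rows, fun k hk => ?_, setSpan_pivot h2.mem h2.chi e⟩
      rw [e k hk]
      split_ifs
      · obtain ⟨l, hl, rfl⟩ := h2.mem
        exact Finset.symmDiff_subset_union.trans (Finset.union_subset (hg k hk) (hg l hl))
      · exact hg k hk

end
end HKP

namespace HKP

/-! ### Simon's algorithm -/

/-- Make the rows of array `4` the unit vectors. -/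
def unitRows : Program := forLoop 12 .size (.instr (.assign 4 (.var 12) (.var 12) (.const 1)))

def simonRound : Program := .seq sampleProgram updateProgram

def simonProgram : Program :=
  .seq unitRows (.seq (forLoop 13 (.add .size (.const 2)) simonRound) emitRows)

/-- The sets whose characteristic vectors are the rows of array `4`. -/
def Data.rows (n : ℕ) (d : Data) (k : ℕ) : Finset ℕ :=
  (Finset.range n).filter fun j => d.mem 4 k j ≠ 0

theorem Data.rows_subset {n : ℕ} {d : Data} (k : ℕ) : d.rows n k ⊆ Finset.range n :=
  Finset.filter_subset _ _

theorem IsRows.rows_eq {n : ℕ} {d : Data} {g : ℕ → Finset ℕ} (h : IsRows n (d.mem 4) g)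
    (hg : ∀ k < n, g k ⊆ Finset.range n) {k : ℕ} (hk : k < n) : d.rows n k = g k := by
  ext j
  simp only [Data.rows, Finset.mem_filter, Finset.mem_range]
  constructor
  · rintro ⟨hj, h1⟩
    rw [h k hk j hj] at h1
    by_contra hn
    simp [hn] at h1
  · intro hj
    have hjn := Finset.mem_range.1 (hg k hk hj)
    exact ⟨hjn, by rw [h k hk j hjn, if_pos hj]; exact one_ne_zero⟩

theorem IsRows.isRows {n : ℕ} {d : Data} {g : ℕ → Finset ℕ} (h : IsRows n (d.mem 4) g)
    (hg : ∀ k < n, g k ⊆ Finset.range n) : IsRows n (d.mem 4) (d.rows n) :=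
  h.congr fun _ hk => (h.rows_eq hg hk).symm

theorem IsRows.setSpan_iff {n : ℕ} {d : Data} {g : ℕ → Finset ℕ} (h : IsRows n (d.mem 4) g)
    (hg : ∀ k < n, g k ⊆ Finset.range n) (x : Finset ℕ) :
    SetSpan n (d.rows n) x ↔ SetSpan n g x :=
  ⟨fun hx => hx.congr fun _ hk => h.rows_eq hg hk, fun hx => hx.congr fun _ hk => (h.rows_eq hg hk).symm⟩

open Classical in
/-- The contribution of `h` to the estimate of the failure probability after `t` of `m` rounds,
where `b` says whether `h` is in the current span and `p` whether `h` is a period. -/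
noncomputable def failCost (t m : ℕ) (p b : Prop) : ℝ :=
  if b then (if p then 0 else 2 ^ t / 2 ^ m) else if p then 1 else 0

theorem failCost_nonneg (t m : ℕ) (p b : Prop) : 0 ≤ failCost t m p b := by
  unfold failCost; split_ifs <;> positivity

/-- The estimate of the failure probability. -/
noncomputable def failBound (n t m : ℕ) (P K : Finset ℕ → Prop) : ℝ :=
  ∑ h ∈ (Finset.range n).powerset, failCost t m (P h) (K h)

theorem failBound_congr {n t m : ℕ} {P K K' : Finset ℕ → Prop} (h : ∀ x, K x ↔ K' x) :
    failBound n t m P K = failBound n t m P K' := by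
  rw [show K = K' from funext fun x => propext (h x)]

theorem failBound_zero {n m : ℕ} {P K : Finset ℕ → Prop}
    (h : ∀ x, x ⊆ Finset.range n → K x) : failBound n 0 m P K ≤ 2 ^ n / 2 ^ m := by
  have h1 : ∀ x ∈ (Finset.range n).powerset, failCost 0 m (P x) (K x) ≤ 1 / 2 ^ m := by
    intro x hx
    rw [failCost, if_pos (h x (Finset.mem_powerset.1 hx)), pow_zero]
    split_ifs
    · positivity
    · exact le_rfl
  refine (Finset.sum_le_sum h1).trans (le_of_eq ?_)
  rw [Finset.sum_const, Finset.card_powerset, Finset.card_range, nsmul_eq_mul]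
  push_cast
  ring

theorem failBound_eq_zero {n t m : ℕ} {P K : Finset ℕ → Prop}
    (h : ∀ x, x ⊆ Finset.range n → (K x ↔ P x)) : failBound n t m P K = 0 := by
  refine Finset.sum_eq_zero fun x hx => ?_
  have := h x (Finset.mem_powerset.1 hx)
  unfold failCost
  by_cases hP : P x <;> simp [this, hP]

/-- After the last round every element on which the span and the set of periods disagree costs
exactly 1. -/
theorem one_le_failBound {n m : ℕ} {P K : Finset ℕ → Prop}
    (h : ¬ ∀ x, x ⊆ Finset.range n → (K x ↔ P x)) : 1 ≤ failBound n m m P K := by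
  push Not at h
  obtain ⟨x, hx, h⟩ := h
  have h1 : failCost m m (P x) (K x) = 1 := by
    unfold failCost
    rcases h with ⟨h1, h2⟩ | ⟨h1, h2⟩
    · simp [h1, h2]
    · simp [h1, h2]
  rw [← h1]
  exact Finset.single_le_sum (f := fun x => failCost m m (P x) (K x))
    (fun x _ => failCost_nonneg _ _ _ _) (Finset.mem_powerset.2 hx)

section
variable {n : ℕ} {F : (Fin n → Bool) → (Fin n → Bool)} {P : Finset ℕ → Prop}

/-- On average, a round of sampling does not change the estimate of the failure probability. -/
theorem sum_failBound (hP : ∀ s t, F (toVec n s) = F (toVec n t) ↔ P (symmDiff s t)) {ψ : QState}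
    (hψ : ∀ s, s ≠ ∅ → ψ s = 0) (t m : ℕ) (K : Finset ℕ → Prop) :
    ∑ s ∈ (Finset.range (n + n)).powerset, ‖sampleState F ψ s‖ ^ 2 *
      (1 - failBound n (t + 1) m P fun h => K h ∧ chi n h s = 1) =
    QState.normSq ψ * (1 - failBound n t m P K) := by
  classical
  have total : ∑ s ∈ (Finset.range (n + n)).powerset, ‖sampleState F ψ s‖ ^ 2 =
      QState.normSq ψ := by
    have h1 := sum_chi_sampleState F hP hψ (Finset.empty_subset _)
    have h2 : P ∅ := by
      have := (hP ∅ ∅).1 rfl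
      rwa [symmDiff_self] at this
    rw [if_pos h2] at h1
    simpa only [chi_empty, one_mul] using h1
  have key : ∀ h ∈ (Finset.range n).powerset, ∑ s ∈ (Finset.range (n + n)).powerset,
      ‖sampleState F ψ s‖ ^ 2 * failCost (t + 1) m (P h) (K h ∧ chi n h s = 1) =
      QState.normSq ψ * failCost t m (P h) (K h) := by
    intro h hh
    have h1 := sum_chi_sampleState F hP hψ (Finset.mem_powerset.1 hh)
    by_cases hK : K h
    · by_cases hPh : P h
      · rw [if_pos hPh] at h1
        -- A period would cost 1 if a sample expelled it, but its Fourier coefficient is the total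
        -- mass, so this has probability zero.
        have e : ∀ s, ‖sampleState F ψ s‖ ^ 2 * failCost (t + 1) m (P h) (K h ∧ chi n h s = 1) =
            (‖sampleState F ψ s‖ ^ 2 - chi n h s * ‖sampleState F ψ s‖ ^ 2) / 2 := by
          intro s
          rcases chi_eq_one_or n h s with h2 | h2 <;> rw [h2, failCost] <;> norm_num [hK, hPh]
        simp only [e]
        rw [← Finset.sum_div, Finset.sum_sub_distrib, total, h1]
        simp [failCost, hK, hPh]
      · rw [if_neg hPh] at h1
        -- The Fourier coefficient of a non-period vanishes, so it survives half of the mass, and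
        -- the doubled cost compensates for this.
        have e : ∀ s, ‖sampleState F ψ s‖ ^ 2 * failCost (t + 1) m (P h) (K h ∧ chi n h s = 1) =
            (‖sampleState F ψ s‖ ^ 2 + chi n h s * ‖sampleState F ψ s‖ ^ 2) * (2 ^ t / 2 ^ m) := by
          intro s
          rcases chi_eq_one_or n h s with h2 | h2 <;> rw [h2, failCost] <;> norm_num [hK, hPh]
          ring
        simp only [e]
        rw [← Finset.sum_mul, Finset.sum_add_distrib, total, h1]
        simp [failCost, hK, hPh]
    · simp only [hK, false_and, ← Finset.sum_mul, total]
      simp [failCost]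
  simp only [mul_sub, mul_one, Finset.sum_sub_distrib, total, failBound, Finset.mul_sum]
  rw [Finset.sum_comm, Finset.sum_congr rfl key]

/-- The invariant of the main loop. -/
structure SimonInv (n : ℕ) (d : Data) : Prop where
  out : d.out = []
  weight : d.weight = 1
  zero : ∀ s, s ≠ ∅ → d.ψ s = 0
  rows : IsRows n (d.mem 4) (d.rows n)

/-- The probability of a branch, reduced by the estimate of its failure probability. -/
noncomputable def Data.value (n : ℕ) (P : Finset ℕ → Prop) (t m : ℕ) (d : Data) : ℝ :=
  d.prob * (1 - failBound n t m P (SetSpan n (d.rows n)))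

theorem Data.value_congr {n : ℕ} {d d' : Data} (hp : d'.prob = d.prob) (hm : d'.mem 4 = d.mem 4)
    (P : Finset ℕ → Prop) (t m : ℕ) : d'.value n P t m = d.value n P t m := by
  have : d'.rows n = d.rows n := by funext k; rw [Data.rows, Data.rows, hm]
  rw [Data.value, Data.value, hp, this]

theorem SimonInv.same {d d' : Data} (h : SimonInv n d) {S : Finset ℕ} (h' : Data.Same S d d')
    (h4 : 4 ∉ S) : SimonInv n d' := by
  have : d'.rows n = d.rows n := by funext k; rw [Data.rows, Data.rows, h'.mem 4 h4]
  exact ⟨h'.out.trans h.out, h'.weight.trans h.weight, by rw [h'.ψ]; exact h.zero,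
    by rw [this, h'.mem 4 h4]; exact h.rows⟩

/-- The update is deterministic and replaces the span by its intersection with the annihilator of
the sample; `sum_failBound` then says that the value is preserved on average. -/
theorem tri_simonRound (hP : ∀ s t, F (toVec n s) = F (toVec n t) ↔ P (symmDiff s t)) {d : Data}
    (hd : SimonInv n d) (t m : ℕ) :
    Tri F (n * (n * 14 + 42) + 19) simonRound d
      (fun d' => SimonInv n d' ∧ d'.mem 13 = d.mem 13) (Data.value n P (t + 1) m)
      (d.value n P t m) := by
  set K := SetSpan n (d.rows n) with hK
  refine (Tri.seq (tri_sampleProgram (fun y => 1 - failBound n (t + 1) m P fun h =>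
    K h ∧ chi n h y = 1) hd.zero) (T₂ := n * (n * 14 + 20) + 5) ?_).conseq (by ring_nf; omega)
    (fun _ h => ⟨h, le_rfl⟩) ?_
  · rintro d₁ ⟨h1, h2⟩
    have e4 : d₁.mem 4 = d.mem 4 := h1.mem 4 (by simp)
    refine (det_updateProgram (g := d.rows n) (y := d₁.sample (n + n)) (by rw [e4]; exact hd.rows)
      (fun k _ => Data.rows_subset k) (fun j hj => ?_) _).conseq le_rfl ?_ le_rfl
    · simp only [Data.sample, Finset.mem_filter, Finset.mem_range]
      exact ⟨fun h => ⟨by omega, h⟩, fun h => h.2⟩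
    · rintro d₂ ⟨h3, g, hg, hgn, hgs⟩
      refine ⟨⟨⟨(h3.out.trans h1.out).trans hd.out, (h3.weight.trans h1.weight).trans hd.weight,
        by rw [h3.ψ]; exact h2, hg.isRows hgn⟩, (h3.mem 13 (by simp)).trans (h1.mem 13 (by simp))⟩, ?_⟩
      rw [Data.value, h3.prob, failBound_congr fun x => (hg.setSpan_iff hgn x).trans (hgs x)]
  · rw [sum_failBound hP hd.zero, Data.value, Data.prob, mul_assoc]

theorem det_unitRows {d : Data} (h0 : ∀ k l, d.mem 4 k l = 0) :
    Det F (n * 4 + 3) unitRows d fun d' => Data.Same {4, 12} d d' ∧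
      IsRows n (d'.mem 4) fun k => {k} := by
  refine (Det.forLoop (T := 1) (N₀ := n) (Inv := fun i d' => Data.Same {4, 12} d d' ∧
      ∀ k l, d'.mem 4 k l = if k = l ∧ k < i then 1 else 0) (fun m => rfl)
      (fun i d' v h => ⟨h.1.set (by simp) v, ?_⟩) ?_ ⟨.refl _ _, by simp [h0]⟩).conseq le_rfl ?_
  · rw [Data.set_mem_ne _ (by decide)]; exact h.2
  · rintro i hi d' ⟨h1, h2⟩ hc v
    refine Tri.assign (V := fun _ => v) ⟨⟨h1.write (by simp) _ _ _, fun k l => ?_⟩, ?_⟩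
    · simp only [Expr.eval, Memory.write_eq, hc, h2]
      by_cases hk : k = i
      · subst hk
        by_cases hl : l = k
        · simp [hl]
        · simp [hl, Ne.symm hl]
      · have : k < i + 1 ↔ k < i := by omega
        simp [hk, this]
    · dsimp only
      rw [Memory.write_ne _ (by decide), hc]
  · rintro d' ⟨h1, h2⟩
    refine ⟨h1, fun k hk j _ => ?_⟩
    rw [h2]
    simp [hk, eq_comm]

theorem good_simonProgram (hP : ∀ s t, F (toVec n s) = F (toVec n t) ↔ P (symmDiff s t))
    {A : List Bool → Prop} (hA : ∀ d : Data, (∀ x, x ⊆ Finset.range n →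
      (SetSpan n (d.rows n) x ↔ P x)) → A ((List.range n).flatMap fun k => rowOut n (d.mem 4 k))) :
    Good F A ((n + 2) * (n * (n * 14 + 42) + 22) + n * (n * 8 + 14) + 11) simonProgram.init
      (2 / 3) := by
  classical
  -- Initially each of the `2^n` vectors costs at most `2^(-m)`, so two rounds beyond `n` make the
  -- failure estimate at most 1/4.
  set m := n + 2 with hm
  have h0 : (simonProgram.init).data.prob = 1 := Program.prob_init simonProgram
  refine Tri.solves (Post := fun d => d.prob ≥ 0) (V := fun d => if A d.out then d.prob else 0)
    ?_ fun d hd => ?_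
  · refine (Tri.seq (det_unitRows (fun _ _ => rfl) _)
      (T₂ := (n + 2) * (n * (n * 14 + 42) + 22) + 3 + (n * (n * 8 + 10) + 3) + 1) ?_).conseq
      (by rw [hm]; ring_nf; omega) (fun _ h => ⟨h, le_rfl⟩) le_rfl
    rintro d ⟨h1, h2⟩
    have hsub : ∀ k < n, ({k} : Finset ℕ) ⊆ Finset.range n := fun k hk => by simpa using hk
    have hinv : SimonInv n d := by
      refine ⟨h1.out, h1.weight, fun s hs => ?_, h2.isRows hsub⟩
      rw [h1.ψ]
      exact Finsupp.single_eq_of_ne hs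
    refine (Tri.seq (Tri.forLoop (c := 13) (p := simonRound) (T := n * (n * 14 + 42) + 19) (N₀ := m)
      (Inv := fun _ d => SimonInv n d) (V := fun i d => d.value n P i m) (fun _ => rfl) ?_ ?_ hinv)
      (P₂ := fun d => d.prob ≥ 0) (V₂ := fun d => if A d.out then d.prob else 0) (T₂ := n * (n * 8 + 10) + 3) ?_).conseq le_rfl
      (fun _ h => ⟨h, le_rfl⟩) ?_
    · intro i d' v h
      have h3 : Data.Same {13} d' (d'.set 13 v) := (Data.Same.refl _ d').set (by simp) v
      exact ⟨h.same h3 (by simp), (Data.value_congr h3.prob (h3.mem 4 (by simp)) P i m).ge⟩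
    · intro i hi d' h hc
      refine (tri_simonRound hP h i m).conseq le_rfl (fun d'' h' => ⟨⟨h'.1, ?_⟩, le_rfl⟩) le_rfl
      rw [h'.2, hc]
    · intro d' hd'
      have hnn : 0 ≤ d'.prob := by
        rw [Data.prob, hd'.weight, one_mul]; exact QState.normSq_nonneg _
      refine (det_emitRows d' _).conseq le_rfl (fun d'' h3 => ?_) le_rfl
      obtain ⟨h3, h4⟩ := h3
      rw [hd'.out, List.nil_append] at h4
      refine ⟨by rw [h3.prob]; exact hnn, ?_⟩
      rw [h3.prob, h4]
      by_cases hK : ∀ x, x ⊆ Finset.range n → (SetSpan n (d'.rows n) x ↔ P x)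
      · rw [if_pos (hA d' hK), Data.value, failBound_eq_zero hK]
        simp
      · have h5 := one_le_failBound (m := m) hK
        have h6 : d'.value n P m m ≤ 0 :=
          mul_nonpos_of_nonneg_of_nonpos hnn (by linarith)
        split_ifs
        exacts [h6.trans hnn, h6]
    · have h3 : failBound n 0 m P (SetSpan n (d.rows n)) ≤ 2 ^ n / 2 ^ m :=
        failBound_zero fun x hx => (h2.setSpan_iff hsub x).2 (SetSpan.singletons hx)
      have h4 : (2 : ℝ) ^ n / 2 ^ m = 1 / 4 := by
        rw [hm, pow_add]
        field_simp
        norm_num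
      rw [Data.value, h1.prob, h0]
      linarith
  · by_cases h : A d.out
    · exact Or.inr ⟨h, by rw [if_pos h]⟩
    · exact Or.inl ⟨by rw [if_neg h], hd⟩

end

/-! ### Sets of qubits as bit vectors, and correctness of Simon's algorithm -/

theorem toVec_symmDiff {n : ℕ} (s t : Finset ℕ) :
    toVec n (symmDiff s t) = fun j => xor (toVec n s j) (toVec n t j) := by
  funext j
  by_cases h1 : j.1 ∈ s <;> by_cases h2 : j.1 ∈ t <;> simp [toVec, Finset.mem_symmDiff, h1, h2]

theorem exists_toVec_eq {n : ℕ} (x : Fin n → Bool) : ∃ s ⊆ Finset.range n, toVec n s = x := by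
  refine ⟨(Finset.univ.filter fun i => x i = true).image Fin.val, fun j hj => ?_, funext fun j => ?_⟩
  · obtain ⟨i, -, rfl⟩ := Finset.mem_image.1 hj
    simp
  · have : j.1 ∈ (Finset.univ.filter fun i => x i = true).image Fin.val ↔ x j = true := by
      simp [Fin.val_inj]
    simp only [toVec, this]
    cases x j <;> rfl

theorem SetSpan.xorSpan {n : ℕ} {G : ℕ → Finset ℕ} {s : Finset ℕ} (h : SetSpan n G s) :
    XorSpan (fun k : Fin n => toVec n (G k)) (toVec n s) := by
  induction h with
  | zero => exact XorSpan.zero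
  | add s k hk _ ih =>
    rw [toVec_symmDiff]
    exact ih.add _ (⟨k, hk⟩ : Fin n)

theorem XorSpan.exists_setSpan {n : ℕ} {G : ℕ → Finset ℕ} {x : Fin n → Bool}
    (h : XorSpan (fun k : Fin n => toVec n (G k)) x) : ∃ s, SetSpan n G s ∧ toVec n s = x := by
  induction h with
  | zero => exact ⟨∅, .zero, by funext j; simp [toVec]⟩
  | add x k _ ih =>
    obtain ⟨s, hs, rfl⟩ := ih
    exact ⟨_, hs.add s k k.2, toVec_symmDiff _ _⟩

open FirstOrder
variable {L : Language} [L.Structure Bool]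

/-- If the sum of three elements modulo 2 is a term operation then Simon's algorithm works. -/
theorem hasQuantumAlgorithm_of_minority (h : cloneAP ⊆ termClone L Bool) :
    HasQuantumAlgorithm L (generatorFormat L) := by
  have hL : (⟨3, opMin⟩ : Operation Bool) ∈ termClone L Bool := h (InClone.basic _ rfl)
  refine ⟨simonProgram, (Polynomial.X + 2) * (Polynomial.X * (Polynomial.X * 14 + 42) + 22) +
    Polynomial.X * (Polynomial.X * 8 + 14) + 11, fun n I => ?_⟩
  have hc := I.isCongruence_kernel.compatible hL
  have e0 : toVec n ∅ = fun _ => false := by funext j; simp [toVec]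
  let P : Finset ℕ → Prop := fun s => I.kernel (toVec n ∅) (toVec n s)
  have hP : ∀ s t, I.oracle (toVec n s) = I.oracle (toVec n t) ↔ P (symmDiff s t) := by
    intro s t
    rw [← I.kernel_iff]
    change _ ↔ I.kernel (toVec n ∅) (toVec n (symmDiff s t))
    rw [toVec_symmDiff, e0]
    constructor
    · intro h1
      have := rel_iff_of_minority hc _ _ (toVec n t) h1
      simp only [Bool.xor_self] at this
      exact I.kernel.symm this
    · intro h1
      have := rel_iff_of_minority hc _ _ (toVec n t) h1
      simp only [Bool.false_xor, Bool.xor_assoc, Bool.xor_self, Bool.xor_false] at this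
      exact I.kernel.symm this
  have hg : Good I.oracle (fun o => generatorFormat L n o = I.kernel)
      ((n + 2) * (n * (n * 14 + 42) + 22) + n * (n * 8 + 14) + 11) simonProgram.init (2 / 3) := by
    refine good_simonProgram hP fun d hd => ?_
    rw [generatorFormat_rows]
    have e : (fun k : Fin n => ((fun _ => false : Fin n → Bool), fun j : Fin n =>
        decide (d.mem 4 k j ≠ 0))) = fun k : Fin n => ((fun _ => false : Fin n → Bool),
          toVec n (d.rows n k)) := by
      funext k
      congr 1
      funext j
      simp [toVec, Data.rows]
    rw [e]
    refine congruenceGen_eq_of_minority hL I.isCongruence_kernel fun x => ?_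
    rw [← e0]
    constructor
    · intro h1
      obtain ⟨s, hs, rfl⟩ := exists_toVec_eq x
      exact ((hd s hs).2 h1).xorSpan
    · intro h1
      obtain ⟨s, hs, rfl⟩ := h1.exists_setSpan
      exact (hd s (hs.subset fun k _ => Data.rows_subset k)).1 hs
  have e : ((Polynomial.X + 2) * (Polynomial.X * (Polynomial.X * 14 + 42) + 22) +
      Polynomial.X * (Polynomial.X * 8 + 14) + 11 : Polynomial ℕ).eval n =
      (n + 2) * (n * (n * 14 + 42) + 22) + n * (n * 8 + 14) + 11 := by simp
  rw [e]
  exact ⟨fun c hc _ => hg.1 c hc, hg.2⟩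

end HKP

/-- `Bool` carries the structure of an arbitrary two-element algebra `B` in the algebraic language
`L`. Algorithms are shown to exist for the output of a list of generators; that there are none is
shown for every output format. -/
theorem theorem5p5 (L : FirstOrder.Language) [L.IsAlgebraic] [L.Structure Bool] :
    -- one of the three cases always applies
    ((HKP.cloneMPT0 ⊆ HKP.termClone L Bool ∨ HKP.cloneMPT1 ⊆ HKP.termClone L Bool ∨
        HKP.cloneDM ⊆ HKP.termClone L Bool) ∨
      (HKP.cloneAP ⊆ HKP.termClone L Bool ∧ HKP.termClone L Bool ⊆ HKP.cloneA) ∨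
      (HKP.termClone L Bool ⊆ HKP.cloneMeet ∨ HKP.termClone L Bool ⊆ HKP.cloneJoin ∨
        HKP.termClone L Bool ⊆ HKP.cloneU)) ∧
    -- both classical and quantum polynomial-time algorithms
    ((HKP.cloneMPT0 ⊆ HKP.termClone L Bool ∨ HKP.cloneMPT1 ⊆ HKP.termClone L Bool ∨
        HKP.cloneDM ⊆ HKP.termClone L Bool) →
      HKP.HasDeterministicAlgorithm L (HKP.generatorFormat L) ∧
      HKP.HasQuantumAlgorithm L (HKP.generatorFormat L)) ∧
    -- quantum but no classical polynomial-time algorithms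
    (HKP.cloneAP ⊆ HKP.termClone L Bool ∧ HKP.termClone L Bool ⊆ HKP.cloneA →
      HKP.HasQuantumAlgorithm L (HKP.generatorFormat L) ∧
      ∀ fmt : HKP.OutputFormat, ¬ HKP.HasClassicalAlgorithm L fmt) ∧
    -- neither quantum nor classical polynomial-time algorithms
    ((HKP.termClone L Bool ⊆ HKP.cloneMeet ∨ HKP.termClone L Bool ⊆ HKP.cloneJoin ∨
        HKP.termClone L Bool ⊆ HKP.cloneU) →
      ∀ fmt : HKP.OutputFormat,
        ¬ HKP.HasQuantumAlgorithm L fmt ∧ ¬ HKP.HasClassicalAlgorithm L fmt) := by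
  exact ⟨HKP.clone_trichotomy _,
    fun h => ⟨HKP.hasDeterministicAlgorithm h, (HKP.hasDeterministicAlgorithm h).quantum⟩,
    fun h => ⟨HKP.hasQuantumAlgorithm_of_minority h.1, HKP.not_hasClassicalAlgorithm h.2⟩,
    fun h fmt => ⟨HKP.not_hasQuantumAlgorithm_of_le h fmt,
      fun hc => HKP.not_hasQuantumAlgorithm_of_le h fmt hc.quantum⟩⟩
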